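/- Let $K=\mathbb F_q$ be a finite field of odd characteristic $p$, let $n\ge 1$, and let $F$ be a field of characteristic $2$ containing a primitive $p$-th root of unity. Let $V=K^{2n}$ have basis $u_1,\dots,u_n,v_1,\dots,v_n$ and the alternating form with $\langle u_i,v_j\rangle=\delta_{ij}$, $\langle u_i,u_j\rangle=\langle v_i,v_j\rangle=0$; put $M=\mathrm{span}(u_i)$, $N=\mathrm{span}(v_i)$ and $\mathrm{Sp}=\mathrm{Sp}_{2n}(q)=\mathrm{Sp}(V)$. Let $\mathrm{Sp}^M$ be the pointwise stabilizer of $M$, and $\mathrm{Sp}_{M,N}=\{\mathrm{diag}(A,{}^tA^{-1}):A\in\mathrm{GL}_n(q)\}$ the common stabilizer of $M$ and $N$. **Steinberg module.** Let $U$ be generated by $\mathrm{Sp}^M$ and the elements $\mathrm{diag}(A,{}^tA^{-1})$ with $A$ upper unitriangular, let $H$ be the group of all $g\in\mathrm{Sp}$ having every $u_i$ and every $v_j$ as eigenvectors, and let $B=UH$. Let $w_i=(u_i,u_{i+1})(v_i,v_{i+1})$ for $1\le i<n$, and let $c_j$ be given by $u_j\mapsto v_j$, $v_j\mapsto -u_j$,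 the other basis vectors being fixed. Let $W_2=\langle w_1,\dots,w_{n-1},c_1,\dots,c_n\rangle$, let $W=W_2/(W_2\cap H)$ be the Weyl group, $\ell$ the length on $W$ with respect to $w_1,\dots,w_{n-1},c_n$, and $n_w\in W_2$ a representative of $w\in W$. Put $e=\big(\sum_{w\in W}(-1)^{\ell(w)}n_w\big)\sum_{b\in B}b\in F\mathrm{Sp}$. The Steinberg module is the left ideal $I=F\mathrm{Sp}\cdot e$; let $S$ be its socle. **Weil modules.** Let $\lambda:K^+\to F^*$ be a non-trivial linear character, and let $Y$ be the $F$-space with basis $(\epsilon_v)_{v\in N}$. For $\alpha\in K$, $u\in M$ and $v\in N$ let $J(\alpha,u+v)\epsilon_w=\lambda(\alpha+\langle u,v+2w\rangle)\epsilon_{w+v}$ $(w\in N)$. The Weil representation of type $\lambda$ is the representation $P:\mathrm{Sp}\to\mathrm{GL}(Y)$ that satisfies $P(g)J(\alpha,x)P(g)^{-1}=J(\alpha,gx)$ for all $g\in\mathrm{Sp}$, $\alpha\in K$, $x\in V$, that satisfies $P(sa)\epsilon_v=\lambda(\langle s(av),av\rangle)\,\epsilon_{av}$ for $s\in\mathrm{Sp}^M$,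 $a\in\mathrm{Sp}_{M,N}$, $v\in N$, and that satisfies $P(\rho)\epsilon_v=\sum_{\alpha\in K}\lambda(\alpha^2)\epsilon_{v+\alpha v_n}$ for $v\in N$, where $\rho(x)=x-\langle v_n,x\rangle v_n$. The subspace $Y^-=\mathrm{span}\{\epsilon_v-\epsilon_{-v}:v\in N\}$ is $\mathrm{Sp}$-stable; it is called the Weil module of type $\lambda$ and degree $(q^n-1)/2$. **Theorem.** The socle $S$ of $I$ is one-dimensional over $F$ and $\mathrm{Sp}$ acts trivially on it. For every non-trivial $\lambda$ the Weil representation of type $\lambda$ exists and is unique. The module $I/S$ contains two non-isomorphic irreducible submodules $M_1$, $M_2$, both of dimension $(q^n-1)/2$, such that each of them is isomorphic to a Weil module of degree $(q^n-1)/2$, and every Weil module of degree $(q^n-1)/2$ of $\mathrm{Sp}_{2n}(q)$ over $F$, of whatever type $\lambda$, is isomorphic to $M_1$ or to $M_2$. -/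

import Mathlib

open scoped MonoidAlgebra Matrix

noncomputable section

namespace SteinbergWeil

/-- The symplectic group `Sp_{2n}(K)`, acting on `V = K^{2n} = M ⊕ N`: the coordinates indexed by
`Sum.inl i` are those along the basis `u_i` of `M`, the ones indexed by `Sum.inr i` those along the
basis `v_i` of `N`. -/
abbrev Sp (n : ℕ) (K : Type*) [Field K] : Type _ := ↥(Matrix.symplecticGroup (Fin n) K)

section Group

variable {n : ℕ} {K : Type*} [Field K]

/-- The alternating form on `V`, with `⟨u_i, v_j⟩ = δ_{ij}` and `M`, `N` totally isotropic. -/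
def form (x y : Fin n ⊕ Fin n → K) : K :=
  ∑ i, (x (Sum.inl i) * y (Sum.inr i) - x (Sum.inr i) * y (Sum.inl i))

/-- The inclusion of `M` in `V`. -/
def inM (x : Fin n → K) : Fin n ⊕ Fin n → K := Sum.elim x 0

/-- The inclusion of `N` in `V`. -/
def inN (x : Fin n → K) : Fin n ⊕ Fin n → K := Sum.elim 0 x

/-- The action of a symplectic matrix on `V`. -/
def act (g : Sp n K) (x : Fin n ⊕ Fin n → K) : Fin n ⊕ Fin n → K :=
  (g : Matrix (Fin n ⊕ Fin n) (Fin n ⊕ Fin n) K) *ᵥ x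

theorem act_one (x : Fin n ⊕ Fin n → K) : act 1 x = x := by simp [act]

theorem act_mul (g h : Sp n K) (x : Fin n ⊕ Fin n → K) : act (g * h) x = act g (act h x) := by
  simp [act]

theorem form_eq (x y : Fin n ⊕ Fin n → K) :
    form x y = -(x ⬝ᵥ (Matrix.J (Fin n) K *ᵥ y)) := by
  simp only [form, Matrix.J, dotProduct, Matrix.mulVec, Fintype.sum_sum_type,
    Matrix.fromBlocks_apply₁₁, Matrix.fromBlocks_apply₁₂, Matrix.fromBlocks_apply₂₁,
    Matrix.fromBlocks_apply₂₂, Matrix.zero_apply, Matrix.neg_apply, Matrix.one_apply]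
  simp [Finset.sum_sub_distrib]
  ring

/-- A matrix is symplectic if and only if it preserves the form. -/
theorem mem_symplecticGroup_iff_form (A : Matrix (Fin n ⊕ Fin n) (Fin n ⊕ Fin n) K) :
    A ∈ Matrix.symplecticGroup (Fin n) K ↔ ∀ x y, form (A *ᵥ x) (A *ᵥ y) = form x y := by
  have key : ∀ x y, form (A *ᵥ x) (A *ᵥ y) =
      -(x ⬝ᵥ ((Aᵀ * Matrix.J (Fin n) K * A) *ᵥ y)) := by
    intro x y
    rw [form_eq, ← Matrix.mulVec_mulVec, ← Matrix.mulVec_mulVec, Matrix.dotProduct_mulVec x Aᵀ,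
      Matrix.vecMul_transpose]
  rw [SymplecticGroup.mem_iff']
  constructor
  · intro h x y
    rw [key, h, form_eq]
  · intro h
    ext i j
    have := h (Pi.single i 1) (Pi.single j 1)
    rw [key, form_eq, neg_inj] at this
    simpa using this

/-- The embedding `A ↦ diag(A, ᵗA⁻¹)` of `GL_n(K)`; its image is the common stabilizer `Sp_{M,N}`
of `M` and `N`. -/
def levi : GL (Fin n) K →* Sp n K where
  toFun A := ⟨Matrix.fromBlocks (A : Matrix (Fin n) (Fin n) K) 0 0
      ((A⁻¹ : GL (Fin n) K) : Matrix (Fin n) (Fin n) K)ᵀ, by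
    rw [SymplecticGroup.mem_iff]
    simp only [Matrix.J, Matrix.fromBlocks_multiply, Matrix.fromBlocks_transpose]
    simp [← Matrix.transpose_mul]⟩
  map_one' := by
    ext1
    simp
  map_mul' A B := by
    ext1
    simp only [Submonoid.coe_mul, Matrix.fromBlocks_multiply]
    simp [mul_inv_rev]

/-- The action of `diag(A, ᵗA⁻¹)` on `N`. -/
def leviN (A : GL (Fin n) K) (v : Fin n → K) : Fin n → K :=
  ((A⁻¹ : GL (Fin n) K) : Matrix (Fin n) (Fin n) K)ᵀ *ᵥ v

/-- The pointwise stabilizer `Sp^M` of `M`. -/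
def fixM (n : ℕ) (K : Type*) [Field K] : Subgroup (Sp n K) where
  carrier := {g | ∀ x : Fin n → K, act g (inM x) = inM x}
  one_mem' x := act_one _
  mul_mem' {a b} ha hb x := by rw [act_mul, hb, ha]
  inv_mem' {a} ha x := by
    have h : act a⁻¹ (act a (inM x)) = inM x := by rw [← act_mul, inv_mul_cancel, act_one]
    rwa [ha x] at h

/-- The group of upper triangular matrices with `1`'s on the diagonal. -/
def unitriangular (n : ℕ) (K : Type*) [Field K] : Subgroup (GL (Fin n) K) where
  carrier := {A | (∀ i j, j < i → (A : Matrix (Fin n) (Fin n) K) i j = 0) ∧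
    ∀ i, (A : Matrix (Fin n) (Fin n) K) i i = 1}
  one_mem' := ⟨fun i j h => by simp [h.ne'], fun i => by simp⟩
  mul_mem' {A B} hA hB := by
    refine ⟨fun i j h => ?_, fun i => ?_⟩
    · rw [Units.val_mul, Matrix.mul_apply]
      refine Finset.sum_eq_zero fun k _ => ?_
      rcases lt_or_ge k i with hk | hk
      · rw [hA.1 i k hk, zero_mul]
      · rw [hB.1 k j (lt_of_lt_of_le h hk), mul_zero]
    · rw [Units.val_mul, Matrix.mul_apply, Finset.sum_eq_single i, hA.2, hB.2, mul_one]
      · intro k _ hk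
        rcases lt_or_gt_of_ne hk with hk | hk
        · rw [hA.1 i k hk, zero_mul]
        · rw [hB.1 k i hk, mul_zero]
      · simp
  inv_mem' {A} hA := by
    have : Invertible (A : Matrix (Fin n) (Fin n) K) := A.invertible
    have hT : (A : Matrix (Fin n) (Fin n) K).BlockTriangular id := fun i j h => hA.1 i j h
    have hI := Matrix.blockTriangular_inv_of_blockTriangular hT
    have hI' : ∀ i j, j < i → ((A⁻¹ : GL (Fin n) K) : Matrix (Fin n) (Fin n) K) i j = 0 := by
      intro i j h
      rw [Matrix.coe_units_inv]
      exact hI h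
    refine ⟨hI', fun i => ?_⟩
    have h1 : ((A : Matrix (Fin n) (Fin n) K) *
        ((A⁻¹ : GL (Fin n) K) : Matrix (Fin n) (Fin n) K)) i i = 1 := by
      rw [← Units.val_mul, mul_inv_cancel]
      simp
    rw [Matrix.mul_apply, Finset.sum_eq_single i, hA.2, one_mul] at h1
    · exact h1
    · intro k _ hk
      rcases lt_or_gt_of_ne hk with hk | hk
      · rw [hA.1 i k hk, zero_mul]
      · rw [hI' k i hk, mul_zero]
    · simp

/-- The Sylow `p`-subgroup `U = T ⋉ Sp^M`, where `T` is the group of all `diag(A, ᵗA⁻¹)` with `A`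
upper unitriangular. -/
def sylowU (n : ℕ) (K : Type*) [Field K] : Subgroup (Sp n K) :=
  (unitriangular n K).map levi ⊔ fixM n K

/-- The group `H` of all symplectic transformations for which every `u_i` and every `v_j` is an
eigenvector. -/
def torusH (n : ℕ) (K : Type*) [Field K] : Subgroup (Sp n K) where
  carrier := {g | ∀ i : Fin n ⊕ Fin n, ∃ c : K,
    act g (Pi.single i 1) = c • (Pi.single i 1 : Fin n ⊕ Fin n → K)}
  one_mem' i := ⟨1, by rw [act_one, one_smul]⟩
  mul_mem' {a b} ha hb i := by
    obtain ⟨c, hc⟩ := ha i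
    obtain ⟨d, hd⟩ := hb i
    refine ⟨d * c, ?_⟩
    rw [act_mul, hd, act, Matrix.mulVec_smul, ← act, hc, smul_smul]
  inv_mem' {a} ha i := by
    obtain ⟨c, hc⟩ := ha i
    have h : act a⁻¹ (act a (Pi.single i 1)) = (Pi.single i 1 : Fin n ⊕ Fin n → K) := by
      rw [← act_mul, inv_mul_cancel, act_one]
    rw [hc, act, Matrix.mulVec_smul, ← act] at h
    have hc0 : c ≠ 0 := by
      rintro rfl
      rw [zero_smul] at h
      simpa using congrFun h i
    refine ⟨c⁻¹, ?_⟩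
    conv_rhs => rw [← h]
    rw [smul_smul, inv_mul_cancel₀ hc0, one_smul]

/-- The Borel subgroup `B = U ⋊ H`. -/
def borelB (n : ℕ) (K : Type*) [Field K] : Subgroup (Sp n K) := sylowU n K ⊔ torusH n K

/-- The symplectic transformation that interchanges `u_i, u_j` and interchanges `v_i, v_j`, and
fixes the other basis vectors. -/
def swapSp (i j : Fin n) : Sp n K :=
  ⟨Matrix.fromBlocks ((Equiv.swap i j).permMatrix K) 0 0 ((Equiv.swap i j).permMatrix K), by
    rw [SymplecticGroup.mem_iff]
    simp only [Matrix.J, Matrix.fromBlocks_multiply, Matrix.fromBlocks_transpose]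
    simp [← Matrix.permMatrix_mul, Matrix.transpose_permMatrix]⟩

/-- The symplectic transformation `c_j`: `u_j ↦ v_j`, `v_j ↦ -u_j`, all other basis vectors being
fixed. -/
def cSp (j : Fin n) : Sp n K :=
  ⟨Matrix.fromBlocks (1 - Matrix.single j j 1) (-Matrix.single j j 1)
      (Matrix.single j j 1) (1 - Matrix.single j j 1), by
    rw [SymplecticGroup.mem_iff]
    simp only [Matrix.J, Matrix.fromBlocks_multiply, Matrix.fromBlocks_transpose]
    simp [mul_sub, sub_mul]
    abel⟩

/-- The letters `w_1, …, w_{n-1}, c_n`, with `w_i = (u_i, u_{i+1})(v_i, v_{i+1})`. -/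
def simpleReflections (n : ℕ) (K : Type*) [Field K] : Set (Sp n K) :=
  {g | ∃ i j : Fin n, (i : ℕ) + 1 = j ∧ g = swapSp i j} ∪
  {g | ∃ i : Fin n, (i : ℕ) + 1 = n ∧ g = cSp i}

/-- The group `W₂` generated by `w_1, …, w_{n-1}, c_1, …, c_n`. The Weyl group is
`W₂H/H = W₂/(W₂ ∩ H)`. -/
def groupW₂ (n : ℕ) (K : Type*) [Field K] : Subgroup (Sp n K) :=
  Subgroup.closure ({g | ∃ i j : Fin n, (i : ℕ) + 1 = j ∧ g = swapSp i j} ∪ Set.range cSp)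

/-- The Weyl group as the set of cosets of `W₂ ∩ H` in `W₂`. -/
abbrev Weyl (n : ℕ) (K : Type*) [Field K] : Type _ :=
  ↥(groupW₂ n K) ⧸ (torusH n K).subgroupOf (groupW₂ n K)

/-- The length of `gH`: the least `k` such that `gH = s_1 ⋯ s_k H` with letters `s_i` among
`w_1, …, w_{n-1}, c_n` (which are involutions modulo `H`). -/
def length (g : Sp n K) : ℕ :=
  sInf {k | ∃ L : List (Sp n K), L.length = k ∧ (∀ s ∈ L, s ∈ simpleReflections n K) ∧
    L.prod⁻¹ * g ∈ torusH n K}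

theorem form_swap (a b : Fin n ⊕ Fin n → K) : form a b = -form b a := by
  simp only [form, ← Finset.sum_neg_distrib]
  exact Finset.sum_congr rfl fun i _ => by ring

theorem form_self (a : Fin n ⊕ Fin n → K) : form a a = 0 := by
  simp only [form]
  exact Finset.sum_eq_zero fun i _ => by ring

theorem form_add_smul (a b c : Fin n ⊕ Fin n → K) (t : K) :
    form a (b + t • c) = form a b + t * form a c := by
  simp only [form, Finset.mul_sum, ← Finset.sum_add_distrib, Pi.add_apply, Pi.smul_apply,
    smul_eq_mul]
  exact Finset.sum_congr rfl fun i _ => by ring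

/-- The matrix of the map `x ↦ x + α⟨u, x⟩u`. -/
def transvectionMatrix (u : Fin n ⊕ Fin n → K) (α : K) :
    Matrix (Fin n ⊕ Fin n) (Fin n ⊕ Fin n) K :=
  1 + α • Matrix.vecMulVec u (fun k => form u (Pi.single k 1))

theorem transvectionMatrix_mulVec (u x : Fin n ⊕ Fin n → K) (α : K) :
    transvectionMatrix u α *ᵥ x = x + (α * form u x) • u := by
  have hlin : (fun k => form u (Pi.single k 1)) ⬝ᵥ x = form u x := by
    simp only [form, dotProduct, Fintype.sum_sum_type, Pi.single_apply]
    simp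
    rw [← sub_eq_neg_add, ← Finset.sum_sub_distrib]
  rw [transvectionMatrix, Matrix.add_mulVec, Matrix.one_mulVec, Matrix.smul_mulVec,
    Matrix.vecMulVec_mulVec, hlin, mul_smul]
  simp

/-- The symplectic transvection `ρ_{u,α} : x ↦ x + α⟨u, x⟩u`. -/
def transvection (u : Fin n ⊕ Fin n → K) (α : K) : Sp n K :=
  ⟨transvectionMatrix u α, by
    rw [mem_symplecticGroup_iff_form]
    intro x y
    rw [transvectionMatrix_mulVec, transvectionMatrix_mulVec, form_add_smul,
      form_swap _ y, form_swap _ u, form_add_smul, form_add_smul, form_self, form_swap y x,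
      form_swap y u]
    ring⟩

end Group

section Steinberg

/-- The element `e = (∑_{w ∈ W} (-1)^{ℓ(w)} n_w) (∑_{b ∈ B} b)` of the group algebra, where `n_w`
is a representative of `w` in `W₂`. -/
def steinbergElement (n : ℕ) (K : Type*) [Field K] [Finite K] (F : Type*) [Field F] :
    F[Sp n K] :=
  letI : Fintype (Weyl n K) := Fintype.ofFinite _
  letI : Fintype (borelB n K) := Fintype.ofFinite _
  (∑ w : Weyl n K, MonoidAlgebra.single ((Quotient.out w : groupW₂ n K) : Sp n K)
      ((-1 : F) ^ length ((Quotient.out w : groupW₂ n K) : Sp n K))) *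
    ∑ b : borelB n K, MonoidAlgebra.single (b : Sp n K) (1 : F)

/-- The Steinberg module: the left ideal `F[Sp] e` of the group algebra. -/
def steinbergModule (n : ℕ) (K : Type*) [Field K] [Finite K] (F : Type*) [Field F] :
    Submodule F[Sp n K] F[Sp n K] :=
  Submodule.span F[Sp n K] {steinbergElement n K F}

/-- The socle of a module: the sum of its simple submodules. -/
def socle (R : Type*) [Ring R] (M : Type*) [AddCommGroup M] [Module R M] : Submodule R M :=
  sSup {N : Submodule R M | IsSimpleModule R N}

/-- The socle of the Steinberg module. -/
abbrev steinbergSocle (n : ℕ) (K : Type*) [Field K] [Finite K] (F : Type*) [Field F] :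
    Submodule F[Sp n K] (steinbergModule n K F) :=
  socle F[Sp n K] (steinbergModule n K F)

end Steinberg

section Weil

variable {n : ℕ} {K : Type*} [Field K] {F : Type*} [Field F]

/-- The space `Y`, with basis `ε_v` indexed by `v ∈ N`. -/
abbrev WeilSpace (n : ℕ) (K F : Type*) [Field F] : Type _ := (Fin n → K) →₀ F

/-- The basis vector `ε_v` of `Y`. -/
def eps (F : Type*) [Field F] (v : Fin n → K) : WeilSpace n K F := Finsupp.single v 1

/-- The Schrödinger representation of type `ψ` of the Heisenberg group `K × V` (with product
`(α, x)(β, y) = (α + β + ⟨x, y⟩, x + y)`):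
`J(α, u + v) ε_w = ψ(α + ⟨u, v + 2w⟩) ε_{w + v}` for `u ∈ M`, `v ∈ N`. -/
def schrodinger (ψ : AddChar K F) (α : K) (x : Fin n ⊕ Fin n → K) :
    WeilSpace n K F →ₗ[F] WeilSpace n K F :=
  Finsupp.linearCombination F fun w =>
    ψ (α + form (inM (x ∘ Sum.inl)) (inN (x ∘ Sum.inr + 2 • w))) • eps F (w + x ∘ Sum.inr)

/-- `χ_v(g) = ψ(⟨gv, v⟩)`. -/
def chi (ψ : AddChar K F) (v : Fin n ⊕ Fin n → K) (g : Sp n K) : F := ψ (form (act g v) v)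

open Classical in
/-- The quadratic character `θ` of the determinant on `N` of `diag(A, ᵗA⁻¹)`, with values in `F`. -/
def theta (F : Type*) [Field F] (A : GL (Fin n) K) : F :=
  if IsSquare (((A⁻¹ : GL (Fin n) K) : Matrix (Fin n) (Fin n) K)ᵀ).det then 1 else -1

/-- `P` is the Weil representation of type `ψ` of `Sp_{2n}(K)`: it intertwines the Schrödinger
representation with its conjugates under `Sp_{2n}(K)`, and it is given by the explicit formulae on
the stabilizer of `M` and on the transvection `ρ_{v_n,-1}`, which generate `Sp_{2n}(K)`. (When `F`
has characteristic `2`, both `θ` and the Gauss sum `∑ ψ(α²)` are equal to `1`.) -/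
structure IsWeilRepresentation [Fintype K] (ψ : AddChar K F)
    (P : Representation F (Sp n K) (WeilSpace n K F)) : Prop where
  intertwines : ∀ (g : Sp n K) (α : K) (x : Fin n ⊕ Fin n → K),
    P g ∘ₗ schrodinger ψ α x = schrodinger ψ α (act g x) ∘ₗ P g
  parabolic : ∀ s ∈ fixM n K, ∀ (A : GL (Fin n) K) (v : Fin n → K),
    P (s * levi A) (eps F v) =
      (theta F A ^ n * chi ψ (inN (leviN A v)) s) • eps F (leviN A v)
  transvection : ∀ i : Fin n, (i : ℕ) + 1 = n → ∀ v : Fin n → K,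
    P (transvection (inN (Pi.single i 1)) (-1)) (eps F v) =
      (∑ α : K, ψ (α ^ 2))⁻¹ • ∑ α : K, ψ (α ^ 2) • eps F (v + α • Pi.single i 1)

/-- The subspace `Y⁻` of `Y` spanned by the vectors `ε_v - ε_{-v}`. -/
def weilMinus (n : ℕ) (K : Type*) [Field K] (F : Type*) [Field F] :
    Submodule F (WeilSpace n K F) :=
  Submodule.span F (Set.range fun v : Fin n → K => eps F v - eps F (-v))

theorem coe_inv_neg_one :
    (((-1 : GL (Fin n) K)⁻¹ : GL (Fin n) K) : Matrix (Fin n) (Fin n) K) = -1 := by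
  rw [inv_neg, inv_one, Units.val_neg, Units.val_one]

theorem levi_neg_one_comm (g : Sp n K) :
    g * levi (-1 : GL (Fin n) K) = levi (-1 : GL (Fin n) K) * g := by
  have h : ((levi (-1 : GL (Fin n) K) : Sp n K) :
      Matrix (Fin n ⊕ Fin n) (Fin n ⊕ Fin n) K) = -1 := by
    rw [← Matrix.fromBlocks_one, Matrix.fromBlocks_neg]
    simp only [levi, MonoidHom.coe_mk, OneHom.coe_mk, coe_inv_neg_one]
    simp
  ext1
  simp [h]

theorem theta_ne_zero (A : GL (Fin n) K) : theta F A ≠ 0 := by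
  unfold theta
  split_ifs <;> simp

/-- `Y⁻` is stable under the Weil representation. -/
theorem IsWeilRepresentation.apply_mem_weilMinus [Fintype K] {ψ : AddChar K F}
    {P : Representation F (Sp n K) (WeilSpace n K F)} (hP : IsWeilRepresentation ψ P)
    (g : Sp n K) ⦃y : WeilSpace n K F⦄ (hy : y ∈ weilMinus n K F) :
    P g y ∈ weilMinus n K F := by
  let σ : WeilSpace n K F →ₗ[F] WeilSpace n K F := Finsupp.lmapDomain F F (fun v => -v)
  have hσ : ∀ v : Fin n → K, σ (eps F v) = eps F (-v) := fun v => by simp [σ, eps]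
  have hc : theta F (-1 : GL (Fin n) K) ^ n ≠ 0 := pow_ne_zero _ (theta_ne_zero _)
  have hPσ : P (levi (-1 : GL (Fin n) K)) = (theta F (-1 : GL (Fin n) K) ^ n) • σ := by
    refine Finsupp.lhom_ext' fun v => LinearMap.ext_ring ?_
    have h := hP.parabolic 1 (one_mem _) (-1 : GL (Fin n) K) v
    have hv : leviN (-1 : GL (Fin n) K) v = -v := by
      rw [leviN, coe_inv_neg_one, Matrix.transpose_neg, Matrix.transpose_one, Matrix.neg_mulVec,
        Matrix.one_mulVec]
    rw [one_mul, hv, chi, act_one, form_self, AddChar.map_zero_eq_one, mul_one] at h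
    have h2 := hσ v
    simp only [eps] at h h2
    simp [h, h2]
  have hcomm : ∀ z, P g (σ z) = σ (P g z) := by
    intro z
    have h1 : P g (P (levi (-1 : GL (Fin n) K)) z) = P (levi (-1 : GL (Fin n) K)) (P g z) := by
      rw [← Module.End.mul_apply, ← Module.End.mul_apply, ← map_mul, ← map_mul,
        levi_neg_one_comm]
    rw [hPσ] at h1
    simp only [LinearMap.smul_apply, map_smul] at h1
    exact smul_right_injective _ hc h1
  have hsub : ∀ z : WeilSpace n K F, z - σ z ∈ weilMinus n K F := by
    intro z
    induction z using Finsupp.induction_linear with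
    | zero => simp
    | add a b ha hb =>
      rw [map_add, add_sub_add_comm]
      exact add_mem ha hb
    | single v t =>
      have ht : (Finsupp.single v t : WeilSpace n K F) = t • eps F v := by simp [eps]
      rw [ht, map_smul, hσ, ← smul_sub]
      exact Submodule.smul_mem _ _ (Submodule.subset_span ⟨v, rfl⟩)
  refine Submodule.span_induction (p := fun y _ => P g y ∈ weilMinus n K F) ?_ ?_ ?_ ?_ hy
  · rintro _ ⟨v, rfl⟩
    have h := hsub (P g (eps F v))
    rwa [← hcomm, hσ, ← map_sub] at h
  · simp
  · intro a b _ _ ha hb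
    rw [map_add]
    exact add_mem ha hb
  · intro t a _ ha
    rw [map_smul]
    exact Submodule.smul_mem _ _ ha

/-- The Weil module of degree `(q^n - 1)/2` attached to a Weil representation, as a module over the
group algebra. -/
def weilModule [Fintype K] {ψ : AddChar K F}
    {P : Representation F (Sp n K) (WeilSpace n K F)} (hP : IsWeilRepresentation ψ P) :
    Submodule F[Sp n K] P.asModule :=
  Subrepresentation.asSubmodule ⟨weilMinus n K F, hP.apply_mem_weilMinus⟩

end Weil

end SteinbergWeil

end

/-! Write q for |K|, U for the unitriangular group, e for the Steinberg element and z for the sum of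
all elements of Sp. Everything rests on `sum_even`: q is odd and F has characteristic 2, so the sum
of an even function over a K-vector space is its value at 0. For the same reason |U| and |Sp^M| are
1 in F, and q - 1 is 0.

Weil representation. The operator `weilOp ψ g` = ∑_x J(gx)J(-x) intertwines the Schrödinger
representation with its conjugate by g. Its matrix coefficient at ε_0 is the sum of an even
function, hence 1. Schur's lemma (`eq_smul_one_of_commute`) makes intertwiners unique up to a
scalar, and the normalization at ε_0 survives products (`coeffZero_weilOp_mul`), so `weilOp ψ` is
multiplicative. Any explicit intertwiner with coefficient 1 at ε_0 must be the Weil operator, which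
yields the prescribed formulae. They cover generators of Sp, whence uniqueness.

Socle. The signs disappear in F, and e is the indicator function of the apartment, the union of the
cosets wB. For a simple reflection s with root elements x_t one has s x_t e = e + x_{κ/t} e for t ≠
0 (`IsSimpleReflection.exists_mul_root_mul`). Consequently I lies in the span of the U-translates of
e, and ∑_u ue is Sp-invariant, hence equal to z. If a nonzero element of I is translated so as to
have a nonzero coefficient at 1, its U-sum is a nonzero multiple of z. Thus every nonzero submodule
of I contains z, and S = Fz.

Embedding. The map y ↦ ∑_g (P(g⁻¹)y)_0 g is equivariant and sends ε_0 to z. Its image lies in I: the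
group U acts on ε_{v_n} through a linear character μ, the Bruhat decomposition shows that ε_{v_n}
goes to ∑_u μ(u)u⁻¹e (`matrixCoeff_eps_last`), and GL_n moves v_n to every nonzero v. Modulo S the
map kills precisely the vectors fixed by ε_v ↦ ε_{-v}, that is, the kernel of `1 - flip`, an
operator with image Y⁻. Since Y⁻ is irreducible (`weilMinus_le_of_stable`), I/S contains a simple
copy of Y⁻.

Two classes. Every type is ψ(a·) for a fixed nontrivial ψ. The map ε_w ↦ ε_{bw} identifies types
that differ by the square b², and the characters of Sp^M on Y⁻ separate types that differ by a
nonsquare. -/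

noncomputable section

namespace SteinbergWeil

/-! ### Sums of even functions in characteristic two. -/

section EvenSums

/-- In characteristic two, the sum of an even function over a finite group without `2`-torsion is
its value at the origin. -/
theorem sum_even {V : Type*} [AddCommGroup V] [Fintype V] (hV : ∀ x : V, -x = x → x = 0)
    {A : Type*} [AddCommMonoid A] (hA : ∀ a : A, a + a = 0) (f : V → A)
    (hf : ∀ x, f (-x) = f x) : ∑ x, f x = f 0 := by
  classical
  rw [← Finset.add_sum_erase _ f (Finset.mem_univ 0)]
  have : ∑ x ∈ Finset.univ.erase 0, f x = 0 := by
    refine Finset.sum_involution (fun x _ => -x) ?_ ?_ ?_ ?_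
    · intro x _
      rw [hf, hA]
    · intro x hx _ h
      exact (Finset.ne_of_mem_erase hx) (hV x h)
    · intro x hx
      simpa using hx
    · intro x _
      simp
  rw [this, add_zero]

theorem add_self_eq_zero_of_module (F : Type*) [Field F] [CharP F 2] {A : Type*} [AddCommGroup A]
    [Module F A] (a : A) : a + a = 0 := by
  rw [← two_smul F a, CharTwo.two_eq_zero, zero_smul]

theorem eq_zero_of_neg_eq {K : Type*} [Field K] (h2 : (2 : K) ≠ 0) {A : Type*} [AddCommGroup A]
    [Module K A] (x : A) (h : -x = x) : x = 0 := by
  have h1 : (2 : K) • x = 0 := by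
    rw [two_smul]
    nth_rewrite 1 [← h]
    simp
  exact (smul_eq_zero.1 h1).resolve_left h2

theorem theta_eq_one {n : ℕ} {K F : Type*} [Field K] [Field F] [CharP F 2] (A : GL (Fin n) K) :
    theta F A = 1 := by
  unfold theta
  split_ifs
  · rfl
  · exact CharTwo.neg_eq 1

/-- A sum of a nontrivial multiplicative function over a finite group vanishes. -/
theorem sum_mul_hom_eq_zero {G F : Type*} [Group G] [Fintype G] [Field F] (c : G → F)
    (hc : ∀ a b, c (a * b) = c a * c b) {g : G} (hg : c g ≠ 1) : ∑ x, c x = 0 := by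
  have h : ∑ x, c x = c g * ∑ x, c x := by
    rw [Finset.mul_sum, ← Equiv.sum_comp (Equiv.mulLeft g)]
    exact Finset.sum_congr rfl fun x _ => hc g x
  have h' : (c g - 1) * ∑ x, c x = 0 := by
    rw [sub_mul, ← h, one_mul, sub_self]
  exact (mul_eq_zero.1 h').resolve_left (sub_ne_zero.2 hg)

end EvenSums

/-! ### Calculus of the alternating form. -/

section Form

variable {n : ℕ} {K : Type*} [Field K]

theorem form_add_right (x y z : Fin n ⊕ Fin n → K) : form x (y + z) = form x y + form x z := by
  simpa using form_add_smul x y z 1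

theorem form_add_left (x y z : Fin n ⊕ Fin n → K) : form (x + y) z = form x z + form y z := by
  rw [form_swap, form_add_right, form_swap x z, form_swap y z]
  ring

theorem form_zero_right (x : Fin n ⊕ Fin n → K) : form x 0 = 0 := by
  simp [form]

theorem form_zero_left (x : Fin n ⊕ Fin n → K) : form 0 x = 0 := by
  simp [form]

theorem form_smul_right (x y : Fin n ⊕ Fin n → K) (t : K) : form x (t • y) = t * form x y := by
  simpa [form_zero_right] using form_add_smul x 0 y t

theorem form_smul_left (x y : Fin n ⊕ Fin n → K) (t : K) : form (t • x) y = t * form x y := by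
  rw [form_swap, form_smul_right, form_swap x y]
  ring

theorem form_neg_right (x y : Fin n ⊕ Fin n → K) : form x (-y) = -form x y := by
  simpa using form_smul_right x y (-1)

theorem form_neg_left (x y : Fin n ⊕ Fin n → K) : form (-x) y = -form x y := by
  simpa using form_smul_left x y (-1)

theorem form_act (g : Sp n K) (x y : Fin n ⊕ Fin n → K) : form (act g x) (act g y) = form x y :=
  (mem_symplecticGroup_iff_form _).1 g.2 x y

theorem act_add (g : Sp n K) (x y : Fin n ⊕ Fin n → K) : act g (x + y) = act g x + act g y :=
  Matrix.mulVec_add _ _ _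

theorem act_neg (g : Sp n K) (x : Fin n ⊕ Fin n → K) : act g (-x) = -act g x :=
  Matrix.mulVec_neg _ _

theorem act_smul (g : Sp n K) (t : K) (x : Fin n ⊕ Fin n → K) : act g (t • x) = t • act g x :=
  Matrix.mulVec_smul _ _ _

theorem act_zero (g : Sp n K) : act g (0 : Fin n ⊕ Fin n → K) = 0 :=
  Matrix.mulVec_zero _

theorem act_inv_act (g : Sp n K) (x : Fin n ⊕ Fin n → K) : act g⁻¹ (act g x) = x := by
  rw [← act_mul, inv_mul_cancel, act_one]

theorem act_act_inv (g : Sp n K) (x : Fin n ⊕ Fin n → K) : act g (act g⁻¹ x) = x := by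
  rw [← act_mul, mul_inv_cancel, act_one]

theorem ext_act {g h : Sp n K} (H : ∀ x, act g x = act h x) : g = h := by
  apply Subtype.ext
  exact Matrix.ext_of_mulVec_single fun i => H _

theorem form_inM_inN (a b : Fin n → K) : form (inM a) (inN b) = ∑ i, a i * b i := by
  simp [form, inM, inN]

theorem form_inN_inM (a b : Fin n → K) : form (inN a) (inM b) = -∑ i, a i * b i := by
  simp [form, inM, inN]

theorem form_inM_inM (a b : Fin n → K) : form (inM a) (inM b) = 0 := by
  simp [form, inM]

theorem form_inN_inN (a b : Fin n → K) : form (inN a) (inN b) = 0 := by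
  simp [form, inN]

theorem inM_add_inN (x : Fin n ⊕ Fin n → K) : inM (x ∘ Sum.inl) + inN (x ∘ Sum.inr) = x := by
  ext i
  rcases i with i | i <;> simp [inM, inN]

theorem inN_add (a b : Fin n → K) : inN (a + b) = inN a + inN b := by
  ext i
  rcases i with i | i <;> simp [inN]

theorem inN_smul (t : K) (b : Fin n → K) : inN (t • b) = t • inN b := by
  ext i
  rcases i with i | i <;> simp [inN]

theorem inN_neg (b : Fin n → K) : inN (-b) = -inN b := by
  ext i
  rcases i with i | i <;> simp [inN]

theorem inM_single (i : Fin n) (t : K) : inM (Pi.single i t) = Pi.single (Sum.inl i) t := by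
  ext j
  rcases j with j | j <;> simp [inM, Pi.single_apply]

theorem inN_single (i : Fin n) (t : K) : inN (Pi.single i t) = Pi.single (Sum.inr i) t := by
  ext j
  rcases j with j | j <;> simp [inN, Pi.single_apply]

theorem act_transvection (u x : Fin n ⊕ Fin n → K) (t : K) :
    act (transvection u t) x = x + (t * form u x) • u :=
  transvectionMatrix_mulVec u x t

theorem act_levi_inN (A : GL (Fin n) K) (v : Fin n → K) :
    act (levi A) (inN v) = inN (leviN A v) := by
  ext i
  rcases i with i | i <;>
    simp [act, levi, inN, leviN, Matrix.mulVec, dotProduct]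

theorem act_levi_inM (A : GL (Fin n) K) (v : Fin n → K) :
    act (levi A) (inM v) = inM ((A : Matrix (Fin n) (Fin n) K) *ᵥ v) := by
  ext i
  rcases i with i | i <;>
    simp [act, levi, inM, Matrix.mulVec, dotProduct]

end Form

theorem weilSpace_hom_ext {n : ℕ} {K F : Type*} [Field F] {A : Type*} [AddCommMonoid A] [Module F A]
    {f g : WeilSpace n K F →ₗ[F] A} (h : ∀ v, f (eps F v) = g (eps F v)) : f = g :=
  Finsupp.lhom_ext' fun v => LinearMap.ext_ring (h v)

/-! ### The Schrödinger representation and Schur's lemma. -/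

section Schrodinger

variable {n : ℕ} {K : Type*} [Field K] {F : Type*} [Field F]

theorem schrodinger_eps (ψ : AddChar K F) (α : K) (x : Fin n ⊕ Fin n → K) (w : Fin n → K) :
    schrodinger ψ α x (eps F w) =
      ψ (α + form (inM (x ∘ Sum.inl)) (inN (x ∘ Sum.inr + 2 • w))) •
        eps F (w + x ∘ Sum.inr) := by
  simp [schrodinger, eps]

/-- The operator `J(0, x)`. -/
def heis (ψ : AddChar K F) (x : Fin n ⊕ Fin n → K) : Module.End F (WeilSpace n K F) :=
  schrodinger ψ 0 x

theorem heis_eps (ψ : AddChar K F) (x : Fin n ⊕ Fin n → K) (w : Fin n → K) :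
    heis ψ x (eps F w) =
      ψ (∑ i, x (Sum.inl i) * (x (Sum.inr i) + 2 * w i)) • eps F (w + x ∘ Sum.inr) := by
  rw [heis, schrodinger_eps, zero_add, form_inM_inN]
  simp

theorem schrodinger_eq (ψ : AddChar K F) (α : K) (x : Fin n ⊕ Fin n → K) :
    schrodinger ψ α x = ψ α • heis ψ x := by
  refine weilSpace_hom_ext fun w => ?_
  rw [schrodinger_eps, LinearMap.smul_apply, heis, schrodinger_eps, smul_smul,
    ← AddChar.map_add_eq_mul, zero_add]

theorem heis_mul (ψ : AddChar K F) (x y : Fin n ⊕ Fin n → K) :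
    heis ψ x * heis ψ y = ψ (form x y) • heis ψ (x + y) := by
  refine weilSpace_hom_ext fun w => ?_
  rw [Module.End.mul_apply, heis_eps, map_smul, heis_eps, LinearMap.smul_apply, heis_eps,
    smul_smul, smul_smul, ← AddChar.map_add_eq_mul, ← AddChar.map_add_eq_mul, form,
    ← Finset.sum_add_distrib, ← Finset.sum_add_distrib]
  congr 1
  · refine congrArg ψ (Finset.sum_congr rfl fun i _ => ?_)
    simp only [Pi.add_apply, Function.comp_apply]
    ring
  · refine congrArg (eps F) (funext fun i => ?_)
    simp only [Pi.add_apply, Function.comp_apply]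
    ring

theorem heis_zero (ψ : AddChar K F) : heis ψ (0 : Fin n ⊕ Fin n → K) = 1 := by
  refine weilSpace_hom_ext fun w => ?_
  rw [heis_eps]
  simp

/-- The involution `ε_v ↦ ε_{-v}` of the Weil space. -/
def flip (n : ℕ) (K : Type*) [Field K] (F : Type*) [Field F] : Module.End F (WeilSpace n K F) :=
  Finsupp.lmapDomain F F (fun v => -v)

theorem flip_eps (v : Fin n → K) : flip n K F (eps F v) = eps F (-v) := by
  simp [flip, eps]

theorem flip_apply (y : WeilSpace n K F) (v : Fin n → K) : flip n K F y v = y (-v) := by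
  have h := Finsupp.mapDomain_apply (neg_injective (G := Fin n → K)) y (-v)
  rw [neg_neg] at h
  exact h

theorem flip_mul_heis (ψ : AddChar K F) (x : Fin n ⊕ Fin n → K) :
    flip n K F * heis ψ x = heis ψ (-x) * flip n K F := by
  refine weilSpace_hom_ext fun w => ?_
  rw [Module.End.mul_apply, heis_eps, map_smul, flip_eps, Module.End.mul_apply, flip_eps, heis_eps]
  congr 2
  · refine Finset.sum_congr rfl fun i _ => ?_
    simp
    ring
  · ext i
    simp
    ring

/-- The matrix coefficient of an operator at `ε_0`. -/
def coeffZero (A : Module.End F (WeilSpace n K F)) : F := A (eps F 0) 0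

theorem coeffZero_sum {ι : Type*} (s : Finset ι) (A : ι → Module.End F (WeilSpace n K F)) :
    coeffZero (∑ i ∈ s, A i) = ∑ i ∈ s, coeffZero (A i) := by
  simp [coeffZero, LinearMap.sum_apply, Finsupp.finsetSum_apply]

theorem coeffZero_smul (c : F) (A : Module.End F (WeilSpace n K F)) :
    coeffZero (c • A) = c * coeffZero A := by
  simp [coeffZero]

theorem coeffZero_one : coeffZero (1 : Module.End F (WeilSpace n K F)) = 1 := by
  simp [coeffZero, eps]

theorem coeffZero_flip_mul (A : Module.End F (WeilSpace n K F)) :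
    coeffZero (flip n K F * A) = coeffZero A := by
  simp [coeffZero, flip_apply]

theorem coeffZero_mul_flip (A : Module.End F (WeilSpace n K F)) :
    coeffZero (A * flip n K F) = coeffZero A := by
  simp [coeffZero, flip_eps]

theorem exists_dot_eq {v : Fin n → K} (hv : v ≠ 0) (t : K) :
    ∃ a : Fin n → K, ∑ i, a i * v i = t := by
  obtain ⟨i, hi⟩ := Function.ne_iff.1 hv
  refine ⟨Pi.single i (t / v i), ?_⟩
  rw [Finset.sum_eq_single i]
  · rw [Pi.single_eq_same]
    exact div_mul_cancel₀ _ hi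
  · intro j _ hj
    simp [hj]
  · simp

/-- Operators commuting with the Schrödinger representation are scalar. -/
theorem eq_smul_one_of_commute (h2 : (2 : K) ≠ 0) {ψ : AddChar K F} (hψ : ψ ≠ 1)
    (A : Module.End F (WeilSpace n K F)) (hA : ∀ x, A * heis ψ x = heis ψ x * A) :
    A = coeffZero A • 1 := by
  obtain ⟨t, ht⟩ : ∃ t, ψ t ≠ 1 := by
    by_contra! h
    exact hψ (DFunLike.ext _ _ h)
  have hM : ∀ (a : Fin n → K) (y : WeilSpace n K F) (w : Fin n → K),
      heis ψ (inM a) y w = ψ (2 * ∑ i, a i * w i) * y w := by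
    intro a y w
    induction y using Finsupp.induction_linear with
    | zero => simp
    | add y z hy hz => rw [map_add, Finsupp.add_apply, hy, hz, Finsupp.add_apply, mul_add]
    | single v c =>
      have h : (Finsupp.single v c : WeilSpace n K F) = c • eps F v := by simp [eps]
      rw [h, map_smul, heis_eps]
      have h0 : v + inM a ∘ Sum.inr = v := by
        ext i
        simp [inM]
      rw [h0]
      by_cases hvw : v = w
      · subst hvw
        simp [eps, inM, Finset.mul_sum, mul_left_comm]
        exact mul_comm _ _
      · simp [eps, hvw]
  have h0 : A (eps F 0) = coeffZero A • eps F 0 := by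
    ext w
    by_cases hw : w = 0
    · subst hw
      simp [coeffZero, eps]
    -- By `hM`, J(a) with a in M is diagonal with eigenvalue ψ(2a·w) at ε_w. With a·w = t/2 this is
    -- ψ(t) ≠ 1, whereas ε_0 has eigenvalue 1, so `A (eps F 0)` has no component at w.
    · obtain ⟨a, ha⟩ := exists_dot_eq hw (t / 2)
      have h := congrArg (fun B : Module.End F (WeilSpace n K F) => B (eps F 0) w) (hA (inM a))
      simp only [Module.End.mul_apply, hM, ha] at h
      rw [mul_div_cancel₀ _ h2] at h
      have h1 : heis ψ (inM a) (eps F (0 : Fin n → K)) = eps F 0 := by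
        rw [heis_eps]
        simp [inM]
      rw [h1] at h
      have h3 : (ψ t - 1) * A (eps F 0) w = 0 := by
        rw [sub_mul, ← h, one_mul, sub_self]
      have h4 := (mul_eq_zero.1 h3).resolve_left (sub_ne_zero.2 ht)
      rw [h4]
      simp [eps, Ne.symm hw]
  refine weilSpace_hom_ext fun v => ?_
  -- Translations by N commute with `A` and carry ε_0 to every basis vector.
  have hv : eps F v = heis ψ (inN v) (eps F 0) := by
    rw [heis_eps]
    simp [inN]
  have h := congrArg (fun B : Module.End F (WeilSpace n K F) => B (eps F 0)) (hA (inN v))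
  simp only [Module.End.mul_apply] at h
  rw [LinearMap.smul_apply, Module.End.one_apply, hv, h, h0, map_smul]

end Schrodinger

/-! ### Construction of the Weil representation. -/

section WeilOperator

variable {n : ℕ} {K : Type*} [Field K] [Fintype K] {F : Type*} [Field F]

theorem sum_pi_even [CharP F 2] (h2 : (2 : K) ≠ 0) {ι : Type*} [Fintype ι] [DecidableEq ι]
    {A : Type*} [AddCommGroup A] [Module F A] (f : (ι → K) → A) (hf : ∀ x, f (-x) = f x) :
    ∑ x, f x = f 0 :=
  sum_even (fun x h => eq_zero_of_neg_eq h2 x h) (add_self_eq_zero_of_module F) f hf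

/-- The Weil operator `∑_x J(gx) J(-x)`. -/
def weilOp (ψ : AddChar K F) (g : Sp n K) : Module.End F (WeilSpace n K F) :=
  ∑ x : Fin n ⊕ Fin n → K, heis ψ (act g x) * heis ψ (-x)

/-- Substituting x - y for x in one of the two sums matches them term by term: the phases agree
because `g` preserves the form. -/
theorem weilOp_mul_heis (ψ : AddChar K F) (g : Sp n K) (y : Fin n ⊕ Fin n → K) :
    weilOp ψ g * heis ψ y = heis ψ (act g y) * weilOp ψ g := by
  rw [weilOp, Finset.sum_mul, Finset.mul_sum,
    ← Equiv.sum_comp (Equiv.subRight y) (fun x => heis ψ (act g y) * _)]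
  refine Finset.sum_congr rfl fun x _ => ?_
  rw [mul_assoc, heis_mul, ← mul_assoc (heis ψ (act g y)), heis_mul, Equiv.subRight_apply,
    form_act, mul_smul_comm, smul_mul_assoc, ← act_add]
  have e1 : form (-x) y = form y (x - y) := by
    rw [sub_eq_add_neg, form_add_right, form_neg_right, form_self, form_neg_left, form_swap x y]
    ring
  have e2 : -x + y = -(x - y) := by abel
  have e3 : y + (x - y) = x := by abel
  rw [e1, e2, e3]

theorem flip_mul_weilOp (ψ : AddChar K F) (g : Sp n K) :
    flip n K F * weilOp ψ g = weilOp ψ g * flip n K F := by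
  rw [weilOp, Finset.sum_mul, Finset.mul_sum,
    ← Equiv.sum_comp (Equiv.neg _) (fun x => heis ψ (act g x) * heis ψ (-x) * flip n K F)]
  refine Finset.sum_congr rfl fun x _ => ?_
  rw [← mul_assoc, flip_mul_heis, mul_assoc, flip_mul_heis, ← mul_assoc, Equiv.neg_apply, act_neg]

variable [CharP F 2]

/-- Conjugation by `flip` turns the summand at x into the one at -x, and `coeffZero` does not see
`flip` on either side. So the coefficient is an even function of x, and only x = 0 survives. -/
theorem coeffZero_weilOp_mul (h2 : (2 : K) ≠ 0) (ψ : AddChar K F) (g : Sp n K)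
    (A : Module.End F (WeilSpace n K F)) (hA : flip n K F * A = A * flip n K F) :
    coeffZero (weilOp ψ g * A) = coeffZero A := by
  rw [weilOp, Finset.sum_mul, coeffZero_sum, sum_pi_even (F := F) h2]
  · rw [act_zero, neg_zero, heis_zero, one_mul, one_mul]
  · intro x
    rw [← coeffZero_mul_flip, mul_assoc, ← hA, ← mul_assoc, mul_assoc _ _ (flip n K F), neg_neg,
      act_neg, ← coeffZero_flip_mul (heis ψ (act g x) * heis ψ (-x) * A)]
    congr 1
    rw [← mul_assoc (flip n K F), ← mul_assoc (flip n K F), flip_mul_heis,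
      mul_assoc _ (flip n K F) (heis ψ _), flip_mul_heis, neg_neg]

theorem coeffZero_weilOp (h2 : (2 : K) ≠ 0) (ψ : AddChar K F) (g : Sp n K) :
    coeffZero (weilOp ψ g) = 1 := by
  have h := coeffZero_weilOp_mul h2 ψ g 1 (by rw [mul_one, one_mul])
  rwa [mul_one, coeffZero_one] at h

theorem weilOp_one (h2 : (2 : K) ≠ 0) (ψ : AddChar K F) : weilOp ψ (1 : Sp n K) = 1 := by
  have h : ∀ x : Fin n ⊕ Fin n → K, heis ψ (act 1 x) * heis ψ (-x) = 1 := by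
    intro x
    rw [act_one, heis_mul, form_neg_right, form_self, add_neg_cancel, heis_zero, neg_zero,
      AddChar.map_zero_eq_one, one_smul]
  rw [weilOp, Finset.sum_congr rfl fun x _ => h x]
  exact sum_pi_even (F := F) h2 (fun _ => (1 : Module.End F (WeilSpace n K F))) fun _ => rfl

/-- Since g h k = 1, the product commutes with every J(x) and is a scalar by Schur's lemma. Peeling
off the factors with `coeffZero_weilOp_mul` shows that the scalar is 1. -/
theorem weilOp_mul_mul (h2 : (2 : K) ≠ 0) {ψ : AddChar K F} (hψ : ψ ≠ 1) {g h k : Sp n K}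
    (hghk : g * h * k = 1) : weilOp ψ g * weilOp ψ h * weilOp ψ k = 1 := by
  rw [eq_smul_one_of_commute h2 hψ (weilOp ψ g * weilOp ψ h * weilOp ψ k)]
  · rw [mul_assoc, coeffZero_weilOp_mul h2, coeffZero_weilOp_mul h2, coeffZero_weilOp h2, one_smul]
    · exact flip_mul_weilOp ψ k
    · rw [← mul_assoc, flip_mul_weilOp, mul_assoc, flip_mul_weilOp, mul_assoc]
  · intro x
    rw [mul_assoc, weilOp_mul_heis, ← mul_assoc, mul_assoc (weilOp ψ g), weilOp_mul_heis,
      ← mul_assoc, weilOp_mul_heis, ← act_mul, ← act_mul, hghk, act_one]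
    simp only [mul_assoc]

theorem weilOp_mul (h2 : (2 : K) ≠ 0) {ψ : AddChar K F} (hψ : ψ ≠ 1) (g h : Sp n K) :
    weilOp ψ (g * h) = weilOp ψ g * weilOp ψ h := by
  have h1 := weilOp_mul_mul h2 hψ (g := g) (h := h) (k := (g * h)⁻¹) (mul_inv_cancel _)
  -- With a trivial middle factor the triple product says that the operators of (gh)⁻¹ and gh are
  -- inverse to each other.
  have h3 := weilOp_mul_mul h2 hψ (g := (g * h)⁻¹) (h := 1) (k := g * h) (by simp)
  rw [weilOp_one h2, mul_one] at h3
  calc weilOp ψ (g * h) = weilOp ψ g * weilOp ψ h * weilOp ψ (g * h)⁻¹ * weilOp ψ (g * h) := by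
        rw [h1, one_mul]
    _ = weilOp ψ g * weilOp ψ h := by rw [mul_assoc, h3, mul_one]

/-- The Weil representation. -/
def weilRep (h2 : (2 : K) ≠ 0) {ψ : AddChar K F} (hψ : ψ ≠ 1) :
    Representation F (Sp n K) (WeilSpace n K F) where
  toFun := weilOp ψ
  map_one' := weilOp_one h2 ψ
  map_mul' := weilOp_mul h2 hψ

/-- An operator that intertwines the Schrödinger representation with its conjugate by `g` is a
multiple of the Weil operator. -/
theorem eq_smul_weilOp (h2 : (2 : K) ≠ 0) {ψ : AddChar K F} (hψ : ψ ≠ 1) (g : Sp n K)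
    (Q : Module.End F (WeilSpace n K F)) (hQ : ∀ x, Q * heis ψ x = heis ψ (act g x) * Q) :
    Q = coeffZero Q • weilOp ψ g := by
  have h1 : weilOp ψ g * weilOp ψ g⁻¹ = 1 := by
    rw [← weilOp_mul h2 hψ, mul_inv_cancel, weilOp_one h2]
  have h3 := eq_smul_one_of_commute h2 hψ (weilOp ψ g⁻¹ * Q) fun x => by
    rw [mul_assoc, hQ, ← mul_assoc, weilOp_mul_heis, act_inv_act, mul_assoc]
  have h4 : Q = coeffZero (weilOp ψ g⁻¹ * Q) • weilOp ψ g := by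
    calc Q = weilOp ψ g * (weilOp ψ g⁻¹ * Q) := by rw [← mul_assoc, h1, one_mul]
      _ = _ := by
        rw [h3, mul_smul_comm, mul_one, coeffZero_smul, coeffZero_one, mul_one]
  have h5 := congrArg coeffZero h4
  rw [coeffZero_smul, coeffZero_weilOp h2, mul_one] at h5
  rwa [h5]

/-- The recognition principle behind all explicit formulae: guess an intertwiner and check its
coefficient at ε_0. -/
theorem weilOp_eq (h2 : (2 : K) ≠ 0) {ψ : AddChar K F} (hψ : ψ ≠ 1) (g : Sp n K)
    (Q : Module.End F (WeilSpace n K F)) (hQ : ∀ x, Q * heis ψ x = heis ψ (act g x) * Q)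
    (hQ1 : coeffZero Q = 1) : weilOp ψ g = Q := by
  rw [eq_smul_weilOp h2 hψ g Q hQ, hQ1, one_smul]

theorem weilOp_levi (h2 : (2 : K) ≠ 0) {ψ : AddChar K F} (hψ : ψ ≠ 1) (A : GL (Fin n) K)
    (v : Fin n → K) : weilOp ψ (levi A) (eps F v) = eps F (leviN A v) := by
  let Q : Module.End F (WeilSpace n K F) :=
    Finsupp.linearCombination F fun w => eps F (leviN A w)
  have hQ : ∀ w, Q (eps F w) = eps F (leviN A w) := fun w => by simp [Q, eps]
  have hadd : ∀ v w, leviN A (v + w) = leviN A v + leviN A w := fun v w => by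
    simp [leviN, Matrix.mulVec_add]
  rw [weilOp_eq h2 hψ (levi A) Q ?_ ?_, hQ]
  · intro x
    refine weilSpace_hom_ext fun w => ?_
    have hx : act (levi A) x =
        inM ((A : Matrix (Fin n) (Fin n) K) *ᵥ (x ∘ Sum.inl)) + inN (leviN A (x ∘ Sum.inr)) := by
      rw [← act_levi_inM, ← act_levi_inN, ← act_add, inM_add_inN]
    have hl : act (levi A) x ∘ Sum.inl = (A : Matrix (Fin n) (Fin n) K) *ᵥ (x ∘ Sum.inl) := by
      rw [hx]
      ext i
      simp [inM, inN]
    have hr : act (levi A) x ∘ Sum.inr = leviN A (x ∘ Sum.inr) := by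
      rw [hx]
      ext i
      simp [inM, inN]
    rw [Module.End.mul_apply, Module.End.mul_apply, hQ, heis, heis, schrodinger_eps,
      schrodinger_eps, map_smul, hQ, hl, hr, hadd, ← act_levi_inM]
    have h3 : leviN A (x ∘ Sum.inr) + 2 • leviN A w = leviN A (x ∘ Sum.inr + 2 • w) := by
      rw [two_smul, two_smul, hadd, hadd]
    rw [h3, ← act_levi_inN, form_act]
  · rw [coeffZero, hQ]
    simp [leviN, eps]

/-- The diagonal operator with entries χ_v(s) is an intertwiner because (v, w) ↦ ⟨sv, w⟩ is
symmetric on N. That symmetry follows from `s` preserving the form and moving vectors of N only by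
vectors of M. -/
theorem weilOp_fixM (h2 : (2 : K) ≠ 0) {ψ : AddChar K F} (hψ : ψ ≠ 1) {s : Sp n K}
    (hs : s ∈ fixM n K) (v : Fin n → K) :
    weilOp ψ s (eps F v) = chi ψ (inN v) s • eps F v := by
  let Q : Module.End F (WeilSpace n K F) :=
    Finsupp.linearCombination F fun w => chi ψ (inN w) s • eps F w
  have hQ : ∀ w, Q (eps F w) = chi ψ (inN w) s • eps F w := fun w => by simp [Q, eps]
  have hs' : ∀ a, act s (inM a) = inM a := hs
  -- `s v - v` lies in `M`
  have hsN : ∀ v, act s (inN v) = inM (act s (inN v) ∘ Sum.inl) + inN v := by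
    intro v
    have h1 : act s (inN v) ∘ Sum.inr = v := by
      ext i
      have h := form_act s (inM (Pi.single i 1)) (inN v)
      rw [hs', ← inM_add_inN (act s (inN v)), form_add_right, form_inM_inM, form_inM_inN,
        form_inM_inN, zero_add] at h
      simpa [Pi.single_apply] using h
    nth_rewrite 1 [← inM_add_inN (act s (inN v)), h1]
    rfl
  have hsymm : ∀ v w, form (act s (inN v)) (inN w) = form (act s (inN w)) (inN v) := by
    intro v w
    have h := form_act s (inN v) (inN w)
    rw [hsN v, hsN w, form_add_right, form_add_left, form_add_left, form_inM_inM, form_inN_inN,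
      form_inN_inM] at h
    rw [hsN v, hsN w, form_add_left, form_add_left, form_inN_inN, form_inN_inN, form_inM_inN,
      form_inM_inN, add_zero, add_zero]
    rw [form_inM_inN] at h
    have h3 : ∑ i, (act s (inN w) ∘ Sum.inl) i * v i = ∑ i, v i * (act s (inN w) ∘ Sum.inl) i :=
      Finset.sum_congr rfl fun i _ => mul_comm _ _
    rw [h3]
    linear_combination h
  rw [weilOp_eq h2 hψ s Q ?_ ?_, hQ]
  · intro x
    refine weilSpace_hom_ext fun w => ?_
    set a := x ∘ Sum.inl with ha
    set b := x ∘ Sum.inr with hb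
    have hx : act s x = inM (a + act s (inN b) ∘ Sum.inl) + inN b := by
      have : inM (a + act s (inN b) ∘ Sum.inl) = inM a + inM (act s (inN b) ∘ Sum.inl) := by
        ext i
        rcases i with i | i <;> simp [inM]
      rw [this, add_assoc, ← hsN, ← hs' a, ← act_add, ha, hb, inM_add_inN]
    have hl : act s x ∘ Sum.inl = a + act s (inN b) ∘ Sum.inl := by
      rw [hx]
      ext i
      simp [inM, inN]
    have hr : act s x ∘ Sum.inr = b := by
      rw [hx]
      ext i
      simp [inM, inN]
    rw [Module.End.mul_apply, Module.End.mul_apply, hQ, map_smul, heis, heis, schrodinger_eps,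
      schrodinger_eps, map_smul, hQ, hl, hr, ← ha, ← hb, smul_smul, smul_smul, chi, chi,
      ← AddChar.map_add_eq_mul, ← AddChar.map_add_eq_mul]
    congr 2
    have e0 : inM (a + act s (inN b) ∘ Sum.inl) = inM a + inM (act s (inN b) ∘ Sum.inl) := by
      ext i
      rcases i with i | i <;> simp [inM]
    have e1 : ∀ y, form (inM (act s (inN b) ∘ Sum.inl)) (inN y) = form (act s (inN b)) (inN y) := by
      intro y
      conv_rhs => rw [hsN b, form_add_left, form_inN_inN, add_zero]
    rw [e0, form_add_left, e1, two_smul, inN_add, inN_add, inN_add, act_add, form_add_left,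
      form_add_right, form_add_right, form_add_right, form_add_right, form_add_right,
      form_add_right, hsymm w b]
    ring
  · have h0 : inN (0 : Fin n → K) = 0 := by simp [inN]
    rw [coeffZero, hQ, h0, chi, act_zero, form_zero_left, AddChar.map_zero_eq_one]
    simp [eps]

theorem sum_sq_eq_one (h2 : (2 : K) ≠ 0) (ψ : AddChar K F) : ∑ α : K, ψ (α ^ 2) = 1 := by
  rw [sum_even (fun x h => eq_zero_of_neg_eq h2 x h) (add_self_eq_zero_of_module F)]
  · simp
  · intro x
    rw [neg_sq]

/-- Shifting α by ⟨b, y⟩ absorbs the transvection, so the right side intertwines. Since J(αb)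
translates ε_0 to ε_{αb}, only α = 0 contributes to the coefficient at ε_0. -/
theorem weilOp_transvection (h2 : (2 : K) ≠ 0) {ψ : AddChar K F} (hψ : ψ ≠ 1) (b : Fin n → K)
    (hb : b ≠ 0) :
    weilOp ψ (transvection (inN b) (-1)) = ∑ α : K, ψ (α ^ 2) • heis ψ (α • inN b) := by
  have hJ : ∀ w v : Fin n → K, heis ψ (inN w) (eps F v) = eps F (v + w) := by
    intro w v
    rw [heis_eps]
    simp [inN]
  refine weilOp_eq h2 hψ _ _ ?_ ?_
  · intro y
    rw [Finset.sum_mul, Finset.mul_sum,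
      ← Equiv.sum_comp (Equiv.addRight (form (inN b) y)) (fun α : K => heis ψ _ * _)]
    refine Finset.sum_congr rfl fun α _ => ?_
    rw [smul_mul_assoc, mul_smul_comm, heis_mul, heis_mul, smul_smul, smul_smul,
      ← AddChar.map_add_eq_mul, ← AddChar.map_add_eq_mul, act_transvection, Equiv.coe_addRight,
      form_smul_left, form_smul_right, form_add_left, form_smul_left, form_self, form_swap y]
    congr 2
    · ring
    · rw [add_smul]
      module
  · rw [coeffZero_sum, Finset.sum_eq_single 0]
    · rw [zero_smul, heis_zero, coeffZero_smul, coeffZero_one]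
      simp
    · intro α _ hα
      rw [coeffZero_smul, coeffZero, ← inN_smul, hJ, zero_add, eps,
        Finsupp.single_eq_of_ne (smul_ne_zero hα hb).symm, mul_zero]
    · simp

theorem isWeilRepresentation_weilRep (h2 : (2 : K) ≠ 0) {ψ : AddChar K F} (hψ : ψ ≠ 1) :
    IsWeilRepresentation ψ (weilRep (n := n) h2 hψ) where
  intertwines g α x := by
    rw [schrodinger_eq, schrodinger_eq, LinearMap.comp_smul, LinearMap.smul_comp]
    exact congrArg (fun B => ψ α • B) (weilOp_mul_heis ψ g x)
  parabolic s hs A v := by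
    rw [theta_eq_one, one_pow, one_mul, map_mul, Module.End.mul_apply]
    change weilOp ψ s (weilOp ψ (levi A) (eps F v)) = _
    rw [weilOp_levi h2 hψ, weilOp_fixM h2 hψ hs]
  transvection i _ v := by
    change weilOp ψ _ _ = _
    rw [weilOp_transvection h2 hψ _ (by simp), sum_sq_eq_one h2, inv_one, one_smul,
      LinearMap.sum_apply]
    refine Finset.sum_congr rfl fun α _ => ?_
    rw [LinearMap.smul_apply, ← inN_smul, heis_eps]
    simp [inN]

end WeilOperator

/-! ### Triangular symplectic matrices: U, H and B in coordinates. -/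

section Triangular

variable {n : ℕ} {K : Type*} [Field K]

/-- The position of a basis vector in the ordering `u_1, …, u_n, v_n, …, v_1`, symmetric about the
origin. -/
def rk : Fin n ⊕ Fin n → ℤ := Sum.elim (fun i => (i : ℤ) - n) (fun i => n - (i : ℤ))

theorem rk_inl (i : Fin n) : rk (Sum.inl i : Fin n ⊕ Fin n) = (i : ℤ) - n := rfl

theorem rk_inr (i : Fin n) : rk (Sum.inr i : Fin n ⊕ Fin n) = n - (i : ℤ) := rfl

theorem rk_swap (i : Fin n ⊕ Fin n) : rk i.swap = -rk i := by
  rcases i with i | i <;> simp [rk_inl, rk_inr]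

theorem rk_injective : Function.Injective (rk : Fin n ⊕ Fin n → ℤ) := by
  rintro (i | i) (j | j) h <;> simp only [rk_inl, rk_inr] at h
  · exact congrArg _ (Fin.ext (by omega))
  · have := i.2
    have := j.2
    omega
  · have := i.2
    have := j.2
    omega
  · exact congrArg _ (Fin.ext (by omega))

/-- The basis vectors of `V`. -/
def bas (i : Fin n ⊕ Fin n) : Fin n ⊕ Fin n → K := Pi.single i 1

theorem bas_self (i : Fin n ⊕ Fin n) : (bas i : Fin n ⊕ Fin n → K) i = 1 := by simp [bas]

theorem bas_of_ne {i j : Fin n ⊕ Fin n} (h : j ≠ i) : (bas i : Fin n ⊕ Fin n → K) j = 0 := by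
  simp [bas, h]

theorem bas_apply (i j : Fin n ⊕ Fin n) :
    (bas i : Fin n ⊕ Fin n → K) j = if j = i then 1 else 0 := by
  simp [bas, Pi.single_apply]

/-- The value `⟨e_i, e_{i'}⟩` of the form on a basis vector and its partner. -/
def sgn (K : Type*) [Field K] : Fin n ⊕ Fin n → K := Sum.elim 1 (-1)

theorem sgn_mul_self (i : Fin n ⊕ Fin n) : sgn K i * sgn K i = 1 := by
  rcases i with i | i <;> simp [sgn]

theorem sgn_ne_zero (i : Fin n ⊕ Fin n) : sgn K i ≠ 0 := by
  rcases i with i | i <;> simp [sgn]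

theorem sgn_swap (i : Fin n ⊕ Fin n) : sgn K i.swap = -sgn K i := by
  rcases i with i | i <;> simp [sgn]

theorem form_bas_left (i : Fin n ⊕ Fin n) (x : Fin n ⊕ Fin n → K) :
    form (bas i) x = sgn K i * x i.swap := by
  rcases i with i | i <;> simp [form, sgn, bas, Pi.single_apply]

theorem form_bas_bas_eq_zero {i j : Fin n ⊕ Fin n} (h : j ≠ i.swap) :
    form (bas i : Fin n ⊕ Fin n → K) (bas j) = 0 := by
  rw [form_bas_left, bas_of_ne h.symm, mul_zero]

theorem act_bas (g : Sp n K) (i j : Fin n ⊕ Fin n) :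
    act g (bas j) i = (g : Matrix (Fin n ⊕ Fin n) (Fin n ⊕ Fin n) K) i j := by
  simp [act, bas]

theorem apply_eq_form (x : Fin n ⊕ Fin n → K) (i : Fin n ⊕ Fin n) :
    x i = sgn K i * form x (bas i.swap) := by
  rw [form_swap, form_bas_left, sgn_swap, Sum.swap_swap]
  linear_combination -x i * sgn_mul_self (K := K) i

/-- The inverse is the adjoint with respect to the form; passing to partners of basis vectors
transposes the indices. -/
theorem inv_apply (g : Sp n K) (i j : Fin n ⊕ Fin n) :
    ((g⁻¹ : Sp n K) : Matrix (Fin n ⊕ Fin n) (Fin n ⊕ Fin n) K) i j =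
      sgn K i * (sgn K j *
        (g : Matrix (Fin n ⊕ Fin n) (Fin n ⊕ Fin n) K) j.swap i.swap) := by
  rw [← act_bas, apply_eq_form (act g⁻¹ (bas j)), ← form_act g, act_act_inv, form_bas_left, act_bas]

theorem coe_mul_apply (g h : Sp n K) (i j : Fin n ⊕ Fin n) :
    ((g * h : Sp n K) : Matrix (Fin n ⊕ Fin n) (Fin n ⊕ Fin n) K) i j =
      ∑ k, (g : Matrix (Fin n ⊕ Fin n) (Fin n ⊕ Fin n) K) i k *
        (h : Matrix (Fin n ⊕ Fin n) (Fin n ⊕ Fin n) K) k j := by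
  rw [Submonoid.coe_mul, Matrix.mul_apply]

/-- The subgroup of upper triangular symplectic matrices, for the ordering
`u_1, …, u_n, v_n, …, v_1`. -/
def upperTri (n : ℕ) (K : Type*) [Field K] : Subgroup (Sp n K) where
  carrier := {g | ∀ i j, rk j < rk i →
    (g : Matrix (Fin n ⊕ Fin n) (Fin n ⊕ Fin n) K) i j = 0}
  one_mem' i j h := by
    have : i ≠ j := by
      rintro rfl
      exact lt_irrefl _ h
    simp [this]
  mul_mem' {g h} hg hh i j hij := by
    rw [coe_mul_apply]
    refine Finset.sum_eq_zero fun k _ => ?_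
    rcases lt_or_ge (rk k) (rk i) with hk | hk
    · rw [hg i k hk, zero_mul]
    · rw [hh k j (hij.trans_le hk), mul_zero]
  inv_mem' {g} hg i j hij := by
    rw [inv_apply, hg, mul_zero, mul_zero]
    rw [rk_swap, rk_swap]
    omega

theorem upperTri_mul_diag {g h : Sp n K} (hg : g ∈ upperTri n K) (hh : h ∈ upperTri n K)
    (i : Fin n ⊕ Fin n) :
    ((g * h : Sp n K) : Matrix (Fin n ⊕ Fin n) (Fin n ⊕ Fin n) K) i i =
      (g : Matrix (Fin n ⊕ Fin n) (Fin n ⊕ Fin n) K) i i *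
        (h : Matrix (Fin n ⊕ Fin n) (Fin n ⊕ Fin n) K) i i := by
  rw [coe_mul_apply, Finset.sum_eq_single i]
  · intro k _ hk
    rcases lt_or_gt_of_ne (fun h => hk (rk_injective h)) with hk | hk
    · rw [hg i k hk, zero_mul]
    · rw [hh k i hk, mul_zero]
  · simp

/-- The subgroup of upper unitriangular symplectic matrices. -/
def upperUni (n : ℕ) (K : Type*) [Field K] : Subgroup (Sp n K) where
  carrier := {g | g ∈ upperTri n K ∧
    ∀ i, (g : Matrix (Fin n ⊕ Fin n) (Fin n ⊕ Fin n) K) i i = 1}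
  one_mem' := ⟨one_mem _, fun i => by simp⟩
  mul_mem' {g h} hg hh := ⟨mul_mem hg.1 hh.1, fun i => by
    rw [upperTri_mul_diag hg.1 hh.1, hg.2, hh.2, one_mul]⟩
  inv_mem' {g} hg := ⟨inv_mem hg.1, fun i => by
    rw [inv_apply, hg.2, mul_one, sgn_mul_self]⟩

/-- With no rank strictly between those of i and j, no cross terms occur. Hence such an entry is a
homomorphism from U to the additive group of K, the coordinate of a simple root. -/
theorem upperUni_mul_apply {g h : Sp n K} (hg : g ∈ upperUni n K) (hh : h ∈ upperUni n K)
    {i j : Fin n ⊕ Fin n} (hij : i ≠ j) (hadj : ∀ m, rk i ≤ rk m → rk m ≤ rk j → m = i ∨ m = j) :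
    ((g * h : Sp n K) : Matrix (Fin n ⊕ Fin n) (Fin n ⊕ Fin n) K) i j =
      (g : Matrix (Fin n ⊕ Fin n) (Fin n ⊕ Fin n) K) i j +
        (h : Matrix (Fin n ⊕ Fin n) (Fin n ⊕ Fin n) K) i j := by
  rw [coe_mul_apply, Finset.sum_eq_add i j hij]
  · rw [hg.2, hh.2, one_mul, mul_one, add_comm]
  · rintro k _ ⟨h1, h2⟩
    rcases lt_or_ge (rk k) (rk i) with hk | hk
    · rw [hg.1 i k hk, zero_mul]
    · rcases lt_or_ge (rk j) (rk k) with hk' | hk'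
      · rw [hh.1 k j hk', mul_zero]
      · rcases hadj k hk hk' with h | h
        · exact absurd h h1
        · exact absurd h h2
  · simp
  · simp

theorem mem_fixM_iff {g : Sp n K} :
    g ∈ fixM n K ↔ ∀ i, act g (bas (Sum.inl i)) = bas (Sum.inl i) := by
  constructor
  · intro h i
    have := h (Pi.single i 1)
    rwa [inM_single] at this
  · intro h x
    have hx : inM x = ∑ i, x i • (bas (Sum.inl i) : Fin n ⊕ Fin n → K) := by
      ext j
      rcases j with j | j <;> simp [inM, bas, Pi.single_apply]
    rw [hx, act, Matrix.mulVec_sum]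
    refine Finset.sum_congr rfl fun i _ => ?_
    rw [Matrix.mulVec_smul]
    exact congrArg _ (h i)

theorem fixM_le_upperUni : fixM n K ≤ upperUni n K := by
  intro g hg
  rw [mem_fixM_iff] at hg
  have hl : ∀ i j, (g : Matrix (Fin n ⊕ Fin n) (Fin n ⊕ Fin n) K) i (Sum.inl j) =
      bas (Sum.inl j) i := fun i j => by
    rw [← act_bas, hg]
  have hr : ∀ i j : Fin n,
      (g : Matrix (Fin n ⊕ Fin n) (Fin n ⊕ Fin n) K) (Sum.inr i) (Sum.inr j) =
        if i = j then 1 else 0 := fun i j => by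
    rw [← act_bas, apply_eq_form (act g _), Sum.swap_inr, ← hg i, form_act, form_bas_left]
    simp [sgn, bas_apply, eq_comm]
  refine ⟨fun i j hij => ?_, fun i => ?_⟩
  · rcases j with j | j
    · rw [hl, bas_of_ne]
      rintro rfl
      exact lt_irrefl _ hij
    · rcases i with i | i
      · rw [rk_inl, rk_inr] at hij
        have := i.2
        have := j.2
        omega
      · rw [hr, if_neg]
        rintro rfl
        exact lt_irrefl _ hij
  · rcases i with i | i
    · rw [hl, bas_self]
    · rw [hr, if_pos rfl]

theorem levi_apply_inl_inl (A : GL (Fin n) K) (i j : Fin n) :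
    ((levi A : Sp n K) : Matrix (Fin n ⊕ Fin n) (Fin n ⊕ Fin n) K) (Sum.inl i) (Sum.inl j) =
      (A : Matrix (Fin n) (Fin n) K) i j := rfl

theorem levi_apply_inr_inr (A : GL (Fin n) K) (i j : Fin n) :
    ((levi A : Sp n K) : Matrix (Fin n ⊕ Fin n) (Fin n ⊕ Fin n) K) (Sum.inr i) (Sum.inr j) =
      ((A⁻¹ : GL (Fin n) K) : Matrix (Fin n) (Fin n) K) j i := rfl

theorem levi_apply_inr_inl (A : GL (Fin n) K) (i j : Fin n) :
    ((levi A : Sp n K) : Matrix (Fin n ⊕ Fin n) (Fin n ⊕ Fin n) K) (Sum.inr i) (Sum.inl j) =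
      0 := rfl

theorem levi_unitriangular_le_upperUni : (unitriangular n K).map levi ≤ upperUni n K := by
  rintro _ ⟨A, hA, rfl⟩
  have hA' := (unitriangular n K).inv_mem hA
  refine ⟨fun i j hij => ?_, fun i => ?_⟩
  · rcases i with i | i <;> rcases j with j | j <;> simp only [rk_inl, rk_inr] at hij
    · exact hA.1 i j (Fin.lt_def.2 (by omega))
    · rfl
    · rfl
    · exact hA'.1 j i (Fin.lt_def.2 (by omega))
  · rcases i with i | i
    · exact hA.2 i
    · exact hA'.2 i

/-- A symplectic matrix that stabilizes `M` is the product of an element of `Sp^M` and an element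
of `Sp_{M,N}`. -/
theorem exists_fixM_mul_levi {g : Sp n K} (hg : ∀ i j : Fin n,
    (g : Matrix (Fin n ⊕ Fin n) (Fin n ⊕ Fin n) K) (Sum.inr i) (Sum.inl j) = 0) :
    ∃ s ∈ fixM n K, ∃ A : GL (Fin n) K, g = s * levi A ∧ ∀ i j,
      (A : Matrix (Fin n) (Fin n) K) i j =
        (g : Matrix (Fin n ⊕ Fin n) (Fin n ⊕ Fin n) K) (Sum.inl i) (Sum.inl j) := by
  have hg' : ∀ i j : Fin n, ((g⁻¹ : Sp n K) : Matrix (Fin n ⊕ Fin n) (Fin n ⊕ Fin n) K)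
      (Sum.inr i) (Sum.inl j) = 0 := fun i j => by
    rw [inv_apply, Sum.swap_inl, Sum.swap_inr, hg, mul_zero, mul_zero]
  have hmul : ∀ a b : Sp n K, a * b = 1 → (∀ i j : Fin n,
      (b : Matrix (Fin n ⊕ Fin n) (Fin n ⊕ Fin n) K) (Sum.inr i) (Sum.inl j) = 0) →
      (Matrix.of fun i j : Fin n =>
        (a : Matrix (Fin n ⊕ Fin n) (Fin n ⊕ Fin n) K) (Sum.inl i) (Sum.inl j)) *
      (Matrix.of fun i j : Fin n =>
        (b : Matrix (Fin n ⊕ Fin n) (Fin n ⊕ Fin n) K) (Sum.inl i) (Sum.inl j)) = 1 := by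
    intro a b hab hb
    ext i j
    have h := coe_mul_apply a b (Sum.inl i) (Sum.inl j)
    rw [hab, Fintype.sum_sum_type] at h
    simp only [hb, mul_zero, Finset.sum_const_zero, add_zero] at h
    rw [Matrix.mul_apply]
    simp only [Matrix.of_apply]
    rw [← h]
    simp [Matrix.one_apply]
  let A : GL (Fin n) K :=
    ⟨_, _, hmul g g⁻¹ (mul_inv_cancel g) hg', hmul g⁻¹ g (inv_mul_cancel g) hg⟩
  refine ⟨g * (levi A)⁻¹, fun x => ?_, A, by group, fun i j => rfl⟩
  have hgM : ∀ x : Fin n → K, act g (inM x) = act (levi A) (inM x) := by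
    intro x
    rw [act_levi_inM]
    ext i
    rcases i with i | i
    · simp [act, inM, Matrix.mulVec, dotProduct, A]
    · simp [act, inM, Matrix.mulVec, dotProduct, hg]
  have : act (levi A)⁻¹ (inM x) = inM (((A⁻¹ : GL (Fin n) K) : Matrix (Fin n) (Fin n) K) *ᵥ x) := by
    rw [← map_inv, act_levi_inM]
  rw [act_mul, this, hgM, ← this, act_act_inv]

/-- This replaces the generators of U by a condition on matrix entries: an upper unitriangular
matrix stabilizes M, so it splits into a part in Sp^M and a unitriangular Levi part. -/
theorem sylowU_eq : sylowU n K = upperUni n K := by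
  refine le_antisymm (sup_le levi_unitriangular_le_upperUni fixM_le_upperUni) ?_
  intro g hg
  obtain ⟨s, hs, A, rfl, hA⟩ := exists_fixM_mul_levi (g := g) fun i j => hg.1 _ _ (by
    rw [rk_inl, rk_inr]
    have := i.2
    have := j.2
    omega)
  refine mul_mem (Subgroup.mem_sup_right hs) (Subgroup.mem_sup_left ⟨A, ⟨fun i j hij => ?_,
    fun i => ?_⟩, rfl⟩)
  · rw [hA]
    refine hg.1 _ _ ?_
    rw [rk_inl, rk_inl]
    have := Fin.lt_def.1 hij
    omega
  · rw [hA]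
    exact hg.2 _

theorem mem_torusH_iff {g : Sp n K} :
    g ∈ torusH n K ↔ ∀ i, ∃ c : K, act g (bas i) = c • bas i := Iff.rfl

theorem torusH_apply {g : Sp n K} (hg : g ∈ torusH n K) {i j : Fin n ⊕ Fin n} (hij : i ≠ j) :
    (g : Matrix (Fin n ⊕ Fin n) (Fin n ⊕ Fin n) K) i j = 0 := by
  obtain ⟨c, hc⟩ := hg j
  rw [← act_bas, bas, hc]
  simp [hij]

theorem torusH_le_upperTri : torusH n K ≤ upperTri n K := by
  intro g hg i j hij
  refine torusH_apply hg ?_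
  rintro rfl
  exact lt_irrefl _ hij

theorem upperUni_le_upperTri : upperUni n K ≤ upperTri n K := fun _ h => h.1

theorem borelB_le_upperTri : borelB n K ≤ upperTri n K := by
  rw [borelB, sylowU_eq]
  exact sup_le upperUni_le_upperTri torusH_le_upperTri

theorem upperUni_le_borelB : upperUni n K ≤ borelB n K := by
  rw [borelB, sylowU_eq]
  exact le_sup_left

theorem torusH_le_borelB : torusH n K ≤ borelB n K := le_sup_right

/-- In odd characteristic, a unitriangular group has no elements of order two. -/
theorem eq_one_of_mul_self (h2 : (2 : K) ≠ 0) {g : Sp n K} (hg : g ∈ upperUni n K)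
    (h : g * g = 1) : g = 1 := by
  -- Induction on the distance from the diagonal. In g² the cross terms at (i, j) contain entries of
  -- smaller distance, which vanish, so 2g_{ij} = 0.
  have key : ∀ d : ℕ, ∀ i j : Fin n ⊕ Fin n, rk j - rk i ≤ d →
      (g : Matrix (Fin n ⊕ Fin n) (Fin n ⊕ Fin n) K) i j = if i = j then 1 else 0 := by
    intro d
    induction d with
    | zero =>
      intro i j hij
      split_ifs with hi
      · rw [hi]
        exact hg.2 j
      · refine hg.1 i j (lt_of_le_of_ne (by push_cast at hij; omega) fun h => hi ?_)
        exact (rk_injective h).symm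
    | succ d ih =>
      intro i j hij
      split_ifs with hi
      · rw [hi]
        exact hg.2 j
      · have h1 := coe_mul_apply g g i j
        rw [h, Finset.sum_eq_add i j hi] at h1
        · rw [hg.2, hg.2] at h1
          simp only [Submonoid.coe_one, Matrix.one_apply, if_neg hi] at h1
          have h3 : (2 : K) * (g : Matrix (Fin n ⊕ Fin n) (Fin n ⊕ Fin n) K) i j = 0 := by
            linear_combination -h1
          exact (mul_eq_zero.1 h3).resolve_left h2
        · rintro k _ ⟨hk1, hk2⟩
          rcases le_or_gt (rk k) (rk i) with hk | hk
          · rw [ih i k (by omega), if_neg hk1.symm, zero_mul]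
          · rw [ih k j (by push_cast at hij ⊢; omega), if_neg hk2, mul_zero]
        · simp
        · simp
  apply Subtype.ext
  ext i j
  rw [key (rk j - rk i).toNat i j (Int.self_le_toNat _)]
  simp [Matrix.one_apply]

/-- Subgroups of `U` have odd order, so their order is `1` in characteristic two. -/
theorem card_eq_one_of_le_upperUni [Finite K] (h2 : (2 : K) ≠ 0) (F : Type*) [Field F] [CharP F 2]
    (Q : Subgroup (Sp n K)) [Fintype Q] (hQ : Q ≤ upperUni n K) : (Fintype.card Q : F) = 1 := by
  have hodd : ¬ 2 ∣ Fintype.card Q := by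
    intro hd
    have : Fact (Nat.Prime 2) := ⟨Nat.prime_two⟩
    obtain ⟨x, hx⟩ := exists_prime_orderOf_dvd_card 2 hd
    have h1 : (x : Sp n K) = 1 := eq_one_of_mul_self h2 (hQ x.2) (by
      have := pow_orderOf_eq_one x
      rw [hx, pow_two] at this
      exact_mod_cast congrArg Subtype.val this)
    have h3 : x = 1 := Subtype.ext h1
    rw [h3, orderOf_one] at hx
    omega
  have : Odd (Fintype.card Q) := Nat.not_even_iff_odd.1 fun h => hodd h.two_dvd
  obtain ⟨k, hk⟩ := this
  rw [hk]
  push_cast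
  rw [CharTwo.two_eq_zero, zero_mul, zero_add]

end Triangular

/-! ### Root elements and monomial matrices. -/

section Roots

variable {n : ℕ} {K : Type*} [Field K]

/-- The root element `x ↦ x + t(⟨a, x⟩b + ⟨b, x⟩a)`, for orthogonal `a` and `b`. -/
def rootElt (a b : Fin n ⊕ Fin n → K) (t : K) : Sp n K :=
  transvection (a + b) t * transvection a (-t) * transvection b (-t)

theorem act_rootElt {a b : Fin n ⊕ Fin n → K} (hab : form a b = 0) (t : K)
    (x : Fin n ⊕ Fin n → K) :
    act (rootElt a b t) x = x + t • (form a x • b + form b x • a) := by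
  have hba : form b a = 0 := by rw [form_swap, hab, neg_zero]
  simp only [rootElt, act_mul, act_transvection, form_add_left, form_add_right, form_smul_right,
    form_self, hab, hba, mul_zero, add_zero]
  module

theorem conj_transvection (g : Sp n K) (u : Fin n ⊕ Fin n → K) (t : K) :
    g * transvection u t * g⁻¹ = transvection (act g u) t := by
  refine ext_act fun x => ?_
  rw [act_mul, act_mul, act_transvection, act_transvection, act_add, act_act_inv, act_smul,
    ← form_act g u, act_act_inv]

theorem conj_rootElt (g : Sp n K) (a b : Fin n ⊕ Fin n → K) (t : K) :
    g * rootElt a b t * g⁻¹ = rootElt (act g a) (act g b) t := by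
  rw [rootElt, rootElt, ← act_add, ← conj_transvection, ← conj_transvection, ← conj_transvection]
  group

theorem rootElt_smul {a b : Fin n ⊕ Fin n → K} (hab : form a b = 0) (c d t : K) :
    rootElt (c • a) (d • b) t = rootElt a b (c * d * t) := by
  refine ext_act fun x => ?_
  rw [act_rootElt hab, act_rootElt (by rw [form_smul_left, form_smul_right, hab]; simp),
    form_smul_left, form_smul_left]
  module

theorem rootElt_add {a b : Fin n ⊕ Fin n → K} (hab : form a b = 0) (s t : K) :
    rootElt a b (s + t) = rootElt a b s * rootElt a b t := by
  have hba : form b a = 0 := by rw [form_swap, hab, neg_zero]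
  refine ext_act fun x => ?_
  simp only [act_mul, act_rootElt hab, form_add_right, form_smul_right, form_self, hab, hba,
    mul_zero, add_zero]
  module

theorem rootElt_comm {a b : Fin n ⊕ Fin n → K} (hab : form a b = 0) (t : K) :
    rootElt a b t = rootElt b a t := by
  have hba : form b a = 0 := by rw [form_swap, hab, neg_zero]
  refine ext_act fun x => ?_
  rw [act_rootElt hab, act_rootElt hba, add_comm (form a x • b)]

theorem rootElt_zero {a b : Fin n ⊕ Fin n → K} (hab : form a b = 0) : rootElt a b 0 = 1 := by
  refine ext_act fun x => ?_
  rw [act_rootElt hab, zero_smul, add_zero, act_one]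

theorem rootElt_neg {a b : Fin n ⊕ Fin n → K} (hab : form a b = 0) (t : K) :
    rootElt a b (-t) = (rootElt a b t)⁻¹ := by
  rw [eq_inv_iff_mul_eq_one, ← rootElt_add hab, neg_add_cancel, rootElt_zero hab]

theorem act_root {i j : Fin n ⊕ Fin n} (hij : j ≠ i.swap) (t : K) (x : Fin n ⊕ Fin n → K) :
    act (rootElt (bas i) (bas j) t) x =
      x + t • ((sgn K i * x i.swap) • bas j + (sgn K j * x j.swap) • bas i) := by
  rw [act_rootElt (form_bas_bas_eq_zero hij), form_bas_left, form_bas_left]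

/-- The off-diagonal entries sit at (j, i') and (i, j'), where the prime denotes the partner. As
`rk` changes sign under passing to the partner, both lie above the diagonal exactly when the two
ranks have negative sum. -/
theorem root_mem_upperUni {i j : Fin n ⊕ Fin n} (hij : rk i + rk j < 0) (t : K) :
    rootElt (bas i) (bas j) t ∈ upperUni n K := by
  have hne : j ≠ i.swap := by
    rintro rfl
    rw [rk_swap] at hij
    omega
  have key : ∀ m l : Fin n ⊕ Fin n, rk l ≤ rk m →
      act (rootElt (bas i) (bas j) t) (bas l) m = (bas l : Fin n ⊕ Fin n → K) m := by
    intro m l hml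
    rw [act_root hne]
    simp only [Pi.add_apply, Pi.smul_apply, smul_eq_mul, bas_apply]
    have h1 : (if i.swap = l then (1 : K) else 0) * (if m = j then 1 else 0) = 0 := by
      by_cases h : i.swap = l
      · have : m ≠ j := by
          rintro rfl
          rw [← h, rk_swap] at hml
          omega
        simp [this]
      · simp [h]
    have h2 : (if j.swap = l then (1 : K) else 0) * (if m = i then 1 else 0) = 0 := by
      by_cases h : j.swap = l
      · have : m ≠ i := by
          rintro rfl
          rw [← h, rk_swap] at hml
          omega
        simp [this]
      · simp [h]
    linear_combination t * sgn K i * h1 + t * sgn K j * h2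
  refine ⟨fun m l h => ?_, fun m => ?_⟩
  · rw [← act_bas, key m l h.le, bas_of_ne]
    rintro rfl
    exact lt_irrefl _ h
  · rw [← act_bas, key m m le_rfl, bas_self]

/-- The entry of a root element that determines its parameter. -/
theorem root_apply (h2 : (2 : K) ≠ 0) {i j : Fin n ⊕ Fin n} (hij : j ≠ i.swap) :
    ∃ κ : K, κ ≠ 0 ∧ ∀ t, (rootElt (bas i) (bas j) t :
      Matrix (Fin n ⊕ Fin n) (Fin n ⊕ Fin n) K) i j.swap = κ * t := by
  have hij' : i ≠ j.swap := fun h => hij (by rw [h, Sum.swap_swap])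
  by_cases h : i = j
  -- For i = j, a long root, the two terms of the root element coincide; this is the source of the
  -- factor 2.
  · subst h
    refine ⟨2 * sgn K i, mul_ne_zero h2 (sgn_ne_zero i), fun t => ?_⟩
    rw [← act_bas, act_root hij]
    simp [bas_apply, hij]
    ring
  · refine ⟨sgn K j, sgn_ne_zero j, fun t => ?_⟩
    rw [← act_bas, act_root hij]
    have hs : i.swap ≠ j.swap := fun h' => h (Sum.swap_leftInverse.injective h')
    simp [bas_apply, hs, hij', mul_comm]

theorem root_notMem_upperTri (h2 : (2 : K) ≠ 0) {i j : Fin n ⊕ Fin n} (hij : 0 < rk i + rk j)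
    {t : K} (ht : t ≠ 0) : rootElt (bas i) (bas j) t ∉ upperTri n K := by
  intro h
  have hne : j ≠ i.swap := by
    rintro rfl
    rw [rk_swap] at hij
    omega
  obtain ⟨κ, hκ, hκt⟩ := root_apply h2 hne
  have h1 := h i j.swap (by rw [rk_swap]; omega)
  rw [hκt] at h1
  exact mul_ne_zero hκ ht h1

/-- The group of monomial symplectic matrices. -/
def monomial (n : ℕ) (K : Type*) [Field K] : Subgroup (Sp n K) where
  carrier := {g | ∃ π : Equiv.Perm (Fin n ⊕ Fin n), ∀ i, ∃ c : K, act g (bas i) = c • bas (π i)}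
  one_mem' := ⟨1, fun i => ⟨1, by rw [act_one, one_smul, Equiv.Perm.one_apply]⟩⟩
  mul_mem' := by
    rintro a b ⟨π, hπ⟩ ⟨σ, hσ⟩
    refine ⟨π * σ, fun i => ?_⟩
    obtain ⟨c, hc⟩ := hσ i
    obtain ⟨d, hd⟩ := hπ (σ i)
    exact ⟨c * d, by rw [act_mul, hc, act_smul, hd, smul_smul, Equiv.Perm.mul_apply]⟩
  inv_mem' := by
    rintro a ⟨π, hπ⟩
    refine ⟨π⁻¹, fun i => ?_⟩
    obtain ⟨c, hc⟩ := hπ (π⁻¹ i)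
    rw [show π (π⁻¹ i) = i from π.apply_symm_apply i] at hc
    have h := act_inv_act a (bas (π⁻¹ i))
    rw [hc, act_smul] at h
    have hc0 : c ≠ 0 := by
      rintro rfl
      rw [zero_smul] at h
      have := congrFun h (π⁻¹ i)
      rw [bas_self] at this
      simp at this
    exact ⟨c⁻¹, by rw [← h, smul_smul, inv_mul_cancel₀ hc0, one_smul]⟩

theorem ne_zero_of_act_bas {g : Sp n K} {i j : Fin n ⊕ Fin n} {c : K}
    (h : act g (bas i) = c • bas j) : c ≠ 0 := by
  rintro rfl
  have h1 := act_inv_act g (bas i)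
  rw [h, zero_smul, act_zero] at h1
  have := congrFun h1 i
  rw [bas_self] at this
  simp at this

theorem eq_swap_of_act_bas {g : Sp n K} {i j k : Fin n ⊕ Fin n} {c d : K}
    (h : act g (bas i) = c • bas j) (h' : act g (bas i.swap) = d • bas k) : k = j.swap := by
  by_contra hk
  have h1 := form_act g (bas i) (bas i.swap)
  rw [h, h', form_smul_left, form_smul_right, form_bas_bas_eq_zero hk, form_bas_left, bas_self,
    mul_zero, mul_zero, mul_one] at h1
  exact sgn_ne_zero i h1.symm

theorem swapSp_eq_levi (i j : Fin n) : (swapSp i j : Sp n K) =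
    levi (Matrix.GeneralLinearGroup.mkOfDetNeZero ((Equiv.swap i j).permMatrix K)
      (by rw [Matrix.det_permutation]; rcases Int.units_eq_one_or (Equiv.Perm.sign (Equiv.swap i j))
            with h | h <;> simp [h])) := by
  set A := Matrix.GeneralLinearGroup.mkOfDetNeZero ((Equiv.swap i j).permMatrix K) _ with hA
  have hA1 : (A : Matrix (Fin n) (Fin n) K) = (Equiv.swap i j).permMatrix K := rfl
  have hAA : A * A = 1 := by
    apply Units.ext
    rw [Units.val_mul, hA1, ← Matrix.permMatrix_mul, Equiv.swap_mul_self, Matrix.permMatrix_one]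
    rfl
  have hinv : A⁻¹ = A := inv_eq_of_mul_eq_one_left hAA
  apply Subtype.ext
  change Matrix.fromBlocks _ _ _ _ = Matrix.fromBlocks _ _ _ _
  rw [hinv, hA1, Matrix.transpose_permMatrix, Equiv.swap_inv]

theorem act_swapSp (k l : Fin n) (x : Fin n ⊕ Fin n → K) :
    act (swapSp k l) x = fun i => x (Sum.map (Equiv.swap k l) (Equiv.swap k l) i) := by
  ext i
  rcases i with i | i <;>
    simp [act, swapSp, Matrix.fromBlocks_mulVec, Matrix.permMatrix_mulVec]

theorem act_cSp (k : Fin n) (x : Fin n ⊕ Fin n → K) :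
    act (cSp k) x = x + (-x (Sum.inr k) - x (Sum.inl k)) • bas (Sum.inl k) +
      (x (Sum.inl k) - x (Sum.inr k)) • bas (Sum.inr k) := by
  ext i
  rcases i with i | i <;> by_cases h : i = k <;>
    simp [act, cSp, Matrix.fromBlocks_mulVec, Matrix.sub_mulVec, Matrix.neg_mulVec,
      Matrix.single_mulVec, bas_apply, h]

end Roots

/-! ### Simple reflections and their rank-one relations. -/

section Simple

variable {n : ℕ} {K : Type*} [Field K]

/-- `s` is a representative of the reflection in the simple root whose root subgroup is
`t ↦ rootElt e_a e_{b'} t`, with `b'` the partner of `b`. -/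
structure IsSimpleReflection (s : Sp n K) (a b : Fin n ⊕ Fin n) : Prop where
  mem : s ∈ groupW₂ n K
  lt : rk a < rk b
  adj : ∀ m, rk a ≤ rk m → rk m ≤ rk b → m = a ∨ m = b
  inversion : ∃ (π : Equiv.Perm (Fin n ⊕ Fin n)) (c : Fin n ⊕ Fin n → K),
    (∀ i, act s (bas i) = c i • bas (π i)) ∧
    ∀ i j, rk i < rk j → rk (π j) ≤ rk (π i) → (i = a ∧ j = b) ∨ (i = b.swap ∧ j = a.swap)
  conj : ∀ t, s * rootElt (bas a) (bas b.swap) t * s⁻¹ = rootElt (bas a.swap) (bas b) t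
  sq : s * s ∈ torusH n K
  rel : ∃ κ : K, κ ≠ 0 ∧ ∀ t, t ≠ 0 → ∃ t' : K, ∃ h ∈ torusH n K,
    s * rootElt (bas a) (bas b.swap) t * s =
      rootElt (bas a) (bas b.swap) (κ * t⁻¹) * s * h * rootElt (bas a) (bas b.swap) t'

/-- Produces the torus factor in `IsSimpleReflection.rel` from a coordinatewise comparison of a word
`y` with `s`. -/
theorem inv_mul_mem_torusH {s y : Sp n K} (π : Fin n ⊕ Fin n → Fin n ⊕ Fin n)
    (c : Fin n ⊕ Fin n → K) (hs : ∀ i, act s (bas i) = c i • bas (π i)) (d : Fin n ⊕ Fin n → K)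
    (h : ∀ x i, act y x i = d i * act s x i) : s⁻¹ * y ∈ torusH n K := by
  rw [mem_torusH_iff]
  intro m
  refine ⟨d (π m), ?_⟩
  have : act y (bas m) = d (π m) • act s (bas m) := by
    ext i
    rw [h, Pi.smul_apply, smul_eq_mul, hs m]
    by_cases hi : i = π m
    · rw [hi]
    · rw [Pi.smul_apply, bas_of_ne hi, smul_zero, mul_zero, mul_zero]
  rw [act_mul, this, act_smul, act_inv_act]

theorem act_swapSp_bas (k l : Fin n) (i : Fin n ⊕ Fin n) :
    act (swapSp k l) (bas i : Fin n ⊕ Fin n → K) =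
      (1 : K) • bas (Equiv.sumCongr (Equiv.swap k l) (Equiv.swap k l) i) := by
  rw [act_swapSp, one_smul]
  ext j
  rw [bas_apply, bas_apply]
  refine if_congr ?_ rfl rfl
  rcases i with i | i <;> rcases j with j | j <;> simp [Equiv.swap_apply_eq_iff]

theorem swapSp_mul_self (k l : Fin n) : (swapSp k l : Sp n K) * swapSp k l = 1 := by
  refine ext_act fun x => ?_
  rw [act_mul, act_one, act_swapSp, act_swapSp]
  ext i
  rcases i with i | i <;> simp

theorem isSimpleReflection_swapSp {k l : Fin n} (hkl : (k : ℕ) + 1 = l) :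
    IsSimpleReflection (swapSp k l : Sp n K) (Sum.inl k) (Sum.inl l) := by
  have hne : k ≠ l := by
    rintro rfl
    omega
  have hroot : (Sum.inl l : Fin n ⊕ Fin n).swap ≠ (Sum.inl k : Fin n ⊕ Fin n).swap := by
    simpa using hne.symm
  have horth : form (bas (Sum.inl k) : Fin n ⊕ Fin n → K)
      (bas (Sum.inl l : Fin n ⊕ Fin n).swap) = 0 :=
    form_bas_bas_eq_zero hroot
  refine ⟨Subgroup.subset_closure (Or.inl ⟨k, l, hkl, rfl⟩), ?_, ?_, ?_, ?_, ?_, ?_⟩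
  · simp only [rk_inl]
    omega
  · rintro (m | m) h1 h2 <;> simp only [rk_inl, rk_inr, Sum.inl.injEq, Fin.ext_iff] at *
    · omega
    · have := m.2
      have := l.2
      omega
  · refine ⟨Equiv.sumCongr (Equiv.swap k l) (Equiv.swap k l), fun _ => 1, act_swapSp_bas k l, ?_⟩
    rintro (i | i) (j | j) h1 h2 <;>
      simp only [rk_inl, rk_inr, Equiv.sumCongr_apply, Sum.map_inl, Sum.map_inr, Sum.swap_inl,
        Equiv.swap_apply_def, Sum.inl.injEq, Sum.inr.injEq, Fin.ext_iff, reduceCtorEq] at h1 h2 ⊢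
    · left
      split_ifs at h2 <;> omega
    · exfalso
      have := (Equiv.swap k l i).2
      have := (Equiv.swap k l j).2
      simp only [Equiv.swap_apply_def, Fin.ext_iff] at *
      omega
    · exfalso
      have := i.2
      have := j.2
      omega
    · right
      split_ifs at h2 <;> omega
  · intro t
    rw [conj_rootElt, act_swapSp_bas, act_swapSp_bas, one_smul, one_smul, rootElt_comm]
    · simp
    · simp only [Equiv.sumCongr_apply, Sum.map_inl, Sum.swap_inl, Sum.map_inr, Equiv.swap_apply_left,
        Equiv.swap_apply_right]
      exact form_bas_bas_eq_zero (by simpa using hne)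
  · rw [swapSp_mul_self]
    exact one_mem _
  -- The identity of SL₂: x(-t⁻¹) s x(t) s x(-t⁻¹) is monomial with the same permutation as s, and
  -- `Sum.elim` lists the ratios of the coefficients.
  · refine ⟨1, one_ne_zero, fun t ht => ⟨t⁻¹, _, inv_mul_mem_torusH _ _ (act_swapSp_bas k l)
      (y := rootElt (bas (Sum.inl k)) (bas (Sum.inl l : Fin n ⊕ Fin n).swap) (-t⁻¹) * swapSp k l *
        rootElt (bas (Sum.inl k)) (bas (Sum.inl l : Fin n ⊕ Fin n).swap) t * swapSp k l *
        rootElt (bas (Sum.inl k)) (bas (Sum.inl l : Fin n ⊕ Fin n).swap) (-t⁻¹))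
      (Sum.elim (fun i => if i = l then -t else if i = k then t⁻¹ else 1)
        (fun i => if i = l then -t⁻¹ else if i = k then t else 1)) ?_, ?_⟩⟩
    · intro x i
      simp only [act_mul, act_root hroot, act_swapSp]
      rcases i with i | i
      · by_cases h1 : i = l
        · subst h1
          simp [bas_apply, hne, hne.symm, sgn]
          field_simp
          ring
        · by_cases h3 : i = k
          · subst h3
            simp [bas_apply, hne, hne.symm, sgn]
            field_simp
            ring
          · simp [bas_apply, hne, hne.symm, sgn, h1, h3, Equiv.swap_apply_of_ne_of_ne h3 h1]
      · by_cases h1 : i = l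
        · subst h1
          simp [bas_apply, hne, hne.symm, sgn]
          field_simp
          ring
        · by_cases h3 : i = k
          · subst h3
            simp [bas_apply, hne, hne.symm, sgn]
            field_simp
            ring
          · simp [bas_apply, hne, hne.symm, sgn, h1, h3, Equiv.swap_apply_of_ne_of_ne h3 h1]
    · rw [rootElt_neg horth, one_mul]
      group

theorem act_cSp_bas (k : Fin n) (i : Fin n ⊕ Fin n) :
    act (cSp k) (bas i : Fin n ⊕ Fin n → K) =
      (if i = Sum.inr k then -1 else 1 : K) • bas (Equiv.swap (Sum.inl k) (Sum.inr k) i) := by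
  rw [act_cSp]
  by_cases h1 : i = Sum.inl k
  · subst h1
    ext j
    simp [bas_apply]
  · by_cases h2 : i = Sum.inr k
    · subst h2
      ext j
      simp only [bas_apply, Pi.add_apply, Pi.smul_apply]
      by_cases h : j = Sum.inl k
      · simp [h]
      · by_cases h' : j = Sum.inr k <;> simp [h, h']
    · rw [Equiv.swap_apply_of_ne_of_ne h1 h2, if_neg h2, one_smul, bas_of_ne (Ne.symm h1),
        bas_of_ne (Ne.symm h2)]
      simp

theorem cSp_mul_self_mem (k : Fin n) : (cSp k : Sp n K) * cSp k ∈ torusH n K := by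
  rw [mem_torusH_iff]
  intro i
  rw [act_mul, act_cSp_bas, act_smul, act_cSp_bas, Equiv.swap_apply_self, smul_smul]
  exact ⟨_, rfl⟩

theorem isSimpleReflection_cSp (h2 : (2 : K) ≠ 0) {k : Fin n} (hk : (k : ℕ) + 1 = n) :
    IsSimpleReflection (cSp k : Sp n K) (Sum.inl k) (Sum.inr k) := by
  have hroot : (Sum.inr k : Fin n ⊕ Fin n).swap ≠ (Sum.inl k : Fin n ⊕ Fin n).swap := by simp
  have horth : form (bas (Sum.inl k) : Fin n ⊕ Fin n → K)
      (bas (Sum.inr k : Fin n ⊕ Fin n).swap) = 0 :=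
    form_bas_bas_eq_zero hroot
  refine ⟨Subgroup.subset_closure (Or.inr ⟨k, rfl⟩), ?_, ?_, ?_, ?_, cSp_mul_self_mem k, ?_⟩
  · simp only [rk_inl, rk_inr]
    omega
  · rintro (m | m) h1 h2 <;>
      simp only [rk_inl, rk_inr, Sum.inl.injEq, Sum.inr.injEq, Fin.ext_iff] at *
    · left
      have := m.2
      omega
    · right
      have := m.2
      omega
  · refine ⟨Equiv.swap (Sum.inl k) (Sum.inr k), _, act_cSp_bas k, ?_⟩
    rintro i j h1 h3
    have hi : ∀ i : Fin n ⊕ Fin n, i ≠ Sum.inl k → i ≠ Sum.inr k → rk i < -1 ∨ 1 < rk i := by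
      rintro (i | i) h h'
      · left
        simp only [ne_eq, Sum.inl.injEq, Fin.ext_iff, rk_inl] at *
        have := i.2
        omega
      · right
        simp only [ne_eq, Sum.inr.injEq, Fin.ext_iff, rk_inr] at *
        have := i.2
        omega
    have hl : rk (Sum.inl k : Fin n ⊕ Fin n) = -1 := by rw [rk_inl]; omega
    have hr : rk (Sum.inr k : Fin n ⊕ Fin n) = 1 := by rw [rk_inr]; omega
    by_cases i1 : i = Sum.inl k
    · subst i1
      by_cases j2 : j = Sum.inr k
      · exact Or.inl ⟨rfl, j2⟩
      · exfalso
        by_cases j1 : j = Sum.inl k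
        · subst j1
          omega
        · rw [Equiv.swap_apply_of_ne_of_ne j1 j2, Equiv.swap_apply_left] at h3
          have := hi j j1 j2
          omega
    · exfalso
      by_cases i2 : i = Sum.inr k
      · subst i2
        by_cases j2 : j = Sum.inr k
        · subst j2
          omega
        · by_cases j1 : j = Sum.inl k
          · subst j1
            omega
          · rw [Equiv.swap_apply_of_ne_of_ne j1 j2, Equiv.swap_apply_right] at h3
            omega
      · have := hi i i1 i2
        rw [Equiv.swap_apply_of_ne_of_ne i1 i2] at h3
        by_cases j2 : j = Sum.inr k
        · subst j2
          rw [Equiv.swap_apply_right] at h3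
          omega
        · by_cases j1 : j = Sum.inl k
          · subst j1
            rw [Equiv.swap_apply_left] at h3
            omega
          · rw [Equiv.swap_apply_of_ne_of_ne j1 j2] at h3
            omega
  · intro t
    rw [conj_rootElt, Sum.swap_inr, act_cSp_bas]
    simp
  · have h4 : (4 : K) ≠ 0 := by
      have : (4 : K) = 2 * 2 := by norm_num
      rw [this]
      exact mul_ne_zero h2 h2
    -- Both vectors of the root element are u_n, so it is the transvection with parameter τ = 2t.
    -- The SL₂ rule τ ↦ -τ⁻¹ then becomes t ↦ -(4t)⁻¹.
    refine ⟨-4⁻¹, neg_ne_zero.2 (inv_ne_zero h4), fun t ht => ⟨-4⁻¹ * t⁻¹, _,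
      inv_mul_mem_torusH _ _ (act_cSp_bas k)
      (y := rootElt (bas (Sum.inl k)) (bas (Sum.inr k : Fin n ⊕ Fin n).swap) (-(-4⁻¹ * t⁻¹)) *
        cSp k *
        rootElt (bas (Sum.inl k)) (bas (Sum.inr k : Fin n ⊕ Fin n).swap) t * cSp k *
        rootElt (bas (Sum.inl k)) (bas (Sum.inr k : Fin n ⊕ Fin n).swap) (-(-4⁻¹ * t⁻¹)))
      (Sum.elim (fun i => if i = k then (2 * t)⁻¹ else 1)
        (fun i => if i = k then 2 * t else 1)) ?_, ?_⟩⟩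
    · intro x i
      simp only [act_mul, act_root hroot, act_cSp]
      rcases i with i | i
      · by_cases h1 : i = k
        · subst h1
          simp [bas_apply, sgn]
          field_simp
          ring
        · simp [bas_apply, sgn, h1]
      · by_cases h1 : i = k
        · subst h1
          simp [bas_apply, sgn]
          field_simp
          ring
        · simp [bas_apply, sgn, h1]
    · rw [rootElt_neg horth]
      group

end Simple

/-! ### Uniqueness in the Bruhat decomposition; factorization of U along a simple root. -/

section Bruhat

variable {n : ℕ} {K : Type*} [Field K]

theorem act_monomial_apply {s : Sp n K} {π : Equiv.Perm (Fin n ⊕ Fin n)} {c : Fin n ⊕ Fin n → K}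
    (hs : ∀ i, act s (bas i) = c i • bas (π i)) (x : Fin n ⊕ Fin n → K) (i : Fin n ⊕ Fin n) :
    act s x (π i) = c i * x i := by
  have hx : x = ∑ m, x m • (bas m : Fin n ⊕ Fin n → K) := by
    ext j
    simp [Finset.sum_apply, bas_apply]
  have h1 : act s x = ∑ m, x m • act s (bas m) := by
    conv_lhs => rw [hx, act, Matrix.mulVec_sum]
    exact Finset.sum_congr rfl fun m _ => Matrix.mulVec_smul _ _ _
  rw [h1, Finset.sum_apply, Finset.sum_eq_single i]
  · rw [hs, Pi.smul_apply, Pi.smul_apply, bas_self, smul_eq_mul, smul_eq_mul, mul_one, mul_comm]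
  · intro m _ hm
    rw [hs, Pi.smul_apply, Pi.smul_apply, bas_of_ne, smul_zero, smul_zero]
    exact fun h => hm (π.injective h).symm
  · simp

theorem conj_monomial_apply {s : Sp n K} {π : Equiv.Perm (Fin n ⊕ Fin n)} {c : Fin n ⊕ Fin n → K}
    (hs : ∀ i, act s (bas i) = c i • bas (π i)) (u : Sp n K) (i j : Fin n ⊕ Fin n) :
    ((s * u * s⁻¹ : Sp n K) : Matrix (Fin n ⊕ Fin n) (Fin n ⊕ Fin n) K) (π i) (π j) =
      c i * (u : Matrix (Fin n ⊕ Fin n) (Fin n ⊕ Fin n) K) i j * (c j)⁻¹ := by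
  have hc : c j ≠ 0 := ne_zero_of_act_bas (hs j)
  have h1 : act s⁻¹ (bas (π j)) = (c j)⁻¹ • bas j := by
    rw [← act_inv_act s (bas j), hs, act_smul, smul_smul, inv_mul_cancel₀ hc, one_smul]
  rw [← act_bas, act_mul, act_mul, h1, act_monomial_apply hs, act_smul, Pi.smul_apply, act_bas,
    smul_eq_mul]
  ring

theorem groupW₂_le_monomial : groupW₂ n K ≤ monomial n K := by
  rw [groupW₂, Subgroup.closure_le]
  rintro g (⟨i, j, _, rfl⟩ | ⟨k, rfl⟩)
  · exact ⟨_, fun m => ⟨_, act_swapSp_bas i j m⟩⟩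
  · exact ⟨_, fun m => ⟨_, act_cSp_bas k m⟩⟩

theorem conj_mem_torusH {w h : Sp n K} (hw : w ∈ monomial n K) (hh : h ∈ torusH n K) :
    w⁻¹ * h * w ∈ torusH n K := by
  obtain ⟨π, hπ⟩ := hw
  rw [mem_torusH_iff] at hh ⊢
  intro i
  obtain ⟨c, hc⟩ := hπ i
  obtain ⟨d, hd⟩ := hh (π i)
  refine ⟨d, ?_⟩
  rw [act_mul, act_mul, hc, act_smul, hd, smul_comm c d, act_smul, ← hc, act_inv_act]

theorem conj_torusH_mem_upperUni {h u : Sp n K} (hh : h ∈ torusH n K) (hu : u ∈ upperUni n K) :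
    h * u * h⁻¹ ∈ upperUni n K := by
  choose c hc using mem_torusH_iff.1 hh
  have key := fun i j => conj_monomial_apply (s := h) (π := 1) (c := c) hc u i j
  simp only [Equiv.Perm.one_apply] at key
  refine ⟨fun i j hij => ?_, fun i => ?_⟩
  · rw [key, hu.1 i j hij, mul_zero, zero_mul]
  · rw [key, hu.2, mul_one, mul_inv_cancel₀ (ne_zero_of_act_bas (hc i))]

/-- Uniqueness in the Bruhat decomposition. -/
theorem inv_mul_mem_torusH_of_bruhat {u b w w' : Sp n K} (hu : u ∈ upperUni n K)
    (hb : b ∈ upperTri n K) (hw : w ∈ monomial n K) (hw' : w' ∈ monomial n K)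
    (h : u * w = w' * b) : w⁻¹ * w' ∈ torusH n K := by
  obtain ⟨π, hπ⟩ := hw
  obtain ⟨σ, hσ⟩ := hw'
  choose c hc using hπ
  choose d hd using hσ
  -- The entry at (π j, j) is nonzero on the left, and would vanish on the right if the rank went
  -- up. A permutation that never raises the rank is the identity, because the sum of the ranks is
  -- preserved.
  have hle : ∀ j, rk (σ.symm (π j)) ≤ rk j := by
    intro j
    by_contra! hlt
    have h1 : act (u * w) (bas j) (π j) = c j := by
      rw [act_mul, hc, act_smul, Pi.smul_apply, act_bas, hu.2, smul_eq_mul, mul_one]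
    have h2 : act (w' * b) (bas j) (π j) = 0 := by
      have := act_monomial_apply hd (act b (bas j)) (σ.symm (π j))
      rw [Equiv.apply_symm_apply, act_bas, hb _ _ hlt, mul_zero] at this
      rw [act_mul, this]
    rw [h, h2] at h1
    exact ne_zero_of_act_bas (hc j) h1.symm
  have hid : ∀ j, σ.symm (π j) = j := by
    have hsum : ∑ j, rk (σ.symm (π j)) = ∑ j : Fin n ⊕ Fin n, rk j :=
      Equiv.sum_comp (π.trans σ.symm) rk
    intro j
    exact rk_injective ((Finset.sum_eq_sum_iff_of_le fun j _ => hle j).1 hsum j (Finset.mem_univ j))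
  rw [mem_torusH_iff]
  intro i
  have hi : σ i = π i := by
    rw [← hid i, Equiv.apply_symm_apply, hid]
  refine ⟨d i * (c i)⁻¹, ?_⟩
  have h1 : (bas (π i) : Fin n ⊕ Fin n → K) = (c i)⁻¹ • act w (bas i) := by
    rw [hc, smul_smul, inv_mul_cancel₀ (ne_zero_of_act_bas (hc i)), one_smul]
  rw [act_mul, hd, hi, h1, act_smul, act_smul, act_inv_act, smul_smul]

theorem IsSimpleReflection.swap_ne {s : Sp n K} {a b : Fin n ⊕ Fin n}
    (hs : IsSimpleReflection s a b) : b.swap ≠ a.swap := by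
  intro h
  have := hs.lt
  rw [Sum.swap_leftInverse.injective h] at this
  exact lt_irrefl _ this

theorem IsSimpleReflection.form_eq_zero {s : Sp n K} {a b : Fin n ⊕ Fin n}
    (hs : IsSimpleReflection s a b) : form (bas a : Fin n ⊕ Fin n → K) (bas b.swap) = 0 :=
  form_bas_bas_eq_zero hs.swap_ne

theorem IsSimpleReflection.root_mem {s : Sp n K} {a b : Fin n ⊕ Fin n}
    (hs : IsSimpleReflection s a b) (t : K) :
    rootElt (bas a) (bas b.swap) t ∈ upperUni n K := by
  refine root_mem_upperUni ?_ t
  rw [rk_swap]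
  have := hs.lt
  omega

theorem IsSimpleReflection.conj_mem {s : Sp n K} {a b : Fin n ⊕ Fin n}
    (hs : IsSimpleReflection s a b) {u : Sp n K} (hu : u ∈ upperUni n K)
    (hab : (u : Matrix (Fin n ⊕ Fin n) (Fin n ⊕ Fin n) K) a b = 0) :
    s * u * s⁻¹ ∈ upperUni n K := by
  have hne : a ≠ b := fun h => hs.swap_ne (by rw [h])
  -- Inversion negates the entry of a simple root, and by `inv_apply` it also carries the entry at
  -- (b', a') to (a, b) up to sign. So these two entries, the only ones that `s` moves below the
  -- diagonal, vanish together.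
  have hab' : (u : Matrix (Fin n ⊕ Fin n) (Fin n ⊕ Fin n) K) b.swap a.swap = 0 := by
    have h1 := upperUni_mul_apply (inv_mem hu) hu hne hs.adj
    rw [inv_mul_cancel, hab, add_zero, inv_apply] at h1
    simp only [Submonoid.coe_one, Matrix.one_apply, if_neg hne] at h1
    have := (mul_eq_zero.1 h1.symm).resolve_left (sgn_ne_zero a)
    exact (mul_eq_zero.1 this).resolve_left (sgn_ne_zero b)
  obtain ⟨π, c, hc, hinv⟩ := hs.inversion
  refine ⟨fun i j hij => ?_, fun i => ?_⟩
  · obtain ⟨i, rfl⟩ := π.surjective i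
    obtain ⟨j, rfl⟩ := π.surjective j
    rw [conj_monomial_apply hc]
    rcases lt_trichotomy (rk i) (rk j) with h | h | h
    · rcases hinv i j h hij.le with ⟨rfl, rfl⟩ | ⟨rfl, rfl⟩
      · rw [hab, mul_zero, zero_mul]
      · rw [hab', mul_zero, zero_mul]
    · rw [rk_injective h] at hij
      exact absurd hij (lt_irrefl _)
    · rw [hu.1 i j h, mul_zero, zero_mul]
  · obtain ⟨i, rfl⟩ := π.surjective i
    rw [conj_monomial_apply hc, hu.2, mul_one, mul_inv_cancel₀ (ne_zero_of_act_bas (hc i))]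

/-- `U` is the product of the root subgroup of `s` and of the subgroup `U ∩ s⁻¹Us`. -/
theorem IsSimpleReflection.exists_root (h2 : (2 : K) ≠ 0) {s : Sp n K} {a b : Fin n ⊕ Fin n}
    (hs : IsSimpleReflection s a b) {u : Sp n K} (hu : u ∈ upperUni n K) :
    ∃ t : K, ∃ v ∈ upperUni n K, s * v * s⁻¹ ∈ upperUni n K ∧
      u = v * rootElt (bas a) (bas b.swap) t := by
  have hne : a ≠ b := fun h => hs.swap_ne (by rw [h])
  obtain ⟨κ, hκ, hκt⟩ := root_apply h2 hs.swap_ne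
  rw [Sum.swap_swap] at hκt
  set t := (u : Matrix (Fin n ⊕ Fin n) (Fin n ⊕ Fin n) K) a b / κ with ht
  have hv : u * rootElt (bas a) (bas b.swap) (-t) ∈ upperUni n K := mul_mem hu (hs.root_mem _)
  refine ⟨t, _, hv, hs.conj_mem hv ?_, ?_⟩
  · rw [upperUni_mul_apply hu (hs.root_mem _) hne hs.adj, hκt, ht]
    field_simp
    ring
  · rw [mul_assoc, ← rootElt_add hs.form_eq_zero, neg_add_cancel, rootElt_zero hs.form_eq_zero,
      mul_one]

theorem IsSimpleReflection.conj_root_notMem (h2 : (2 : K) ≠ 0) {s : Sp n K}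
    {a b : Fin n ⊕ Fin n} (hs : IsSimpleReflection s a b) {t : K}
    (h : s * rootElt (bas a) (bas b.swap) t * s⁻¹ ∈ upperUni n K) : t = 0 := by
  by_contra ht
  rw [hs.conj] at h
  refine root_notMem_upperTri h2 ?_ ht h.1
  rw [rk_swap]
  have := hs.lt
  omega

end Bruhat

/-! ### Generators of the symplectic group. -/

section Generation

variable {n : ℕ} {K : Type*} [Field K]

/-- The element of `Sp^M` with off-diagonal block a symmetric matrix. -/
def siegel (S : Matrix (Fin n) (Fin n) K) (hS : Sᵀ = S) : Sp n K :=
  ⟨Matrix.fromBlocks 1 S 0 1, by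
    rw [SymplecticGroup.mem_iff]
    simp only [Matrix.J, Matrix.fromBlocks_multiply, Matrix.fromBlocks_transpose]
    simp [hS]⟩

theorem siegel_mem_fixM (S : Matrix (Fin n) (Fin n) K) (hS : Sᵀ = S) : siegel S hS ∈ fixM n K := by
  intro x
  ext i
  rcases i with i | i <;> simp [act, siegel, Matrix.fromBlocks_mulVec, inM]

/-- For k in J, the element c_k exchanges rows u_k and v_k up to sign, so row k of the lower left
block becomes zero. After removing all of J the matrix stabilizes M. -/
theorem mem_of_diagonal_block (D : Subgroup (Sp n K)) (hM : fixM n K ≤ D)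
    (hL : ∀ A : GL (Fin n) K, levi A ∈ D) (hC : ∀ k : Fin n, cSp k ∈ D) (m : ℕ) :
    ∀ (g : Sp n K) (J : Finset (Fin n)), J.card = m →
      (∀ i j, i ≠ j ∨ i ∉ J →
        (g : Matrix (Fin n ⊕ Fin n) (Fin n ⊕ Fin n) K) (Sum.inr i) (Sum.inl j) = 0) →
      (∀ i ∈ J, ∀ j,
        (g : Matrix (Fin n ⊕ Fin n) (Fin n ⊕ Fin n) K) (Sum.inl i) (Sum.inl j) = 0) → g ∈ D := by
  induction m with
  | zero =>
    intro g J hJ h1 _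
    rw [Finset.card_eq_zero] at hJ
    subst hJ
    obtain ⟨s, hs, A, rfl, -⟩ := exists_fixM_mul_levi (g := g) fun i j => h1 i j (Or.inr (by simp))
    exact mul_mem (hM hs) (hL A)
  | succ m ih =>
    intro g J hJ h1 h2
    obtain ⟨k, hk⟩ : J.Nonempty := Finset.card_pos.1 (by omega)
    have hmul : ∀ i j, ((cSp k * g : Sp n K) : Matrix (Fin n ⊕ Fin n) (Fin n ⊕ Fin n) K) i j =
        act (cSp k) (fun l => (g : Matrix (Fin n ⊕ Fin n) (Fin n ⊕ Fin n) K) l j) i := by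
      intro i j
      rw [coe_mul_apply]
      rfl
    have h3 : cSp k * g ∈ D := by
      refine ih (cSp k * g) (J.erase k) (by rw [Finset.card_erase_of_mem hk]; omega) ?_ ?_
      · intro i j hij
        rw [hmul, act_cSp]
        by_cases hik : i = k
        · subst hik
          simp [bas_apply, h2 i hk]
        · have : i ≠ j ∨ i ∉ J := by
            rcases hij with h | h
            · exact Or.inl h
            · right
              intro h'
              exact h (Finset.mem_erase.2 ⟨hik, h'⟩)
          simp [bas_apply, hik, h1 i j this]
      · intro i hi j
        rw [Finset.mem_erase] at hi
        rw [hmul, act_cSp]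
        simp [bas_apply, hi.1, h2 i hi.2]
    have h4 := mul_mem (inv_mem (hC k)) h3
    rwa [inv_mul_cancel_left] at h4

/-- The symplectic group is generated by the stabilizer of `M` and the elements `c_k`. -/
theorem eq_top_of_parabolic (D : Subgroup (Sp n K)) (hM : fixM n K ≤ D)
    (hL : ∀ A : GL (Fin n) K, levi A ∈ D) (hC : ∀ k : Fin n, cSp k ∈ D) : D = ⊤ := by
  classical
  have step : ∀ (g : Sp n K) (d : Fin n → K), (∀ i j,
      (g : Matrix (Fin n ⊕ Fin n) (Fin n ⊕ Fin n) K) (Sum.inr i) (Sum.inl j) =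
        if i = j then d i else 0) → g ∈ D := by
    intro g d hd
    have hsymm : ∀ i j, (g : Matrix (Fin n ⊕ Fin n) (Fin n ⊕ Fin n) K) (Sum.inl i) (Sum.inl j) * d i
        = (g : Matrix (Fin n ⊕ Fin n) (Fin n ⊕ Fin n) K) (Sum.inl j) (Sum.inl i) * d j := by
      intro i j
      have h := form_act g (bas (Sum.inl i)) (bas (Sum.inl j))
      rw [form_bas_bas_eq_zero (by simp), form] at h
      simp only [act_bas, hd] at h
      simp at h
      linear_combination -h
    -- With upper left block A and lower left block D = diag(d), this makes row i of A + SD vanish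
    -- whenever d_i ≠ 0. The relation `hsymm`, isotropy of the columns, makes S symmetric and forces
    -- A_{ij} = 0 when d_i ≠ 0 = d_j.
    let S : Matrix (Fin n) (Fin n) K := Matrix.of fun i j =>
      if d i = 0 ∨ d j = 0 then 0 else
        -((g : Matrix (Fin n ⊕ Fin n) (Fin n ⊕ Fin n) K) (Sum.inl i) (Sum.inl j) / d j)
    have hS : Sᵀ = S := by
      ext i j
      simp only [S, Matrix.transpose_apply, Matrix.of_apply]
      by_cases hi : d i = 0
      · simp [hi]
      · by_cases hj : d j = 0
        · simp [hj]
        · simp only [hi, hj, or_self, if_false, neg_inj]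
          rw [div_eq_div_iff hi hj, hsymm]
    have hmul : ∀ i j, ((siegel S hS * g : Sp n K) : Matrix (Fin n ⊕ Fin n) (Fin n ⊕ Fin n) K) i j =
        Sum.elim (fun i => (g : Matrix (Fin n ⊕ Fin n) (Fin n ⊕ Fin n) K) (Sum.inl i) j +
          ∑ k, S i k * (g : Matrix (Fin n ⊕ Fin n) (Fin n ⊕ Fin n) K) (Sum.inr k) j)
          (fun i => (g : Matrix (Fin n ⊕ Fin n) (Fin n ⊕ Fin n) K) (Sum.inr i) j) i := by
      intro i j
      rw [coe_mul_apply, Fintype.sum_sum_type]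
      rcases i with i | i <;> simp [siegel, Matrix.one_apply]
    have h3 : siegel S hS * g ∈ D := by
      refine mem_of_diagonal_block D hM hL hC _ (siegel S hS * g)
        (Finset.univ.filter fun i => d i ≠ 0) rfl ?_ ?_
      · intro i j hij
        rw [hmul, Sum.elim_inr, hd]
        rcases hij with h | h
        · rw [if_neg h]
        · have : d i = 0 := by simpa using h
          simp [this]
      · intro i hi j
        have hi : d i ≠ 0 := by simpa using hi
        rw [hmul, Sum.elim_inl]
        simp only [hd]
        simp only [mul_ite, mul_zero, Finset.sum_ite_eq', Finset.mem_univ, if_true, S,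
          Matrix.of_apply]
        by_cases hj : d j = 0
        · have h := hsymm i j
          rw [hj, mul_zero] at h
          rw [(mul_eq_zero.1 h).resolve_right hi, hj]
          simp
        · simp only [hi, hj, or_self, if_false]
          field_simp
          ring
    have h4 := mul_mem (inv_mem (hM (siegel_mem_fixM S hS))) h3
    rwa [inv_mul_cancel_left] at h4
  rw [eq_top_iff]
  intro g _
  obtain ⟨L, L', d, hd⟩ := Matrix.Pivot.exists_list_transvec_mul_mul_list_transvec_eq_diagonal
    (Matrix.of fun i j : Fin n =>
      (g : Matrix (Fin n ⊕ Fin n) (Fin n ⊕ Fin n) K) (Sum.inr i) (Sum.inl j))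
  set X := (L.map Matrix.TransvectionStruct.toMatrix).prod with hX
  set Y := (L'.map Matrix.TransvectionStruct.toMatrix).prod with hY
  have hXd : X.det = 1 := Matrix.TransvectionStruct.det_toMatrix_prod L
  have hYd : Y.det = 1 := Matrix.TransvectionStruct.det_toMatrix_prod L'
  -- A Levi element acts on N by the inverse transpose, so `levi A⁻¹` multiplies the lower rows by
  -- X.
  let A : GL (Fin n) K := Matrix.GeneralLinearGroup.mkOfDetNeZero Xᵀ (by simp [hXd])
  let B : GL (Fin n) K := Matrix.GeneralLinearGroup.mkOfDetNeZero Y (by simp [hYd])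
  have hA : (A : Matrix (Fin n) (Fin n) K) = Xᵀ := rfl
  have hB : (B : Matrix (Fin n) (Fin n) K) = Y := rfl
  have h5 : levi A⁻¹ * g * levi B ∈ D := by
    refine step _ d fun i j => ?_
    have h6 := congrFun (congrFun hd i) j
    rw [Matrix.diagonal_apply] at h6
    rw [← h6, coe_mul_apply, Fintype.sum_sum_type, Matrix.mul_apply]
    simp only [levi_apply_inl_inl, levi_apply_inr_inl, mul_zero, Finset.sum_const_zero, add_zero]
    refine Finset.sum_congr rfl fun k _ => ?_
    rw [hB, coe_mul_apply, Fintype.sum_sum_type, Matrix.mul_apply]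
    simp only [levi_apply_inr_inl, zero_mul, Finset.sum_const_zero, zero_add, levi_apply_inr_inr,
      inv_inv, hA, Matrix.transpose_apply, Matrix.of_apply]
  have h7 := mul_mem (mul_mem (inv_mem (hL A⁻¹)) h5) (inv_mem (hL B))
  have h8 : (levi A⁻¹ : Sp n K)⁻¹ * (levi A⁻¹ * g * levi B) * (levi B)⁻¹ = g := by group
  rwa [h8] at h7

theorem swapSp_conj (k l i j : Fin n) : (swapSp k l : Sp n K) * swapSp i j * swapSp k l =
    swapSp (Equiv.swap k l i) (Equiv.swap k l j) := by
  refine ext_act fun x => ?_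
  simp only [act_mul, act_swapSp]
  ext m
  rcases m with m | m <;>
    simp [Equiv.swap_apply_apply (Equiv.swap k l)]

theorem swapSp_mem_of_adjacent (D : Subgroup (Sp n K))
    (hW : ∀ i j : Fin n, (i : ℕ) + 1 = j → swapSp i j ∈ D) (i j : Fin n) (hij : i < j) :
    swapSp i j ∈ D := by
  have key : ∀ d : ℕ, ∀ i j : Fin n, (i : ℕ) + d + 1 = j → swapSp i j ∈ D := by
    intro d
    induction d with
    | zero => exact fun i j h => hW i j (by omega)
    | succ d ih =>
      intro i j h
      let k : Fin n := ⟨i + d + 1, by omega⟩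
      have hkj : swapSp k j ∈ D := hW k j (by simp only [k]; omega)
      have h1 := mul_mem (mul_mem hkj (ih i k rfl)) hkj
      rw [swapSp_conj, Equiv.swap_apply_left, Equiv.swap_apply_of_ne_of_ne] at h1
      · exact h1
      · simp only [k, ne_eq, Fin.ext_iff]
        omega
      · simp only [ne_eq, Fin.ext_iff]
        omega
  exact key (j - i - 1) i j (by have := Fin.lt_def.1 hij; omega)

theorem levi_eq_root {i j : Fin n} (hij : i ≠ j) (c : K) {A : GL (Fin n) K}
    (hA : (A : Matrix (Fin n) (Fin n) K) = Matrix.transvection i j c) :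
    levi A = rootElt (bas (Sum.inl i)) (bas (Sum.inr j)) (-c) := by
  have hA' : ((A⁻¹ : GL (Fin n) K) : Matrix (Fin n) (Fin n) K) = Matrix.transvection i j (-c) := by
    have h : (A : Matrix (Fin n) (Fin n) K) * Matrix.transvection i j (-c) = 1 := by
      rw [hA, Matrix.transvection_mul_transvection_same _ _ hij, add_neg_cancel,
        Matrix.transvection_zero]
    rw [Matrix.coe_units_inv]
    exact Matrix.inv_eq_right_inv h
  refine ext_act fun x => ?_
  rw [act_root (by simpa using hij.symm)]
  nth_rewrite 1 [← inM_add_inN x]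
  rw [act_add, act_levi_inM, act_levi_inN, leviN, hA, hA']
  ext m
  rcases m with m | m
  · by_cases h : m = i <;> simp [inM, inN, Matrix.transvection, Matrix.add_mulVec,
      Matrix.single_mulVec, bas_apply, sgn, h]
  · by_cases h : m = j <;> simp [inM, inN, Matrix.transvection, Matrix.add_mulVec,
      Matrix.single_mulVec, bas_apply, sgn, h]

/-- Diagonal matrices and transvections generate GL_n. The diagonal ones lie in H, the upper
transvections in U, and a lower transvection is conjugate to an upper one by a transposition. -/
theorem levi_mem_of_simple (D : Subgroup (Sp n K)) (hU : upperUni n K ≤ D) (hH : torusH n K ≤ D)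
    (hW : ∀ i j : Fin n, (i : ℕ) + 1 = j → swapSp i j ∈ D) (A : GL (Fin n) K) : levi A ∈ D := by
  suffices h : ∀ M : Matrix (Fin n) (Fin n) K, M.det ≠ 0 →
      ∀ A : GL (Fin n) K, (A : Matrix (Fin n) (Fin n) K) = M → levi A ∈ D from
    h A (A.isUnit.map Matrix.detMonoidHom).ne_zero A rfl
  intro M hM
  refine Matrix.diagonal_transvection_induction_of_det_ne_zero
    (fun M => ∀ A : GL (Fin n) K, (A : Matrix (Fin n) (Fin n) K) = M → levi A ∈ D) M hM ?_ ?_ ?_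
  · intro d hd A hA
    apply hH
    have hd' : ∀ i, d i ≠ 0 := by
      rw [Matrix.det_diagonal] at hd
      exact fun i => (Finset.prod_ne_zero_iff.1 hd) i (Finset.mem_univ i)
    have hA' : ((A⁻¹ : GL (Fin n) K) : Matrix (Fin n) (Fin n) K) =
        Matrix.diagonal fun i => (d i)⁻¹ := by
      rw [Matrix.coe_units_inv]
      refine Matrix.inv_eq_right_inv ?_
      rw [hA, Matrix.diagonal_mul_diagonal, ← Matrix.diagonal_one]
      congr 1
      ext i
      exact mul_inv_cancel₀ (hd' i)
    rw [mem_torusH_iff]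
    rintro (i | i)
    · refine ⟨d i, ?_⟩
      rw [bas, ← inM_single, act_levi_inM, hA]
      ext j
      rcases j with j | j <;> simp [inM]
      simp [Pi.single_apply]
    · refine ⟨(d i)⁻¹, ?_⟩
      rw [bas, ← inN_single, act_levi_inN, leviN, hA', Matrix.diagonal_transpose]
      ext j
      rcases j with j | j <;> simp [inN]
      simp [Pi.single_apply]
  · rintro ⟨i, j, hij, c⟩ A hA
    rw [levi_eq_root hij c hA]
    rcases lt_or_gt_of_ne hij with h | h
    · refine hU (root_mem_upperUni ?_ _)
      rw [rk_inl, rk_inr]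
      have := Fin.lt_def.1 h
      omega
    · have hsw := swapSp_mem_of_adjacent D hW j i h
      have h1 : rootElt (bas (Sum.inl j)) (bas (Sum.inr i)) (-c) ∈ D := by
        refine hU (root_mem_upperUni ?_ _)
        rw [rk_inl, rk_inr]
        have := Fin.lt_def.1 h
        omega
      have h2 := mul_mem (mul_mem hsw h1) (inv_mem hsw)
      rw [conj_rootElt, act_swapSp_bas, act_swapSp_bas, one_smul, one_smul] at h2
      simpa using h2
  · intro M N hM hN ihM ihN A hA
    have h1 := ihM (Matrix.GeneralLinearGroup.mkOfDetNeZero M hM) rfl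
    have h2 := ihN (Matrix.GeneralLinearGroup.mkOfDetNeZero N hN) rfl
    have h3 := mul_mem h1 h2
    rw [← map_mul] at h3
    convert! h3
    exact Units.ext hA

/-- The symplectic group is generated by `U`, `H` and the simple reflections. -/
theorem eq_top_of_simple (D : Subgroup (Sp n K)) (hU : upperUni n K ≤ D) (hH : torusH n K ≤ D)
    (hW : ∀ i j : Fin n, (i : ℕ) + 1 = j → swapSp i j ∈ D)
    (hC : ∀ k : Fin n, (k : ℕ) + 1 = n → cSp k ∈ D) : D = ⊤ := by
  refine eq_top_of_parabolic D (fixM_le_upperUni.trans hU) (levi_mem_of_simple D hU hH hW) ?_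
  intro k
  by_cases hk : (k : ℕ) + 1 = n
  · exact hC k hk
  -- The other c_k are conjugates of c_n by transpositions; indices start at 0, so c_n has index n -
  -- 1.
  · let l : Fin n := ⟨n - 1, by have := k.2; omega⟩
    have hl : cSp l ∈ D := hC l (by simp only [l]; have := k.2; omega)
    have hkl : k < l := by
      rw [Fin.lt_def]
      simp only [l]
      have := k.2
      omega
    have hsw := swapSp_mem_of_adjacent D hW k l hkl
    have h1 := mul_mem (mul_mem hsw hl) hsw
    have h2 : (swapSp k l : Sp n K) * cSp l * swapSp k l = cSp k := by
      refine ext_act fun x => ?_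
      rw [act_mul, act_mul, act_cSp, act_cSp, act_add, act_add, act_smul, act_smul, act_swapSp_bas,
        act_swapSp_bas, ← act_mul, swapSp_mul_self, act_one, act_swapSp]
      simp
    rwa [h2] at h1

end Generation

/-! ### Indicator functions in the group algebra. -/

section Indicator

variable {G : Type*} (F : Type*) [Field F]

/-- The sum in the group algebra of the elements of a set. -/
def setSum [Finite G] (X : Set G) : F[G] :=
  MonoidAlgebra.ofCoeff (Finsupp.equivFunOnFinite.symm (X.indicator 1))

variable {F}

theorem coeff_setSum_of_mem [Finite G] {X : Set G} {g : G} (h : g ∈ X) :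
    (setSum F X).coeff g = 1 := by
  simp [setSum, h]

theorem coeff_setSum_of_notMem [Finite G] {X : Set G} {g : G} (h : g ∉ X) :
    (setSum F X).coeff g = 0 := by
  simp [setSum, h]

variable [Group G]

theorem coeff_single_one_mul_apply (x : F[G]) (g h : G) :
    (MonoidAlgebra.single g (1 : F) * x).coeff h = x.coeff (g⁻¹ * h) := by
  rw [MonoidAlgebra.coeff_single_mul_apply, one_mul]

theorem single_mul_setSum [Finite G] {X Y : Set G} (g : G) (h : ∀ x, x ∈ Y ↔ g⁻¹ * x ∈ X) :
    MonoidAlgebra.single g (1 : F) * setSum F X = setSum F Y := by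
  ext x
  rw [coeff_single_one_mul_apply]
  by_cases hx : x ∈ Y
  · rw [coeff_setSum_of_mem hx, coeff_setSum_of_mem ((h x).1 hx)]
  · rw [coeff_setSum_of_notMem hx, coeff_setSum_of_notMem fun h' => hx ((h x).2 h')]

theorem single_mul_single_mul (g h : G) (x : F[G]) :
    MonoidAlgebra.single g (1 : F) * (MonoidAlgebra.single h (1 : F) * x) =
      MonoidAlgebra.single (g * h) (1 : F) * x := by
  rw [← mul_assoc, MonoidAlgebra.single_mul_single, one_mul]

theorem single_one_mul (x : F[G]) : MonoidAlgebra.single (1 : G) (1 : F) * x = x := by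
  rw [← MonoidAlgebra.one_def, one_mul]

end Indicator

/-! ### The apartment, its halves, and the key relation for simple reflections. -/

section Apartment

variable {n : ℕ} {K : Type*} [Field K]

/-- The union of the cosets `wB`, `w ∈ W`, making up the standard apartment. -/
def apartment (n : ℕ) (K : Type*) [Field K] : Set (Sp n K) :=
  {g | ∃ w ∈ groupW₂ n K, w⁻¹ * g ∈ borelB n K}

theorem mul_mem_apartment {w g : Sp n K} (hw : w ∈ groupW₂ n K) :
    w * g ∈ apartment n K ↔ g ∈ apartment n K := by
  constructor
  · rintro ⟨w', hw', h⟩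
    exact ⟨w⁻¹ * w', mul_mem (inv_mem hw) hw', by convert! h using 1; group⟩
  · rintro ⟨w', hw', h⟩
    exact ⟨w * w', mul_mem hw hw', by convert! h using 1; group⟩

theorem mem_apartment_mul {b g : Sp n K} (hb : b ∈ borelB n K) :
    g * b ∈ apartment n K ↔ g ∈ apartment n K := by
  constructor
  · rintro ⟨w, hw, h⟩
    exact ⟨w, hw, by convert! mul_mem h (inv_mem hb) using 1; group⟩
  · rintro ⟨w, hw, h⟩
    exact ⟨w, hw, by convert! mul_mem h hb using 1; group⟩

theorem torusH_mul_mem_apartment {h g : Sp n K} (hh : h ∈ torusH n K) (hg : g ∈ apartment n K) :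
    h * g ∈ apartment n K := by
  obtain ⟨w, hw, hb⟩ := hg
  refine ⟨w, hw, ?_⟩
  have := mul_mem (torusH_le_borelB (conj_mem_torusH (groupW₂_le_monomial hw) hh)) hb
  convert! this using 1
  group

theorem borelB_le_apartment {b : Sp n K} (hb : b ∈ borelB n K) : b ∈ apartment n K :=
  ⟨1, one_mem _, by simpa using hb⟩

/-- Conjugation by monomial matrices carries a root to a root, and the opposite root to the
opposite root. -/
theorem conj_root_monomial {w : Sp n K} (hw : w ∈ monomial n K) {i j : Fin n ⊕ Fin n}
    (hij : j ≠ i.swap) : ∃ i' j' : Fin n ⊕ Fin n, j' ≠ i'.swap ∧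
      (∃ κ : K, κ ≠ 0 ∧ ∀ t, w⁻¹ * rootElt (bas i) (bas j) t * w =
        rootElt (bas i') (bas j') (κ * t)) ∧
      ∃ κ : K, κ ≠ 0 ∧ ∀ t, w⁻¹ * rootElt (bas i.swap) (bas j.swap) t * w =
        rootElt (bas i'.swap) (bas j'.swap) (κ * t) := by
  obtain ⟨π, hπ⟩ := (monomial n K).inv_mem hw
  choose c hc using hπ
  have hsw : ∀ i, π i.swap = (π i).swap := fun i => eq_swap_of_act_bas (hc i) (hc i.swap)
  have hc0 : ∀ i, c i ≠ 0 := fun i => ne_zero_of_act_bas (hc i)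
  have hne : π j ≠ (π i).swap := by
    rw [← hsw]
    exact fun h => hij (π.injective h)
  have key : ∀ i j t, π j ≠ (π i).swap → w⁻¹ * rootElt (bas i) (bas j) t * w =
      rootElt (bas (π i)) (bas (π j)) (c i * c j * t) := by
    intro i j t h
    have := conj_rootElt w⁻¹ (bas i) (bas j) t
    rw [inv_inv, hc, hc, rootElt_smul (form_bas_bas_eq_zero h)] at this
    exact this
  refine ⟨π i, π j, hne, ⟨_, mul_ne_zero (hc0 i) (hc0 j), fun t => key i j t hne⟩,
    ⟨_, mul_ne_zero (hc0 i.swap) (hc0 j.swap), fun t => ?_⟩⟩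
  rw [key i.swap j.swap t, hsw, hsw]
  rw [hsw, hsw]
  exact fun h => hne (Sum.swap_leftInverse.injective h)

/-- The half-apartment on which the root subgroup of `(a, b)` acts trivially. -/
def halfApartment (a b : Fin n ⊕ Fin n) : Set (Sp n K) :=
  {g | g ∈ apartment n K ∧ ∀ t, g⁻¹ * rootElt (bas a) (bas b.swap) t * g ∈ borelB n K}

theorem root_mem_borelB_iff (h2 : (2 : K) ≠ 0) {i j : Fin n ⊕ Fin n} (hij : j ≠ i.swap) {κ : K}
    (hκ : κ ≠ 0) :
    (∀ t, rootElt (bas i) (bas j) (κ * t) ∈ borelB n K) ↔ rk i + rk j < 0 := by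
  constructor
  · intro h
    by_contra! hlt
    have hne : rk i + rk j ≠ 0 := by
      intro h0
      refine hij (rk_injective ?_)
      rw [rk_swap]
      omega
    refine root_notMem_upperTri h2 (lt_of_le_of_ne hlt hne.symm) (t := κ * 1) ?_
      (borelB_le_upperTri (h 1))
    rwa [mul_one]
  · intro h t
    exact upperUni_le_borelB (root_mem_upperUni h _)

variable {s : Sp n K} {a b : Fin n ⊕ Fin n}

/-- For g in wB, conjugation by w turns the root subgroup of s into another root subgroup, which
lies in B exactly if its root is positive. Since s reverses the root, exactly one of g and s⁻¹g
meets the condition. -/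
theorem IsSimpleReflection.mem_halfApartment_iff (h2 : (2 : K) ≠ 0)
    (hs : IsSimpleReflection s a b) {g : Sp n K} (hg : g ∈ apartment n K) :
    s⁻¹ * g ∈ halfApartment a b ↔ g ∉ halfApartment a b := by
  obtain ⟨w, hw, hb⟩ := id hg
  have hsg : s⁻¹ * g ∈ apartment n K := (mul_mem_apartment (inv_mem hs.mem)).2 hg
  have hconj : ∀ r : Sp n K, g⁻¹ * r * g ∈ borelB n K ↔ w⁻¹ * r * w ∈ borelB n K := by
    intro r
    have e1 : w⁻¹ * r * w = (w⁻¹ * g) * (g⁻¹ * r * g) * (w⁻¹ * g)⁻¹ := by group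
    have e2 : g⁻¹ * r * g = (w⁻¹ * g)⁻¹ * (w⁻¹ * r * w) * (w⁻¹ * g) := by group
    constructor
    · intro h
      rw [e1]
      exact mul_mem (mul_mem hb h) (inv_mem hb)
    · intro h
      rw [e2]
      exact mul_mem (mul_mem (inv_mem hb) h) hb
  obtain ⟨i, j, hij, ⟨κ, hκ, h⟩, ⟨κ', hκ', h'⟩⟩ :=
    conj_root_monomial (groupW₂_le_monomial hw) hs.swap_ne
  have hij' : j.swap ≠ i.swap.swap := fun h => hij (Sum.swap_leftInverse.injective h)
  rw [Sum.swap_swap] at h'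
  have hpos : g ∈ halfApartment a b ↔ rk i + rk j < 0 := by
    rw [← root_mem_borelB_iff h2 hij hκ]
    simp only [halfApartment, Set.mem_ofPred_eq, hg, true_and, hconj, h]
  have hneg : s⁻¹ * g ∈ halfApartment a b ↔ rk i.swap + rk j.swap < 0 := by
    rw [← root_mem_borelB_iff h2 hij' hκ']
    simp only [halfApartment, Set.mem_ofPred_eq, hsg, true_and]
    refine forall_congr' fun t => ?_
    rw [← h', ← hs.conj, ← hconj]
    have : (s⁻¹ * g)⁻¹ * rootElt (bas a) (bas b.swap) t * (s⁻¹ * g) =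
        g⁻¹ * (s * rootElt (bas a) (bas b.swap) t * s⁻¹) * g := by group
    rw [this]
  rw [hpos, hneg, rk_swap, rk_swap]
  have hne : rk i + rk j ≠ 0 := by
    intro h0
    refine hij (rk_injective ?_)
    rw [rk_swap]
    omega
  omega

variable [Finite K] {F : Type*} [Field F]

theorem IsSimpleReflection.setSum_apartment (h2 : (2 : K) ≠ 0) (hs : IsSimpleReflection s a b) :
    setSum F (apartment n K) = setSum F (halfApartment a b) +
      MonoidAlgebra.single s (1 : F) * setSum F (halfApartment a b) := by
  ext g
  rw [MonoidAlgebra.coeff_add, Finsupp.add_apply, coeff_single_one_mul_apply]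
  by_cases hg : g ∈ apartment n K
  · rw [coeff_setSum_of_mem hg]
    have h := hs.mem_halfApartment_iff h2 hg
    by_cases hg' : g ∈ halfApartment a b
    · rw [coeff_setSum_of_mem hg', coeff_setSum_of_notMem, add_zero]
      rw [h]
      exact fun h => h hg'
    · rw [coeff_setSum_of_notMem hg', coeff_setSum_of_mem (h.2 hg'), zero_add]
  · rw [coeff_setSum_of_notMem hg, coeff_setSum_of_notMem fun h => hg h.1,
      coeff_setSum_of_notMem, add_zero]
    exact fun h => hg ((mul_mem_apartment (inv_mem hs.mem)).1 h.1)

/-- A root element x_t fixes each chamber gB in the half-apartment, as x_t g = g(g⁻¹x_t g). -/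
theorem IsSimpleReflection.root_mul_half (hs : IsSimpleReflection s a b) (t : K) :
    MonoidAlgebra.single (rootElt (bas a) (bas b.swap) t) (1 : F) *
      setSum F (halfApartment a b) = setSum F (halfApartment a b) := by
  have key : ∀ (t : K) (g : Sp n K), g ∈ halfApartment a b →
      rootElt (bas a) (bas b.swap) t * g ∈ halfApartment a b := by
    rintro t g ⟨hg, hg'⟩
    refine ⟨?_, fun t' => ?_⟩
    · have : rootElt (bas a) (bas b.swap) t * g =
          g * (g⁻¹ * rootElt (bas a) (bas b.swap) t * g) := by group
      rw [this, mem_apartment_mul (hg' t)]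
      exact hg
    · convert! hg' t' using 1
      rw [mul_inv_rev, ← rootElt_neg hs.form_eq_zero]
      simp only [mul_assoc]
      rw [← mul_assoc (rootElt (bas a) (bas b.swap) t'), ← rootElt_add hs.form_eq_zero,
        ← mul_assoc (rootElt (bas a) (bas b.swap) (-t)), ← rootElt_add hs.form_eq_zero]
      congr 3
      ring
  refine single_mul_setSum _ fun x => ⟨fun h => ?_, fun h => ?_⟩
  · rw [← rootElt_neg hs.form_eq_zero]
    exact key _ _ h
  · have := key t _ h
    rwa [mul_inv_cancel_left] at this

theorem IsSimpleReflection.torusH_mul_half (hs : IsSimpleReflection s a b) {h : Sp n K}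
    (hh : h ∈ torusH n K) :
    MonoidAlgebra.single h (1 : F) * setSum F (halfApartment a b) =
      setSum F (halfApartment a b) := by
  have key : ∀ h ∈ torusH n K, ∀ g : Sp n K, g ∈ halfApartment a b →
      h * g ∈ halfApartment a b := by
    rintro h hh g ⟨hg, hg'⟩
    refine ⟨torusH_mul_mem_apartment hh hg, fun t => ?_⟩
    choose c hc using mem_torusH_iff.1 (inv_mem hh)
    have h1 := conj_rootElt h⁻¹ (bas a) (bas b.swap) t
    rw [hc, hc, rootElt_smul hs.form_eq_zero, inv_inv] at h1
    convert! hg' (c a * c b.swap * t) using 1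
    rw [← h1]
    group
  refine single_mul_setSum _ fun x => ⟨fun hx => key _ (inv_mem hh) _ hx, fun hx => ?_⟩
  have := key h hh _ hx
  rwa [mul_inv_cancel_left] at this

theorem groupW₂_mul_apartment {w : Sp n K} (hw : w ∈ groupW₂ n K) :
    MonoidAlgebra.single w (1 : F) * setSum F (apartment n K) = setSum F (apartment n K) :=
  single_mul_setSum _ fun _ => (mul_mem_apartment (inv_mem hw)).symm

theorem torusH_mul_apartment {h : Sp n K} (hh : h ∈ torusH n K) :
    MonoidAlgebra.single h (1 : F) * setSum F (apartment n K) = setSum F (apartment n K) := by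
  refine single_mul_setSum _ fun x =>
    ⟨fun hx => torusH_mul_mem_apartment (inv_mem hh) hx, fun hx => ?_⟩
  have := torusH_mul_mem_apartment hh hx
  rwa [mul_inv_cancel_left] at this

variable [CharP F 2]

/-- Let E be the half-apartment sum, so e = E + sE and both x_t and H fix E. The rank-one relation
gives s x_t sE = x_{κ/t} sE, whence s x_t e = sE + x_{κ/t} sE. Adding 2E = 0 turns this into e +
x_{κ/t} e. -/
theorem IsSimpleReflection.exists_mul_root_mul (h2 : (2 : K) ≠ 0)
    (hs : IsSimpleReflection s a b) : ∃ κ : K, κ ≠ 0 ∧ ∀ t, t ≠ 0 →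
      MonoidAlgebra.single s (1 : F) * (MonoidAlgebra.single (rootElt (bas a) (bas b.swap) t)
        (1 : F) * setSum F (apartment n K)) =
      setSum F (apartment n K) + MonoidAlgebra.single (rootElt (bas a) (bas b.swap) (κ * t⁻¹))
        (1 : F) * setSum F (apartment n K) := by
  obtain ⟨κ, hκ, hrel⟩ := hs.rel
  refine ⟨κ, hκ, fun t ht => ?_⟩
  obtain ⟨t', h, hh, e⟩ := hrel t ht
  set E := setSum F (halfApartment a b : Set (Sp n K)) with hE
  have h1 := hs.setSum_apartment (F := F) h2
  rw [← hE] at h1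
  have h3 : MonoidAlgebra.single s (1 : F) * (MonoidAlgebra.single (rootElt (bas a) (bas b.swap) t)
      (1 : F) * (MonoidAlgebra.single s (1 : F) * E)) =
      MonoidAlgebra.single (rootElt (bas a) (bas b.swap) (κ * t⁻¹)) (1 : F) *
        (MonoidAlgebra.single s (1 : F) * E) := by
    rw [single_mul_single_mul, single_mul_single_mul, e, ← single_mul_single_mul,
      hs.root_mul_half, ← single_mul_single_mul, hs.torusH_mul_half hh, ← single_mul_single_mul]
  rw [h1, mul_add, hs.root_mul_half, mul_add, h3, mul_add, hs.root_mul_half]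
  have h4 : E + E = 0 := add_self_eq_zero_of_module F E
  calc MonoidAlgebra.single s (1 : F) * E +
        MonoidAlgebra.single (rootElt (bas a) (bas b.swap) (κ * t⁻¹)) (1 : F) *
          (MonoidAlgebra.single s (1 : F) * E)
      = (E + E) + (MonoidAlgebra.single s (1 : F) * E +
        MonoidAlgebra.single (rootElt (bas a) (bas b.swap) (κ * t⁻¹)) (1 : F) *
          (MonoidAlgebra.single s (1 : F) * E)) := by rw [h4, zero_add]
    _ = _ := by abel

end Apartment

/-! ### The Steinberg element as an indicator function. -/

section SteinbergElement

variable {n : ℕ} {K : Type*} [Field K] [Finite K] {F : Type*} [Field F] [CharP F 2]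

/-- All signs are 1 in F, and by uniqueness in the Bruhat decomposition an element of the apartment
lies in wB for just one class w. -/
theorem steinbergElement_eq : steinbergElement n K F = setSum F (apartment n K) := by
  classical
  let : Fintype (Weyl n K) := Fintype.ofFinite _
  let : Fintype (borelB n K) := Fintype.ofFinite _
  have hB : ∀ g : Sp n K, (∑ b : borelB n K, MonoidAlgebra.single (b : Sp n K) (1 : F)).coeff g =
      if g ∈ borelB n K then 1 else 0 := by
    intro g
    rw [MonoidAlgebra.coeff_sum, Finsupp.finsetSum_apply]
    split_ifs with hg
    · rw [Finset.sum_eq_single (⟨g, hg⟩ : borelB n K)]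
      · simp
      · intro b _ hb
        rw [MonoidAlgebra.coeff_single, Finsupp.single_apply, if_neg]
        rintro rfl
        exact hb rfl
      · simp
    · refine Finset.sum_eq_zero fun b _ => ?_
      rw [MonoidAlgebra.coeff_single, Finsupp.single_apply, if_neg]
      rintro rfl
      exact hg b.2
  have hcoeff : ∀ g : Sp n K, (steinbergElement n K F).coeff g = ∑ w : Weyl n K,
      if ((Quotient.out w : groupW₂ n K) : Sp n K)⁻¹ * g ∈ borelB n K then (1 : F) else 0 := by
    intro g
    rw [steinbergElement, Finset.sum_mul, MonoidAlgebra.coeff_sum, Finsupp.finsetSum_apply]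
    refine Finset.sum_congr rfl fun w _ => ?_
    rw [CharTwo.neg_eq, one_pow, coeff_single_one_mul_apply]
    exact hB _
  ext g
  rw [hcoeff]
  by_cases hg : g ∈ apartment n K
  · rw [coeff_setSum_of_mem hg]
    obtain ⟨w, hw, hb⟩ := hg
    have hout : ∀ v : Weyl n K, ((Quotient.out v : groupW₂ n K) : Sp n K)⁻¹ * g ∈ borelB n K ↔
        v = QuotientGroup.mk ⟨w, hw⟩ := by
      intro v
      constructor
      · intro h
        rw [← QuotientGroup.out_eq' v, QuotientGroup.eq, Subgroup.mem_subgroupOf]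
        refine inv_mul_mem_torusH_of_bruhat (u := 1)
          (b := (w⁻¹ * g) * (((Quotient.out v : groupW₂ n K) : Sp n K)⁻¹ * g)⁻¹) (one_mem _)
          (borelB_le_upperTri (mul_mem hb (inv_mem h)))
          (groupW₂_le_monomial (Quotient.out v : groupW₂ n K).2) (groupW₂_le_monomial hw) ?_
        group
      · intro h
        have h1 : (QuotientGroup.mk (Quotient.out v : groupW₂ n K) : Weyl n K) =
            QuotientGroup.mk ⟨w, hw⟩ := by
          rw [QuotientGroup.out_eq', h]
        rw [QuotientGroup.eq, Subgroup.mem_subgroupOf] at h1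
        have h3 := mul_mem (torusH_le_borelB h1) hb
        convert! h3 using 1
        simp
    rw [Finset.sum_congr rfl fun v _ => if_congr (hout v) rfl rfl]
    simp
  · rw [coeff_setSum_of_notMem hg]
    refine Finset.sum_eq_zero fun w _ => if_neg fun h => hg ⟨_, (Quotient.out w).2, h⟩

end SteinbergElement

/-! ### Translates of the Steinberg element under U, and their sum. -/

section USum

variable {n : ℕ} {K : Type*} [Field K] {F : Type*} [Field F]

/-- A subgroup containing `U`, `H` and the simple reflections is the whole group. -/
theorem eq_top_of_isSimpleReflection (h2 : (2 : K) ≠ 0) (D : Subgroup (Sp n K))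
    (hU : upperUni n K ≤ D) (hH : torusH n K ≤ D)
    (hS : ∀ s a b, IsSimpleReflection s a b → s ∈ D) : D = ⊤ :=
  eq_top_of_simple D hU hH (fun _ _ h => hS _ _ _ (isSimpleReflection_swapSp h))
    fun _ h => hS _ _ _ (isSimpleReflection_cSp h2 h)

/-- The span of the `U`-translates of the Steinberg element. -/
def uSpan (n : ℕ) (K : Type*) [Field K] [Finite K] (F : Type*) [Field F] :
    Submodule F F[Sp n K] :=
  Submodule.span F {x | ∃ u ∈ upperUni n K,
    x = MonoidAlgebra.single u (1 : F) * setSum F (apartment n K)}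

theorem single_mul_mem_uSpan_of [Finite K] {g : Sp n K}
    (hg : ∀ u ∈ upperUni n K, MonoidAlgebra.single g (1 : F) *
      (MonoidAlgebra.single u (1 : F) * setSum F (apartment n K)) ∈ uSpan n K F)
    {x : F[Sp n K]} (hx : x ∈ uSpan n K F) :
    MonoidAlgebra.single g (1 : F) * x ∈ uSpan n K F := by
  refine Submodule.span_induction (p := fun x _ => MonoidAlgebra.single g (1 : F) * x ∈ uSpan n K F)
    ?_ ?_ ?_ ?_ hx
  · rintro _ ⟨u, hu, rfl⟩
    exact hg u hu
  · rw [mul_zero]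
    exact zero_mem _
  · intro a b _ _ ha hb
    rw [mul_add]
    exact add_mem ha hb
  · intro c a _ ha
    rw [mul_smul_comm]
    exact Submodule.smul_mem _ _ ha

/-- It suffices to treat U, H and simple reflections. H normalizes U and fixes e. For s, write u = v
x_t with svs⁻¹ in U; then s u e = (svs⁻¹) s x_t e, and the key relation applies. -/
theorem single_mul_mem_uSpan [Finite K] [CharP F 2] (h2 : (2 : K) ≠ 0) (g : Sp n K) {x : F[Sp n K]}
    (hx : x ∈ uSpan n K F) : MonoidAlgebra.single g (1 : F) * x ∈ uSpan n K F := by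
  have hmem : ∀ u ∈ upperUni n K,
      MonoidAlgebra.single u (1 : F) * setSum F (apartment n K) ∈ uSpan n K F :=
    fun u hu => Submodule.subset_span ⟨u, hu, rfl⟩
  have hU : ∀ g ∈ upperUni n K, ∀ x ∈ uSpan n K F,
      MonoidAlgebra.single g (1 : F) * x ∈ uSpan n K F := fun g hg x hx =>
    single_mul_mem_uSpan_of (fun u hu => by
      rw [single_mul_single_mul]
      exact hmem _ (mul_mem hg hu)) hx
  have hH : ∀ g ∈ torusH n K, ∀ x ∈ uSpan n K F,
      MonoidAlgebra.single g (1 : F) * x ∈ uSpan n K F := fun g hg x hx =>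
    single_mul_mem_uSpan_of (fun u hu => by
      rw [single_mul_single_mul, ← inv_mul_cancel_right (g * u) g, ← single_mul_single_mul,
        torusH_mul_apartment hg]
      exact hmem _ (conj_torusH_mem_upperUni hg hu)) hx
  have hS : ∀ s a b, IsSimpleReflection s a b → ∀ x ∈ uSpan n K F,
      MonoidAlgebra.single s (1 : F) * x ∈ uSpan n K F := by
    intro s a b hs x hx
    refine single_mul_mem_uSpan_of (fun u hu => ?_) hx
    obtain ⟨t, v, hv, hv', rfl⟩ := hs.exists_root h2 hu
    obtain ⟨κ, -, hκ⟩ := hs.exists_mul_root_mul (F := F) h2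
    rw [← single_mul_single_mul v, single_mul_single_mul s v,
      ← inv_mul_cancel_right (s * v) s, ← single_mul_single_mul (s * v * s⁻¹)]
    refine hU _ hv' _ ?_
    by_cases ht : t = 0
    · rw [ht, rootElt_zero hs.form_eq_zero, single_one_mul, groupW₂_mul_apartment hs.mem,
        ← single_one_mul (setSum F (apartment n K))]
      exact hmem _ (one_mem _)
    · rw [hκ t ht]
      refine add_mem ?_ (hmem _ (hs.root_mem _))
      rw [← single_one_mul (setSum F (apartment n K))]
      exact hmem _ (one_mem _)
  let D : Subgroup (Sp n K) :=
    { carrier := {g | (∀ x ∈ uSpan n K F, MonoidAlgebra.single g (1 : F) * x ∈ uSpan n K F) ∧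
        ∀ x ∈ uSpan n K F, MonoidAlgebra.single g⁻¹ (1 : F) * x ∈ uSpan n K F}
      one_mem' := by
        refine ⟨fun x hx => ?_, fun x hx => ?_⟩
        · rwa [single_one_mul]
        · rwa [inv_one, single_one_mul]
      mul_mem' := by
        intro a b ha hb
        refine ⟨fun x hx => ?_, fun x hx => ?_⟩
        · rw [← single_mul_single_mul]
          exact ha.1 _ (hb.1 _ hx)
        · rw [mul_inv_rev, ← single_mul_single_mul]
          exact hb.2 _ (ha.2 _ hx)
      inv_mem' := by
        intro a ha
        refine ⟨ha.2, fun x hx => ?_⟩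
        rw [inv_inv]
        exact ha.1 x hx }
  have hD : D = ⊤ := by
    refine eq_top_of_isSimpleReflection h2 D (fun g hg => ⟨hU g hg, hU _ (inv_mem hg)⟩)
      (fun g hg => ⟨hH g hg, hH _ (inv_mem hg)⟩) fun s a b hs => ⟨hS s a b hs, fun x hx => ?_⟩
    have : s⁻¹ = s * (s * s)⁻¹ := by group
    rw [this, ← single_mul_single_mul]
    exact hS s a b hs _ (hH _ (inv_mem hs.sq) _ hx)
  have : g ∈ D := by
    rw [hD]
    trivial
  exact this.1 x hx

theorem mem_uSpan_of_mem_steinbergModule [Finite K] [CharP F 2] (h2 : (2 : K) ≠ 0) {x : F[Sp n K]}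
    (hx : x ∈ steinbergModule n K F) : x ∈ uSpan n K F := by
  rw [steinbergModule, Submodule.mem_span_singleton] at hx
  obtain ⟨a, rfl⟩ := hx
  have he : steinbergElement n K F ∈ uSpan n K F := by
    rw [steinbergElement_eq, ← single_one_mul (setSum F (apartment n K))]
    exact Submodule.subset_span ⟨1, one_mem _, rfl⟩
  rw [smul_eq_mul]
  induction a using MonoidAlgebra.induction_linear with
  | zero =>
    rw [zero_mul]
    exact zero_mem _
  | add a b ha hb =>
    rw [add_mul]
    exact add_mem ha hb
  | single g r =>
    have : MonoidAlgebra.single g r = r • MonoidAlgebra.single g (1 : F) := by simp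
    rw [this, smul_mul_assoc]
    exact Submodule.smul_mem _ _ (single_mul_mem_uSpan h2 g he)

theorem single_smul_setSum_univ [Finite K] (g : Sp n K) (c : F) :
    MonoidAlgebra.single g c * setSum F (Set.univ : Set (Sp n K)) = c • setSum F Set.univ := by
  have : MonoidAlgebra.single g c = c • MonoidAlgebra.single g (1 : F) := by simp
  rw [this, smul_mul_assoc, single_mul_setSum (Y := Set.univ) g fun x => by simp]

theorem setSum_univ_ne_zero [Finite K] : setSum F (Set.univ : Set (Sp n K)) ≠ 0 := by
  intro h
  have h1 := congrArg (fun x => x.coeff 1) h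
  simp only [coeff_setSum_of_mem (Set.mem_univ (1 : Sp n K))] at h1
  simp at h1

/-- Multiplication by the sum of the elements of `U`. -/
def uSum (F : Type*) [Field F] [Fintype (upperUni n K)] (x : F[Sp n K]) : F[Sp n K] :=
  ∑ u : upperUni n K, MonoidAlgebra.single (u : Sp n K) (1 : F) * x

variable [Fintype (upperUni n K)]

theorem uSum_single_mul {u : Sp n K} (hu : u ∈ upperUni n K) (x : F[Sp n K]) :
    uSum F (MonoidAlgebra.single u (1 : F) * x) = uSum F x := by
  rw [uSum, uSum, ← Equiv.sum_comp (Equiv.mulRight (⟨u, hu⟩ : upperUni n K))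
    (fun v : upperUni n K => MonoidAlgebra.single (v : Sp n K) (1 : F) * x)]
  refine Finset.sum_congr rfl fun v _ => ?_
  rw [single_mul_single_mul]
  rfl

theorem single_mul_uSum {u : Sp n K} (hu : u ∈ upperUni n K) (x : F[Sp n K]) :
    MonoidAlgebra.single u (1 : F) * uSum F x = uSum F x := by
  rw [uSum, Finset.mul_sum, ← Equiv.sum_comp (Equiv.mulLeft (⟨u, hu⟩ : upperUni n K))
    (fun v : upperUni n K => MonoidAlgebra.single (v : Sp n K) (1 : F) * x)]
  refine Finset.sum_congr rfl fun v _ => ?_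
  rw [single_mul_single_mul]
  rfl

theorem torusH_mul_uSum [Finite K] {h : Sp n K} (hh : h ∈ torusH n K) :
    MonoidAlgebra.single h (1 : F) * uSum F (setSum F (apartment n K)) =
      uSum F (setSum F (apartment n K)) := by
  let φ : upperUni n K → upperUni n K := fun u => ⟨h * u * h⁻¹, conj_torusH_mem_upperUni hh u.2⟩
  have hφ : Function.Bijective φ := by
    refine Finite.injective_iff_bijective.1 fun u v huv => Subtype.ext ?_
    have := congrArg Subtype.val huv
    simpa [φ] using this
  rw [uSum, Finset.mul_sum, ← hφ.sum_comp
    (fun v : upperUni n K => MonoidAlgebra.single (v : Sp n K) (1 : F) * setSum F (apartment n K))]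
  refine Finset.sum_congr rfl fun u _ => ?_
  rw [single_mul_single_mul, ← inv_mul_cancel_right (h * u) h, ← single_mul_single_mul,
    torusH_mul_apartment hh]

/-- Factor U as V times the root subgroup, with V = U ∩ s⁻¹Us. Then s normalizes V and fixes the sum
of the x_t e: by the key relation it permutes the terms up to an error of (q - 1)e, which is 0. -/
theorem IsSimpleReflection.mul_uSum [Finite K] [CharP F 2] (h2 : (2 : K) ≠ 0)
    {s : Sp n K} {a b : Fin n ⊕ Fin n}
    (hs : IsSimpleReflection s a b) :
    MonoidAlgebra.single s (1 : F) * uSum F (setSum F (apartment n K)) =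
      uSum F (setSum F (apartment n K)) := by
  classical
  let : Fintype K := Fintype.ofFinite K
  let V : Subgroup (Sp n K) := upperUni n K ⊓ (upperUni n K).comap (MulAut.conj s).toMonoidHom
  have hV : ∀ v, v ∈ V ↔ v ∈ upperUni n K ∧ s * v * s⁻¹ ∈ upperUni n K := fun v => Iff.rfl
  let : Fintype V := Fintype.ofFinite V
  set e := setSum F (apartment n K) with he
  let R : K → Sp n K := fun t => rootElt (bas a) (bas b.swap) t
  let f : V × K → upperUni n K := fun x =>
    ⟨x.1 * R x.2, mul_mem ((hV _).1 x.1.2).1 (hs.root_mem x.2)⟩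
  have hf : Function.Bijective f := by
    constructor
    · rintro ⟨v, t⟩ ⟨v', t'⟩ h
      have h1 : (v : Sp n K) * R t = v' * R t' := congrArg Subtype.val h
      have h3 : ((v'⁻¹ * v : V) : Sp n K) = R (t' - t) := by
        rw [sub_eq_add_neg]
        simp only [R]
        rw [rootElt_add hs.form_eq_zero, rootElt_neg hs.form_eq_zero, Subgroup.coe_mul,
          Subgroup.coe_inv, eq_mul_inv_iff_mul_eq, mul_assoc]
        exact inv_mul_eq_iff_eq_mul.2 h1
      have h4 := ((hV _).1 (v'⁻¹ * v).2).2
      rw [h3] at h4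
      have h5 : t' - t = 0 := hs.conj_root_notMem h2 h4
      have h6 : t' = t := sub_eq_zero.1 h5
      subst h6
      have h7 : v = v' := Subtype.ext (mul_right_cancel h1)
      rw [h7]
    · rintro ⟨u, hu⟩
      obtain ⟨t, v, hv, hv', rfl⟩ := hs.exists_root h2 hu
      exact ⟨(⟨v, hv, hv'⟩, t), rfl⟩
  let X : F[Sp n K] := ∑ t : K, MonoidAlgebra.single (R t) (1 : F) * e
  have hE : uSum F e = ∑ v : V, MonoidAlgebra.single (v : Sp n K) (1 : F) * X := by
    rw [uSum, ← hf.sum_comp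
      (fun v : upperUni n K => MonoidAlgebra.single (v : Sp n K) (1 : F) * e),
      Fintype.sum_prod_type]
    refine Finset.sum_congr rfl fun v _ => ?_
    rw [Finset.mul_sum]
    refine Finset.sum_congr rfl fun t _ => ?_
    rw [single_mul_single_mul]
  have hX : MonoidAlgebra.single s (1 : F) * X = X := by
    obtain ⟨κ, hκ, hrel⟩ := hs.exists_mul_root_mul (F := F) h2
    -- The convention 0⁻¹ = 0 includes t = 0 in the same formula, because s fixes e; it also makes t
    -- ↦ κt⁻¹ a permutation of K.
    have hterm : ∀ t : K, MonoidAlgebra.single s (1 : F) * (MonoidAlgebra.single (R t) (1 : F) * e) =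
        MonoidAlgebra.single (R (κ * t⁻¹)) (1 : F) * e + if t = 0 then 0 else e := by
      intro t
      split_ifs with ht
      · subst ht
        simp only [R]
        rw [inv_zero, mul_zero, rootElt_zero hs.form_eq_zero, single_one_mul, add_zero,
          groupW₂_mul_apartment hs.mem]
      · rw [add_comm]
        exact hrel t ht
    have hbij : Function.Bijective fun t : K => κ * t⁻¹ := by
      refine Finite.injective_iff_bijective.1 fun t t' h => ?_
      exact inv_injective (mul_left_cancel₀ hκ h)
    have hodd : ∑ t : K, (if t = 0 then 0 else e) = 0 := by
      rw [sum_even (fun x h => eq_zero_of_neg_eq h2 x h) (add_self_eq_zero_of_module F)]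
      · rw [if_pos rfl]
      · intro t
        simp
    change MonoidAlgebra.single s (1 : F) * ∑ t : K, MonoidAlgebra.single (R t) (1 : F) * e = X
    rw [Finset.mul_sum, Finset.sum_congr rfl fun t _ => hterm t, Finset.sum_add_distrib, hodd,
      add_zero]
    exact hbij.sum_comp fun t => MonoidAlgebra.single (R t) (1 : F) * e
  -- Conjugating twice by s is conjugation by s², which lies in H and so preserves U.
  let φ : V → V := fun v => ⟨s * v * s⁻¹, by
    refine (hV _).2 ⟨((hV _).1 v.2).2, ?_⟩
    have := conj_torusH_mem_upperUni hs.sq ((hV _).1 v.2).1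
    convert! this using 1
    group⟩
  have hφ : Function.Bijective φ := by
    refine Finite.injective_iff_bijective.1 fun u v huv => Subtype.ext ?_
    have := congrArg Subtype.val huv
    simpa [φ] using this
  rw [hE, Finset.mul_sum, ← hφ.sum_comp
    (fun v : V => MonoidAlgebra.single (v : Sp n K) (1 : F) * X)]
  refine Finset.sum_congr rfl fun v _ => ?_
  rw [single_mul_single_mul, ← inv_mul_cancel_right (s * v) s, ← single_mul_single_mul, hX]

theorem single_mul_uSum_apartment [Finite K] [CharP F 2] (h2 : (2 : K) ≠ 0) (g : Sp n K) :
    MonoidAlgebra.single g (1 : F) * uSum F (setSum F (apartment n K)) =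
      uSum F (setSum F (apartment n K)) := by
  let D : Subgroup (Sp n K) :=
    { carrier := {g | MonoidAlgebra.single g (1 : F) * uSum F (setSum F (apartment n K)) =
        uSum F (setSum F (apartment n K))}
      one_mem' := single_one_mul _
      mul_mem' := by
        intro a b ha hb
        rw [Set.mem_ofPred_eq] at *
        rw [← single_mul_single_mul, hb, ha]
      inv_mem' := by
        intro a ha
        rw [Set.mem_ofPred_eq] at *
        nth_rewrite 1 [← ha]
        rw [single_mul_single_mul, inv_mul_cancel, single_one_mul] }
  have hD : D = ⊤ := eq_top_of_isSimpleReflection h2 D (fun g hg => single_mul_uSum hg _)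
    (fun g hg => torusH_mul_uSum hg) fun s a b hs => hs.mul_uSum h2
  have : g ∈ D := by
    rw [hD]
    trivial
  exact this

theorem coeff_uSum (x : F[Sp n K]) (g : Sp n K) :
    (uSum F x).coeff g = ∑ u : upperUni n K, x.coeff ((u : Sp n K)⁻¹ * g) := by
  rw [uSum, MonoidAlgebra.coeff_sum, Finsupp.finsetSum_apply]
  exact Finset.sum_congr rfl fun u _ => coeff_single_one_mul_apply _ _ _

/-- Invariance makes all coefficients equal, and the coefficient at 1 is |U| = 1 because U lies in
the apartment. -/
theorem uSum_apartment [Finite K] [CharP F 2] (h2 : (2 : K) ≠ 0) :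
    uSum F (setSum F (apartment n K)) = setSum F Set.univ := by
  have h1 : (uSum F (setSum F (apartment n K))).coeff 1 = 1 := by
    rw [coeff_uSum, Finset.sum_congr rfl fun u _ => coeff_setSum_of_mem (borelB_le_apartment (by
      rw [mul_one]
      exact upperUni_le_borelB (inv_mem u.2)))]
    rw [Finset.sum_const, Finset.card_univ, nsmul_eq_mul, mul_one]
    exact card_eq_one_of_le_upperUni h2 F _ le_rfl
  ext g
  have h3 := congrArg (fun x => x.coeff g) (single_mul_uSum_apartment (F := F) h2 g)
  simp only [coeff_single_one_mul_apply, inv_mul_cancel] at h3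
  rw [← h3, h1, coeff_setSum_of_mem (Set.mem_univ g)]

/-- Existence of the Bruhat decomposition. -/
theorem exists_mul_mem_apartment [Finite K] (h2 : (2 : K) ≠ 0) (g : Sp n K) :
    ∃ u ∈ upperUni n K, u * g ∈ apartment n K := by
  by_contra! h
  -- Over the field with two elements the coefficient of ∑_u ue at g is 1, so some translate of the
  -- apartment must contain g.
  have h1 := congrArg (fun x => x.coeff g) (uSum_apartment (F := ZMod 2) (n := n) h2)
  simp only [coeff_uSum, coeff_setSum_of_mem (Set.mem_univ g)] at h1
  rw [Finset.sum_eq_zero fun u _ => coeff_setSum_of_notMem (h _ (inv_mem u.2))] at h1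
  exact zero_ne_one h1

theorem uSum_mem_span [Finite K] [CharP F 2] (h2 : (2 : K) ≠ 0)
    {x : F[Sp n K]} (hx : x ∈ uSpan n K F) :
    ∃ c : F, uSum F x = c • setSum F Set.univ := by
  refine Submodule.span_induction
    (p := fun x _ => ∃ c : F, uSum F x = c • setSum F (Set.univ : Set (Sp n K))) ?_ ?_ ?_ ?_ hx
  · rintro _ ⟨u, hu, rfl⟩
    exact ⟨1, by rw [uSum_single_mul hu, uSum_apartment h2, one_smul]⟩
  · exact ⟨0, by simp [uSum]⟩
  · rintro x y _ _ ⟨c, hc⟩ ⟨d, hd⟩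
    refine ⟨c + d, ?_⟩
    rw [add_smul, ← hc, ← hd]
    simp only [uSum, mul_add, Finset.sum_add_distrib]
  · rintro r x _ ⟨c, hc⟩
    refine ⟨r * c, ?_⟩
    rw [mul_smul, ← hc]
    simp only [uSum, mul_smul_comm, Finset.smul_sum]

theorem uSum_mem {J : Submodule F[Sp n K] F[Sp n K]} {x : F[Sp n K]}
    (hx : x ∈ J) : uSum F x ∈ J :=
  sum_mem fun u _ => J.smul_mem (MonoidAlgebra.single (u : Sp n K) (1 : F)) hx

end USum

/-! ### The socle of the Steinberg module. -/

section Socle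

variable {n : ℕ} {K : Type*} [Field K] [Finite K] {F : Type*} [Field F] [CharP F 2]

theorem coeff_mul_borelB {x : F[Sp n K]} (hx : x ∈ steinbergModule n K F) (g : Sp n K)
    {b : Sp n K} (hb : b ∈ borelB n K) : x.coeff (g * b) = x.coeff g := by
  rw [steinbergModule, Submodule.mem_span_singleton] at hx
  obtain ⟨a, rfl⟩ := hx
  have he : ∀ g : Sp n K, (setSum F (apartment n K)).coeff (g * b) =
      (setSum F (apartment n K)).coeff g := by
    intro g
    by_cases hg : g ∈ apartment n K
    · rw [coeff_setSum_of_mem hg, coeff_setSum_of_mem ((mem_apartment_mul hb).2 hg)]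
    · rw [coeff_setSum_of_notMem hg, coeff_setSum_of_notMem fun h => hg ((mem_apartment_mul hb).1 h)]
  rw [smul_eq_mul, steinbergElement_eq]
  induction a using MonoidAlgebra.induction_linear with
  | zero => simp
  | add a b ha hb => rw [add_mul, MonoidAlgebra.coeff_add, Finsupp.add_apply, Finsupp.add_apply, ha, hb]
  | single h r =>
    rw [MonoidAlgebra.coeff_single_mul_apply, MonoidAlgebra.coeff_single_mul_apply, ← mul_assoc, he]

/-- Every nonzero submodule of the Steinberg module contains the sum of all group elements. -/
theorem setSum_univ_mem (h2 : (2 : K) ≠ 0) {J : Submodule F[Sp n K] F[Sp n K]}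
    (hJ : J ≤ steinbergModule n K F) {x : F[Sp n K]} (hx : x ∈ J) (hx0 : x ≠ 0) :
    setSum F Set.univ ∈ J := by
  let : Fintype (upperUni n K) := Fintype.ofFinite _
  obtain ⟨g, hg⟩ : ∃ g, x.coeff g ≠ 0 := by
    by_contra! h
    exact hx0 (MonoidAlgebra.ext (Finsupp.ext h))
  -- The translation moves a nonzero coefficient of x to 1. Coefficients are constant on cosets of
  -- B, so summing over U multiplies the coefficient at 1 by |U| = 1 and keeps it nonzero.
  let y := MonoidAlgebra.single g⁻¹ (1 : F) * x
  have hy : y ∈ J := J.smul_mem (MonoidAlgebra.single g⁻¹ (1 : F)) hx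
  obtain ⟨c, hc⟩ := uSum_mem_span h2 (mem_uSpan_of_mem_steinbergModule h2 (hJ hy))
  have h1 : (uSum F y).coeff 1 = x.coeff g := by
    rw [coeff_uSum]
    have : ∀ u : upperUni n K, y.coeff ((u : Sp n K)⁻¹ * 1) = x.coeff g := by
      intro u
      rw [mul_one, ← one_mul (u : Sp n K)⁻¹,
        coeff_mul_borelB (hJ hy) 1 (upperUni_le_borelB (inv_mem u.2)), coeff_single_one_mul_apply,
        inv_inv, mul_one]
    rw [Finset.sum_congr rfl fun u _ => this u, Finset.sum_const, Finset.card_univ, nsmul_eq_mul,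
      card_eq_one_of_le_upperUni h2 F _ le_rfl, one_mul]
  have hc0 : c ≠ 0 := by
    rintro rfl
    rw [hc, zero_smul] at h1
    exact hg (by simpa using h1.symm)
  have h3 : setSum F Set.univ = c⁻¹ • uSum F y := by
    rw [hc, smul_smul, inv_mul_cancel₀ hc0, one_smul]
  rw [h3]
  exact Submodule.smul_of_tower_mem J _ (uSum_mem hy)

theorem steinbergElement_ne_zero : steinbergElement n K F ≠ 0 := by
  intro h
  have h1 := congrArg (fun x => x.coeff 1) h
  rw [steinbergElement_eq] at h1
  simp only [coeff_setSum_of_mem (borelB_le_apartment (one_mem (borelB n K)))] at h1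
  simp at h1

theorem setSum_univ_mem_steinbergModule (h2 : (2 : K) ≠ 0) :
    setSum F Set.univ ∈ steinbergModule n K F :=
  setSum_univ_mem h2 le_rfl (Submodule.mem_span_singleton_self _) steinbergElement_ne_zero

/-- The socle of the Steinberg module is spanned by the sum of all group elements. -/
theorem mem_steinbergSocle_iff (h2 : (2 : K) ≠ 0) (x : steinbergModule n K F) :
    x ∈ steinbergSocle n K F ↔ ∃ c : F, (x : F[Sp n K]) = c • setSum F Set.univ := by
  have hz := setSum_univ_ne_zero (n := n) (K := K) (F := F)
  let z : steinbergModule n K F := ⟨setSum F Set.univ, setSum_univ_mem_steinbergModule h2⟩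
  -- As z lies in every nonzero submodule, the line through z is the only simple one.
  have hmin : ∀ N : Submodule F[Sp n K] (steinbergModule n K F), ∀ x ∈ N, x ≠ 0 → z ∈ N := by
    intro N x hx hx0
    have h1 := setSum_univ_mem h2 (J := N.map (steinbergModule n K F).subtype)
      (Submodule.map_subtype_le _ _) (Submodule.mem_map_of_mem hx) (by simpa using hx0)
    obtain ⟨y, hy, hyz⟩ := h1
    have : y = z := Subtype.ext hyz
    rwa [← this]
  have hspan : ∀ x : steinbergModule n K F, x ∈ Submodule.span F[Sp n K] {z} ↔
      ∃ c : F, (x : F[Sp n K]) = c • setSum F Set.univ := by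
    intro x
    rw [Submodule.mem_span_singleton]
    constructor
    · rintro ⟨a, rfl⟩
      change ∃ c : F, a * setSum F Set.univ = c • setSum F Set.univ
      induction a using MonoidAlgebra.induction_linear with
      | zero => exact ⟨0, by simp⟩
      | add a b ha hb =>
        obtain ⟨c, hc⟩ := ha
        obtain ⟨d, hd⟩ := hb
        exact ⟨c + d, by rw [add_mul, hc, hd, add_smul]⟩
      | single g r => exact ⟨r, single_smul_setSum_univ g r⟩
    · rintro ⟨c, hc⟩
      refine ⟨MonoidAlgebra.single 1 c, Subtype.ext ?_⟩
      rw [hc]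
      exact single_smul_setSum_univ 1 c
  rw [← hspan]
  have heq : steinbergSocle n K F = Submodule.span F[Sp n K] {z} := by
    refine le_antisymm (sSup_le ?_) (le_sSup ?_)
    · intro N hN
      have hN : IsSimpleModule F[Sp n K] N := hN
      rw [isSimpleModule_iff_isAtom] at hN
      obtain ⟨x, hx, hx0⟩ := (Submodule.ne_bot_iff N).1 hN.1
      have hzN : Submodule.span F[Sp n K] {z} ≤ N := by
        rw [Submodule.span_singleton_le_iff_mem]
        exact hmin N x hx hx0
      rcases hN.le_iff.1 hzN with h | h
      · rw [Submodule.span_singleton_eq_bot] at h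
        exact absurd (congrArg Subtype.val h) hz
      · exact h.ge
    · change IsSimpleModule F[Sp n K] _
      rw [isSimpleModule_iff_isAtom]
      refine ⟨?_, fun N hN => ?_⟩
      · rw [ne_eq, Submodule.span_singleton_eq_bot]
        exact fun h => hz (congrArg Subtype.val h)
      · by_contra h0
        obtain ⟨x, hx, hx0⟩ := (Submodule.ne_bot_iff N).1 h0
        refine hN.not_ge ?_
        rw [Submodule.span_singleton_le_iff_mem]
        exact hmin N x hx hx0
  rw [heq]

theorem finrank_steinbergSocle (h2 : (2 : K) ≠ 0) :
    Module.finrank F (steinbergSocle n K F) = 1 := by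
  have hz := setSum_univ_ne_zero (n := n) (K := K) (F := F)
  let z : steinbergSocle n K F := ⟨⟨setSum F Set.univ, setSum_univ_mem_steinbergModule h2⟩,
    (mem_steinbergSocle_iff h2 _).2 ⟨1, by rw [one_smul]⟩⟩
  have hval : ∀ c : F, (((c • z : steinbergSocle n K F) : steinbergModule n K F) : F[Sp n K]) =
      c • setSum F Set.univ := fun c => rfl
  have hbij : Function.Bijective (LinearMap.toSpanSingleton F (steinbergSocle n K F) z) := by
    constructor
    · intro c d h
      rw [LinearMap.toSpanSingleton_apply, LinearMap.toSpanSingleton_apply] at h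
      have h1 := congrArg (fun x : steinbergSocle n K F => ((x : steinbergModule n K F) : F[Sp n K])) h
      simp only [hval] at h1
      exact smul_left_injective F hz h1
    · rintro ⟨x, hx⟩
      obtain ⟨c, hc⟩ := (mem_steinbergSocle_iff h2 _).1 hx
      exact ⟨c, Subtype.ext (Subtype.ext hc.symm)⟩
  rw [← (LinearEquiv.ofBijective _ hbij).finrank_eq, Module.finrank_self]

theorem single_smul_of_mem_steinbergSocle (h2 : (2 : K) ≠ 0) (g : Sp n K)
    (x : steinbergModule n K F) (hx : x ∈ steinbergSocle n K F) :
    MonoidAlgebra.single g (1 : F) • x = x := by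
  obtain ⟨c, hc⟩ := (mem_steinbergSocle_iff h2 _).1 hx
  refine Subtype.ext ?_
  rw [Submodule.coe_smul, hc, smul_eq_mul, mul_smul_comm, single_smul_setSum_univ, one_smul]

end Socle

/-! ### Uniqueness of the Weil representation. -/

section Uniqueness

variable {n : ℕ} {K : Type*} [Field K] [Fintype K] {F : Type*} [Field F]

theorem transvection_inM_mem_fixM {n : ℕ} {K : Type*} [Field K] (a : Fin n → K) (t : K) :
    transvection (inM a) t ∈ fixM n K := by
  intro x
  rw [act_transvection, form_inM_inM, mul_zero, zero_smul, add_zero]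

/-- For k = n this expresses c_n by elements on which the Weil representation is prescribed. -/
theorem cSp_eq {n : ℕ} {K : Type*} [Field K] (k : Fin n) : (cSp k : Sp n K) =
    transvection (inM (Pi.single k 1)) (-1) * transvection (inN (Pi.single k 1)) (-1) *
      transvection (inM (Pi.single k 1)) (-1) := by
  refine ext_act fun x => ?_
  rw [inM_single, inN_single]
  change _ = act (transvection (bas (Sum.inl k)) (-1) * transvection (bas (Sum.inr k)) (-1) *
    transvection (bas (Sum.inl k)) (-1)) x
  simp only [act_mul, act_transvection, act_cSp, form_bas_left]
  ext i
  rcases i with i | i <;> by_cases h : i = k <;> simp [bas_apply, sgn, h]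

/-- The elements where P and Q agree form a subgroup. It contains the stabilizer of M, hence U, H
and the transpositions, and by `cSp_eq` also c_n. -/
theorem weilRepresentation_unique {ψ : AddChar K F}
    {P Q : Representation F (Sp n K) (WeilSpace n K F)} (hP : IsWeilRepresentation ψ P)
    (hQ : IsWeilRepresentation ψ Q) : P = Q := by
  let D : Subgroup (Sp n K) := MonoidHom.eqLocus P Q
  have hpar : ∀ s ∈ fixM n K, ∀ A : GL (Fin n) K, s * levi A ∈ D := fun s hs A =>
    weilSpace_hom_ext fun v => by
      rw [hP.parabolic s hs, hQ.parabolic s hs]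
  have hM : fixM n K ≤ D := fun s hs => by
    simpa using hpar s hs 1
  have hL : ∀ A, levi A ∈ D := fun A => by
    simpa using hpar 1 (one_mem _) A
  have hD : D = ⊤ := by
    refine eq_top_of_simple D ?_ ?_ ?_ ?_
    · rw [← sylowU_eq]
      refine sup_le ?_ hM
      rintro _ ⟨A, _, rfl⟩
      exact hL A
    · intro h hh
      obtain ⟨s, hs, A, rfl, -⟩ := exists_fixM_mul_levi (g := h) fun i j =>
        torusH_apply hh (by simp)
      exact hpar s hs A
    · intro i j _
      rw [swapSp_eq_levi]
      exact hL _
    · intro k hk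
      rw [cSp_eq]
      have ht := hM (transvection_inM_mem_fixM (Pi.single k (1 : K)) (-1))
      refine mul_mem (mul_mem ht ?_) ht
      exact weilSpace_hom_ext fun v => by
        rw [hP.transvection k hk, hQ.transvection k hk]
  refine MonoidHom.ext fun g => ?_
  have : g ∈ D := by
    rw [hD]
    trivial
  exact this

theorem IsWeilRepresentation.apply_eq [CharP F 2] {ψ : AddChar K F} (h2 : (2 : K) ≠ 0) (hψ : ψ ≠ 1)
    {P : Representation F (Sp n K) (WeilSpace n K F)} (hP : IsWeilRepresentation ψ P)
    (g : Sp n K) : P g = weilOp ψ g := by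
  rw [weilRepresentation_unique hP (isWeilRepresentation_weilRep h2 hψ)]
  rfl

end Uniqueness

/-! ### The subspace Y⁻ as the image of `1 - flip`. -/

section WeilMinus

theorem weilSpace_eq_sum {n : ℕ} {K : Type*} [Fintype K] {F : Type*} [Field F]
    (y : WeilSpace n K F) : y = ∑ v, y v • eps F v := by
  ext w
  classical
  rw [Finsupp.finsetSum_apply, Finset.sum_eq_single w]
  · simp [eps]
  · intro v _ hv
    simp [eps, hv]
  · simp

variable {n : ℕ} {K : Type*} [Field K] {F : Type*} [Field F]

theorem weilMinus_eq_range : weilMinus n K F = LinearMap.range (1 - flip n K F) := by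
  refine le_antisymm (Submodule.span_le.2 ?_) ?_
  · rintro _ ⟨v, rfl⟩
    exact ⟨eps F v, by simp [flip_eps]⟩
  · rintro _ ⟨y, rfl⟩
    induction y using Finsupp.induction_linear with
    | zero =>
      rw [map_zero]
      exact zero_mem _
    | add y z hy hz =>
      rw [map_add]
      exact add_mem hy hz
    | single v c =>
      have h : (Finsupp.single v c : WeilSpace n K F) = c • eps F v := by simp [eps]
      rw [h, map_smul]
      refine Submodule.smul_mem _ _ (Submodule.subset_span ⟨v, ?_⟩)
      simp [flip_eps]

theorem apply_zero_of_mem_weilMinus {y : WeilSpace n K F} (hy : y ∈ weilMinus n K F) : y 0 = 0 := by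
  rw [weilMinus_eq_range] at hy
  obtain ⟨y, rfl⟩ := hy
  simp [flip_apply]

variable [CharP F 2]

theorem flip_of_mem_weilMinus {y : WeilSpace n K F} (hy : y ∈ weilMinus n K F) :
    flip n K F y = y := by
  rw [weilMinus_eq_range] at hy
  obtain ⟨y, rfl⟩ := hy
  ext v
  simp only [flip_apply, LinearMap.sub_apply, Finsupp.sub_apply, Module.End.one_apply, neg_neg]
  rw [CharTwo.sub_eq_add, CharTwo.sub_eq_add, add_comm]

variable [Fintype K]

/-- A linear map that is invariant under `ε_v ↦ ε_{-v}` is determined on invariant vectors by its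
value on `ε_0`. -/
theorem map_eq_of_flip_eq (h2 : (2 : K) ≠ 0) {A : Type*} [AddCommGroup A] [Module F A]
    (f : WeilSpace n K F →ₗ[F] A) (hf : ∀ v, f (eps F (-v)) = f (eps F v)) {y : WeilSpace n K F}
    (hy : flip n K F y = y) : f y = y 0 • f (eps F 0) := by
  conv_lhs => rw [weilSpace_eq_sum y, map_sum]
  rw [Finset.sum_congr rfl fun v _ => map_smul f (y v) (eps F v), sum_pi_even (F := F) h2]
  intro v
  rw [hf, ← flip_apply, hy]

/-- The projection modulo the right side is invariant under `flip` and kills ε_0, so by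
`map_eq_of_flip_eq` it kills every fixed vector. In characteristic 2, Y⁻ itself consists of fixed
vectors. -/
theorem ker_one_sub_flip (h2 : (2 : K) ≠ 0) :
    LinearMap.ker (1 - flip n K F) = weilMinus n K F ⊔ Submodule.span F {eps F 0} := by
  refine le_antisymm ?_ (sup_le ?_ ?_)
  · intro y hy
    have hy' : flip n K F y = y := (sub_eq_zero.1 hy).symm
    set N := weilMinus n K F ⊔ Submodule.span F {eps F (0 : Fin n → K)} with hN
    have h1 := map_eq_of_flip_eq h2 N.mkQ (fun v => by
      rw [Submodule.mkQ_apply, Submodule.mkQ_apply, Submodule.Quotient.eq]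
      refine Submodule.mem_sup_left (Submodule.subset_span ⟨-v, ?_⟩)
      simp) hy'
    have h3 : N.mkQ (eps F 0) = 0 := by
      rw [Submodule.mkQ_apply, Submodule.Quotient.mk_eq_zero]
      exact Submodule.mem_sup_right (Submodule.mem_span_singleton_self _)
    rwa [h3, smul_zero, Submodule.mkQ_apply, Submodule.Quotient.mk_eq_zero] at h1
  · intro y hy
    rw [LinearMap.mem_ker, LinearMap.sub_apply, flip_of_mem_weilMinus hy]
    simp
  · rw [Submodule.span_singleton_le_iff_mem, LinearMap.mem_ker, LinearMap.sub_apply, flip_eps]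
    simp

/-- The kernel of `1 - flip` is its image Y⁻ plus the line of ε_0, so rank-nullity gives 2 dim Y⁻ +
1 = q^n. -/
theorem finrank_weilMinus (h2 : (2 : K) ≠ 0) :
    Module.finrank F (weilMinus n K F) = (Fintype.card K ^ n - 1) / 2 := by
  have h1 := LinearMap.finrank_range_add_finrank_ker (1 - flip n K F)
  rw [← weilMinus_eq_range, ker_one_sub_flip h2] at h1
  have h3 := Submodule.finrank_sup_add_finrank_inf_eq (weilMinus n K F)
    (Submodule.span F {eps F (0 : Fin n → K)})
  have h4 : weilMinus n K F ⊓ Submodule.span F {eps F (0 : Fin n → K)} = ⊥ := by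
    rw [eq_bot_iff]
    rintro y ⟨hy, hy'⟩
    obtain ⟨c, rfl⟩ := Submodule.mem_span_singleton.1 hy'
    have := apply_zero_of_mem_weilMinus hy
    simp only [eps, Finsupp.smul_apply, Finsupp.single_eq_same, smul_eq_mul, mul_one] at this
    rw [this, zero_smul]
    exact zero_mem _
  have h5 : eps F (0 : Fin n → K) ≠ 0 := by simp [eps]
  rw [h4, finrank_bot, finrank_span_singleton h5, add_zero] at h3
  have h6 : Module.finrank F (WeilSpace n K F) = Fintype.card K ^ n := by
    change Module.finrank F ((Fin n → K) →₀ F) = _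
    rw [Module.finrank_finsupp_self, Fintype.card_fun, Fintype.card_fin]
  rw [h3, h6] at h1
  omega

end WeilMinus

/-! ### Characters of Sp^M and irreducibility of Y⁻. -/

section Characters

variable {n : ℕ} {K : Type*} [Field K] {F : Type*} [Field F]

theorem addChar_eq_of_forall {ψ : AddChar K F} (hψ : ψ ≠ 1) {x y : K}
    (h : ∀ t, ψ (t * x) = ψ (t * y)) : x = y := by
  by_contra hxy
  refine hψ (DFunLike.ext _ _ fun t => ?_)
  have h1 := h (t / (x - y))
  have h3 : t = t / (x - y) * x - t / (x - y) * y := by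
    rw [← mul_sub, div_mul_cancel₀ _ (sub_ne_zero.2 hxy)]
  rw [h3, sub_eq_add_neg, AddChar.map_add_eq_mul, h1, ← AddChar.map_add_eq_mul, add_neg_cancel,
    AddChar.map_zero_eq_one, AddChar.one_apply]

theorem addChar_ne_zero (ψ : AddChar K F) (x : K) : ψ x ≠ 0 := by
  intro h
  have h1 : ψ (x + -x) = 1 := by rw [add_neg_cancel, AddChar.map_zero_eq_one]
  rw [AddChar.map_add_eq_mul, h, zero_mul] at h1
  exact zero_ne_one h1

theorem chi_transvection (ψ : AddChar K F) (a v : Fin n → K) (t : K) :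
    chi ψ (inN v) (transvection (inM a) t) = ψ (t * (∑ i, a i * v i) ^ 2) := by
  rw [chi, act_transvection, form_add_left, form_self, form_smul_left, form_inM_inN, zero_add]
  congr 1
  ring

/-- A vector space is not the union of two proper hyperplanes. -/
theorem exists_dot_ne_zero {v w : Fin n → K} (hv : v ≠ 0) (hw : w ≠ 0) :
    ∃ a : Fin n → K, ∑ i, a i * v i ≠ 0 ∧ ∑ i, a i * w i ≠ 0 := by
  obtain ⟨a, ha⟩ := exists_dot_eq hv 1
  obtain ⟨b, hb⟩ := exists_dot_eq hw 1
  by_cases h1 : ∑ i, a i * w i = 0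
  · by_cases h3 : ∑ i, b i * v i = 0
    · refine ⟨a + b, ?_, ?_⟩ <;> simp only [Pi.add_apply, add_mul, Finset.sum_add_distrib]
      · rw [ha, h3, add_zero]
        exact one_ne_zero
      · rw [h1, hb, zero_add]
        exact one_ne_zero
    · exact ⟨b, h3, by rw [hb]; exact one_ne_zero⟩
  · exact ⟨a, by rw [ha]; exact one_ne_zero, h1⟩

/-- Choose a in M nonzero on both v - w and v + w. Then (a·v)² ≠ (a·w)², and transvections along a
tell the two characters apart. -/
theorem exists_chi_ne {ψ : AddChar K F} (hψ : ψ ≠ 1) {v w : Fin n → K} (h : v ≠ w) (h' : v ≠ -w) :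
    ∃ s ∈ fixM n K, chi ψ (inN v) s ≠ chi ψ (inN w) s := by
  by_contra! hall
  obtain ⟨a, ha, ha'⟩ := exists_dot_ne_zero (sub_ne_zero.2 h) (sub_ne_zero.2 h')
  have h1 := addChar_eq_of_forall hψ (x := (∑ i, a i * v i) ^ 2) (y := (∑ i, a i * w i) ^ 2)
    fun t => by
      rw [← chi_transvection, ← chi_transvection]
      exact hall _ (transvection_inM_mem_fixM a t)
  simp only [Pi.sub_apply, Pi.neg_apply, mul_sub, Finset.sum_sub_distrib, mul_neg,
    Finset.sum_neg_distrib] at ha ha'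
  rw [sq_eq_sq_iff_eq_or_eq_neg] at h1
  rcases h1 with h1 | h1
  · exact ha (sub_eq_zero.2 h1)
  · exact ha' (sub_eq_zero.2 h1)

/-- `GL_n` is transitive on nonzero vectors of `N`. -/
theorem exists_leviN_eq {v w : Fin n → K} (hv : v ≠ 0) (hw : w ≠ 0) :
    ∃ A : GL (Fin n) K, leviN A v = w := by
  obtain ⟨a, ha, ha'⟩ := exists_dot_ne_zero hv hw
  set α := ∑ i, a i * v i with hα
  set β := ∑ i, a i * w i with hβ
  have hav : a ⬝ᵥ v = α := rfl
  have haw : a ⬝ᵥ w = β := rfl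
  -- The map sending m to m + (a·m)(a·x)⁻¹(y - x) takes x to y; exchanging x and y gives its
  -- inverse.
  have key : ∀ (x y : Fin n → K) (c d : K), a ⬝ᵥ x = c → a ⬝ᵥ y = d → c ≠ 0 → d ≠ 0 →
      (1 + Matrix.vecMulVec (c⁻¹ • (y - x)) a) * (1 + Matrix.vecMulVec (d⁻¹ • (x - y)) a) = 1 := by
    intro x y c d hx hy hc hd
    refine Matrix.ext_of_mulVec_single fun i => ?_
    rw [← Matrix.mulVec_mulVec]
    simp only [Matrix.add_mulVec, Matrix.one_mulVec, Matrix.vecMulVec_mulVec, Matrix.mulVec_add,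
      dotProduct_sub, hx, hy, op_smul_eq_smul, Matrix.mulVec_smul]
    ext j
    simp only [Pi.add_apply, Pi.smul_apply, Pi.sub_apply, smul_eq_mul]
    field_simp
    ring
  let X : GL (Fin n) K := ⟨_, _, key v w α β hav haw ha ha', key w v β α haw hav ha' ha⟩
  let A : GL (Fin n) K := ⟨((X⁻¹ : GL (Fin n) K) : Matrix (Fin n) (Fin n) K)ᵀ,
    (X : Matrix (Fin n) (Fin n) K)ᵀ, by
      rw [← Matrix.transpose_mul, ← Units.val_mul, mul_inv_cancel]
      simp, by
      rw [← Matrix.transpose_mul, ← Units.val_mul, inv_mul_cancel]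
      simp⟩
  refine ⟨A, ?_⟩
  have hA : ((A⁻¹ : GL (Fin n) K) : Matrix (Fin n) (Fin n) K)ᵀ =
      1 + Matrix.vecMulVec (α⁻¹ • (w - v)) a := Matrix.transpose_transpose _
  rw [leviN, hA, Matrix.add_mulVec, Matrix.one_mulVec, Matrix.vecMulVec_mulVec, hav]
  ext j
  simp only [Pi.add_apply, Pi.smul_apply, Pi.sub_apply, smul_eq_mul, op_smul_eq_smul]
  field_simp
  ring

variable [Fintype K] [CharP F 2]

theorem weilOp_fixM_apply (h2 : (2 : K) ≠ 0) {ψ : AddChar K F} (hψ : ψ ≠ 1) {s : Sp n K}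
    (hs : s ∈ fixM n K) (y : WeilSpace n K F) (w : Fin n → K) :
    weilOp ψ s y w = chi ψ (inN w) s * y w := by
  induction y using Finsupp.induction_linear with
  | zero => simp
  | add y z hy hz => rw [map_add, Finsupp.add_apply, hy, hz, Finsupp.add_apply, mul_add]
  | single v c =>
    have h : (Finsupp.single v c : WeilSpace n K F) = c • eps F v := by simp [eps]
    rw [h, map_smul, weilOp_fixM h2 hψ hs]
    by_cases hvw : v = w
    · subst hvw
      simp [eps]
      exact mul_comm _ _
    · simp [eps, hvw]

theorem chi_mul (h2 : (2 : K) ≠ 0) {ψ : AddChar K F} (hψ : ψ ≠ 1) {s t : Sp n K}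
    (hs : s ∈ fixM n K) (ht : t ∈ fixM n K) (v : Fin n → K) :
    chi ψ (inN v) (s * t) = chi ψ (inN v) s * chi ψ (inN v) t := by
  have h := weilOp_fixM_apply h2 hψ (mul_mem hs ht) (eps F v) v
  rw [weilOp_mul h2 hψ, Module.End.mul_apply, weilOp_fixM_apply h2 hψ hs,
    weilOp_fixM_apply h2 hψ ht] at h
  simpa [eps] using h.symm

/-- A subspace stable under the Weil operators that contains a nonzero vector of `Y⁻` contains
`Y⁻`. -/
theorem weilMinus_le_of_stable (h2 : (2 : K) ≠ 0) {ψ : AddChar K F} (hψ : ψ ≠ 1)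
    (W : Submodule F (WeilSpace n K F)) (hW : ∀ g : Sp n K, ∀ y ∈ W, weilOp ψ g y ∈ W)
    {y : WeilSpace n K F} (hy : y ∈ W) (hy' : y ∈ weilMinus n K F) (hy0 : y ≠ 0) :
    weilMinus n K F ≤ W := by
  classical
  obtain ⟨v, hv⟩ : ∃ v, y v ≠ 0 := by
    by_contra! h
    exact hy0 (Finsupp.ext h)
  have hv0 : v ≠ 0 := by
    rintro rfl
    exact hv (apply_zero_of_mem_weilMinus hy')
  let : Fintype (fixM n K) := Fintype.ofFinite _
  have hne : ∀ s : fixM n K, chi ψ (inN v) (s : Sp n K) ≠ 0 := fun s => addChar_ne_zero ψ _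
  -- The projection of y to the χ_v-eigenspace of Sp^M; no division is needed because |Sp^M| = 1 in
  -- F. Only ε_v and ε_{-v} survive, since χ_w = χ_v forces w = ±v.
  let z := ∑ s : fixM n K, (chi ψ (inN v) (s : Sp n K))⁻¹ • weilOp ψ (s : Sp n K) y
  have hzW : z ∈ W := sum_mem fun s _ => Submodule.smul_mem _ _ (hW _ _ hy)
  have hz : z = y v • (eps F v - eps F (-v)) := by
    ext w
    have h1 : z w = (∑ s : fixM n K, (chi ψ (inN v) (s : Sp n K))⁻¹ *
        chi ψ (inN w) (s : Sp n K)) * y w := by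
      simp only [z, Finsupp.finsetSum_apply, Finset.sum_mul, Finsupp.smul_apply, smul_eq_mul]
      refine Finset.sum_congr rfl fun s _ => ?_
      rw [weilOp_fixM_apply h2 hψ s.2, mul_assoc]
    have hvv : v ≠ -v := fun h => hv0 (eq_zero_of_neg_eq h2 v h.symm)
    have hone : (∀ s : fixM n K, chi ψ (inN w) (s : Sp n K) = chi ψ (inN v) (s : Sp n K)) →
        z w = y w := by
      intro hc
      rw [h1, Finset.sum_congr rfl fun s _ => by rw [hc s, inv_mul_cancel₀ (hne s)],
        Finset.sum_const, Finset.card_univ, nsmul_eq_mul, mul_one,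
        card_eq_one_of_le_upperUni h2 F _ fixM_le_upperUni, one_mul]
    by_cases hw : w = v
    · subst hw
      rw [hone fun _ => rfl]
      simp [eps, hvv.symm]
    · by_cases hw' : w = -v
      · subst hw'
        rw [hone fun s => by
          rw [chi, chi, inN_neg, act_neg, form_neg_left, form_neg_right, neg_neg]]
        rw [← flip_apply, flip_of_mem_weilMinus hy']
        simp [eps, hvv, CharTwo.neg_eq]
      · obtain ⟨s, hs, hsne⟩ := exists_chi_ne hψ hw hw'
        rw [h1, sum_mul_hom_eq_zero (fun s : fixM n K => (chi ψ (inN v) (s : Sp n K))⁻¹ *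
          chi ψ (inN w) (s : Sp n K)) ?_ (g := ⟨s, hs⟩) ?_, zero_mul]
        · have e1 : eps F v w = 0 := by simp [eps, Ne.symm hw]
          have e2 : eps F (-v) w = 0 := by simp [eps, Ne.symm hw']
          rw [Finsupp.smul_apply, Finsupp.sub_apply, e1, e2, sub_zero, smul_zero]
        · intro a b
          rw [Subgroup.coe_mul, chi_mul h2 hψ a.2 b.2, chi_mul h2 hψ a.2 b.2]
          field_simp
        · intro h
          refine hsne ?_
          have := (inv_mul_eq_one₀ (hne ⟨s, hs⟩)).1 h
          exact this.symm
  have hfv : eps F v - eps F (-v) ∈ W := by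
    rw [hz] at hzW
    have := W.smul_mem (y v)⁻¹ hzW
    rwa [smul_smul, inv_mul_cancel₀ hv, one_smul] at this
  refine Submodule.span_le.2 ?_
  rintro _ ⟨w, rfl⟩
  by_cases hw : w = 0
  · subst hw
    simp
  · obtain ⟨A, rfl⟩ := exists_leviN_eq hv0 hw
    have h := hW (levi A) _ hfv
    rw [map_sub, weilOp_levi h2 hψ, weilOp_levi h2 hψ] at h
    convert! h using 3
    simp [leviN, Matrix.mulVec_neg]

end Characters

/-! ### Two auxiliary facts about vectors of M and the vector v_n. -/

section

variable {n : ℕ} {K : Type*} [Field K] {F : Type*} [Field F]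

theorem inN_zero : inN (0 : Fin n → K) = 0 := by
  ext i
  rcases i with i | i <;> simp [inN]

theorem heis_inM_apply_zero (ψ : AddChar K F) {x : Fin n ⊕ Fin n → K}
    (hx : x ∘ Sum.inr = 0) (y : WeilSpace n K F) : heis ψ x y 0 = y 0 := by
  induction y using Finsupp.induction_linear with
  | zero => simp
  | add y z hy hz => rw [map_add, Finsupp.add_apply, hy, hz, Finsupp.add_apply]
  | single v c =>
    have h : (Finsupp.single v c : WeilSpace n K F) = c • eps F v := by simp [eps]
    have hx' : ∀ i, x (Sum.inr i) = 0 := fun i => congrFun hx i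
    rw [h, map_smul, heis_eps, hx, add_zero]
    by_cases hv : v = 0
    · subst hv
      simp [hx']
    · simp [eps, hv]

theorem leviN_single_of_unitriangular {A : GL (Fin n) K} (hA : A ∈ unitriangular n K) {k : Fin n}
    (hk : (k : ℕ) + 1 = n) : leviN A (Pi.single k 1) = Pi.single k 1 := by
  have hA' := (unitriangular n K).inv_mem hA
  ext i
  rw [leviN, Matrix.mulVec_single_one, Matrix.col_apply, Matrix.transpose_apply]
  by_cases hi : i = k
  · subst hi
    rw [hA'.2, Pi.single_eq_same]
  · rw [Pi.single_eq_of_ne hi, hA'.1]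
    have := i.2
    rw [Fin.lt_def]
    have : (i : ℕ) ≠ k := fun h => hi (Fin.ext h)
    omega

end

/-! ### The matrix coefficient map into the group algebra. -/

section Embedding

variable {n : ℕ} {K : Type*} [Field K] [Fintype K] {F : Type*} [Field F]

/-- The map from the Weil space to the group algebra whose coefficients are the matrix coefficients
`g ↦ (P(g⁻¹) y)_0`. -/
def matrixCoeff (ψ : AddChar K F) : WeilSpace n K F →ₗ[F] F[Sp n K] where
  toFun y := MonoidAlgebra.ofCoeff (Finsupp.equivFunOnFinite.symm fun g => weilOp ψ g⁻¹ y 0)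
  map_add' y z := by
    ext g
    simp
  map_smul' c y := by
    ext g
    simp

theorem coeff_matrixCoeff (ψ : AddChar K F) (y : WeilSpace n K F) (g : Sp n K) :
    (matrixCoeff ψ y).coeff g = weilOp ψ g⁻¹ y 0 := by
  simp [matrixCoeff]

theorem matrixCoeff_flip (ψ : AddChar K F) (y : WeilSpace n K F) :
    matrixCoeff ψ (flip n K F y) = matrixCoeff ψ y := by
  ext g
  rw [coeff_matrixCoeff, coeff_matrixCoeff, ← Module.End.mul_apply, ← flip_mul_weilOp,
    Module.End.mul_apply, flip_apply, neg_zero]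

variable [CharP F 2]

theorem matrixCoeff_weilOp (h2 : (2 : K) ≠ 0) {ψ : AddChar K F} (hψ : ψ ≠ 1) (h : Sp n K)
    (y : WeilSpace n K F) :
    matrixCoeff ψ (weilOp ψ h y) = MonoidAlgebra.single h (1 : F) * matrixCoeff ψ y := by
  ext g
  rw [coeff_matrixCoeff, coeff_single_one_mul_apply, coeff_matrixCoeff, ← Module.End.mul_apply,
    ← weilOp_mul h2 hψ, mul_inv_rev, inv_inv]

theorem matrixCoeff_eps_zero (h2 : (2 : K) ≠ 0) (ψ : AddChar K F) :
    matrixCoeff ψ (eps F (0 : Fin n → K)) = setSum F Set.univ := by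
  ext g
  rw [coeff_matrixCoeff, coeff_setSum_of_mem (Set.mem_univ g)]
  exact coeffZero_weilOp h2 ψ g⁻¹

/-- Levi elements permute the basis vectors and fix ε_0, while Sp^M acts on coordinate 0 by χ_0 = 1.
This makes matrix coefficients constant on cosets gB, as for elements of I. -/
theorem weilOp_borelB_apply_zero (h2 : (2 : K) ≠ 0) {ψ : AddChar K F} (hψ : ψ ≠ 1) {b : Sp n K}
    (hb : b ∈ borelB n K) (y : WeilSpace n K F) : weilOp ψ b y 0 = y 0 := by
  obtain ⟨s, hs, A, rfl, -⟩ := exists_fixM_mul_levi (g := b) fun i j =>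
    borelB_le_upperTri hb _ _ (by
      rw [rk_inl, rk_inr]
      omega)
  have hA : weilOp ψ (levi A) y 0 = y 0 := by
    induction y using Finsupp.induction_linear with
    | zero => simp
    | add y z hy hz => rw [map_add, Finsupp.add_apply, hy, hz, Finsupp.add_apply]
    | single v c =>
      have h : (Finsupp.single v c : WeilSpace n K F) = c • eps F v := by simp [eps]
      rw [h, map_smul, weilOp_levi h2 hψ]
      by_cases hv : v = 0
      · subst hv
        simp [leviN]
      · have hv' : leviN A v ≠ 0 := by
          intro h0
          have h1 := act_levi_inN A v
          rw [h0, inN_zero, ← act_zero (levi A)] at h1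
          have h4 := congrArg (act (levi A)⁻¹) h1
          rw [act_inv_act, act_inv_act] at h4
          exact hv (funext fun i => congrFun h4 (Sum.inr i))
        simp [eps, hv, hv']
  rw [weilOp_mul h2 hψ, Module.End.mul_apply, weilOp_fixM_apply h2 hψ hs, hA, chi, inN_zero,
    form_zero_right, AddChar.map_zero_eq_one, one_mul]

/-- The unitriangular Levi part fixes v_n, the last row of a unitriangular matrix being that of the
identity, and Sp^M acts diagonally. -/
theorem weilOp_upperUni_eps (h2 : (2 : K) ≠ 0) {ψ : AddChar K F} (hψ : ψ ≠ 1) {k : Fin n}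
    (hk : (k : ℕ) + 1 = n) {u : Sp n K} (hu : u ∈ upperUni n K) :
    weilOp ψ u (eps F (Pi.single k 1)) =
      weilOp ψ u (eps F (Pi.single k 1)) (Pi.single k 1) • eps F (Pi.single k 1) := by
  obtain ⟨s, hs, A, rfl, hA⟩ := exists_fixM_mul_levi (g := u) fun i j => hu.1 _ _ (by
    rw [rk_inl, rk_inr]
    omega)
  have hA1 : A ∈ unitriangular n K := by
    refine ⟨fun i j hij => ?_, fun i => ?_⟩
    · rw [hA]
      refine hu.1 _ _ ?_
      rw [rk_inl, rk_inl]
      rw [Fin.lt_def] at hij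
      omega
    · rw [hA]
      exact hu.2 _
  rw [weilOp_mul h2 hψ, Module.End.mul_apply, weilOp_levi h2 hψ,
    leviN_single_of_unitriangular hA1 hk, weilOp_fixM h2 hψ hs]
  simp [eps]

end Embedding

/-! ### Stabilizers of chambers in U. -/

section Chambers

variable {n : ℕ} {K : Type*} [Field K]

/-- If uw = w'b, uniqueness in the Bruhat decomposition puts w' in wH, so u fixes the chamber wB. -/
theorem mul_mem_apartment_iff {u w : Sp n K} (hu : u ∈ upperUni n K) (hw : w ∈ groupW₂ n K) :
    u * w ∈ apartment n K ↔ w⁻¹ * u * w ∈ borelB n K := by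
  constructor
  · rintro ⟨w', hw', hb⟩
    have h := inv_mul_mem_torusH_of_bruhat hu (borelB_le_upperTri hb) (groupW₂_le_monomial hw)
      (groupW₂_le_monomial hw') (by group)
    have h1 := mul_mem (torusH_le_borelB h) hb
    convert! h1 using 1
    group
  · intro h
    exact ⟨w, hw, by rwa [← mul_assoc]⟩

/-- The stabilizer in `U` of the chamber `wB`. -/
def chamberStabilizer (w : Sp n K) : Subgroup (Sp n K) :=
  upperUni n K ⊓ (borelB n K).comap (MulAut.conj w⁻¹).toMonoidHom

theorem mem_chamberStabilizer_iff {w u : Sp n K} :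
    u ∈ chamberStabilizer w ↔ u ∈ upperUni n K ∧ w⁻¹ * u * w ∈ borelB n K := by
  simp [chamberStabilizer, Subgroup.mem_inf, Subgroup.mem_comap]

theorem coeff_setSum_apartment_mul [Finite K] {F : Type*} [Field F] {g b : Sp n K}
    (hb : b ∈ borelB n K) :
    (setSum F (apartment n K)).coeff (g * b) = (setSum F (apartment n K)).coeff g := by
  by_cases h : g ∈ apartment n K
  · rw [coeff_setSum_of_mem h, coeff_setSum_of_mem ((mem_apartment_mul hb).2 h)]
  · rw [coeff_setSum_of_notMem h,
      coeff_setSum_of_notMem (fun h' => h ((mem_apartment_mul hb).1 h'))]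

end Chambers

/-! ### The image of the matrix coefficient map lies in the Steinberg module. -/

section Embedding

variable {n : ℕ} {K : Type*} [Field K] [Fintype K] {F : Type*} [Field F] [CharP F 2]

/-- The matrix coefficient of `ε_{v_n}` at a Weyl group element sending `u_m` to a multiple of
`v_n`. -/
theorem weilOp_eps_apply_zero_of_act_eq (h2 : (2 : K) ≠ 0) (ψ : AddChar K F) {g : Sp n K}
    {k m : Fin n} {d : K} (h : act g (bas (Sum.inr k)) = d • bas (Sum.inl m)) :
    weilOp ψ g (eps F (Pi.single k 1)) 0 = 1 := by
  -- Writing ε_{v_k} = J(v_k)ε_0 and moving J past the Weil operator gives J(d u_m), which leaves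
  -- coordinate 0 unchanged; what remains is `coeffZero_weilOp`.
  have h1 : eps F (Pi.single k (1 : K)) = heis ψ (bas (Sum.inr k)) (eps F 0) := by
    rw [heis_eps]
    have e1 : (bas (Sum.inr k) : Fin n ⊕ Fin n → K) ∘ Sum.inr = Pi.single k 1 := by
      ext i
      simp [bas, Pi.single_apply]
    rw [e1]
    simp [bas_apply]
  rw [h1, ← Module.End.mul_apply, weilOp_mul_heis, Module.End.mul_apply, h, heis_inM_apply_zero]
  · exact coeffZero_weilOp h2 ψ g
  · ext i
    simp [bas_apply]

/-- The element of `U` acting on `ε_{v_n}` by a nontrivial scalar. -/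
theorem exists_mem_upperUni_smul_ne_one (h2 : (2 : K) ≠ 0) {ψ : AddChar K F} (hψ : ψ ≠ 1)
    {g : Sp n K} {k m : Fin n} {d : K} (hg : g ∈ monomial n K)
    (h : act g (bas (Sum.inr k)) = d • bas (Sum.inr m)) :
    ∃ x ∈ upperUni n K, g * x * g⁻¹ ∈ borelB n K ∧
      weilOp ψ x (eps F (Pi.single k 1)) (Pi.single k 1) ≠ 1 := by
  obtain ⟨t, ht⟩ : ∃ t, ψ t ≠ 1 := by
    by_contra! h
    exact hψ (DFunLike.ext _ _ h)
  -- The transvection along u_k acts on ε_{v_k} by ψ(t). Its conjugate by g is a transvection along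
  -- a multiple of u_m, again in Sp^M.
  have hx := transvection_inM_mem_fixM (Pi.single k (1 : K)) t
  refine ⟨_, fixM_le_upperUni hx, ?_, ?_⟩
  · obtain ⟨π, hπ⟩ := hg
    obtain ⟨d', hd'⟩ := hπ (Sum.inl k)
    have h3 : π (Sum.inl k) = Sum.inl m := eq_swap_of_act_bas (i := Sum.inr k) h hd'
    rw [h3] at hd'
    have h4 : d' • (bas (Sum.inl m) : Fin n ⊕ Fin n → K) = inM (d' • Pi.single m 1) := by
      ext i
      rcases i with i | i <;> simp [bas, inM, Pi.single_apply]
    rw [conj_transvection, inM_single]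
    change transvection (act g (bas (Sum.inl k))) t ∈ _
    rw [hd', h4]
    exact upperUni_le_borelB (fixM_le_upperUni (transvection_inM_mem_fixM _ _))
  · rw [weilOp_fixM_apply h2 hψ hx, chi_transvection]
    simpa [eps, Pi.single_apply] using ht

/-- The scalar by which an element of `U` acts on `ε_{v_n}`. -/
def weilScalar (ψ : AddChar K F) (k : Fin n) (u : Sp n K) : F :=
  weilOp ψ u (eps F (Pi.single k 1)) (Pi.single k 1)

theorem weilOp_eps_eq_weilScalar_smul (h2 : (2 : K) ≠ 0) {ψ : AddChar K F} (hψ : ψ ≠ 1) {k : Fin n}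
    (hk : (k : ℕ) + 1 = n) {u : Sp n K} (hu : u ∈ upperUni n K) :
    weilOp ψ u (eps F (Pi.single k 1)) = weilScalar ψ k u • eps F (Pi.single k 1) :=
  weilOp_upperUni_eps h2 hψ hk hu

theorem weilScalar_mul (h2 : (2 : K) ≠ 0) {ψ : AddChar K F} (hψ : ψ ≠ 1) {k : Fin n}
    (hk : (k : ℕ) + 1 = n) {u u' : Sp n K} (hu : u ∈ upperUni n K) (hu' : u' ∈ upperUni n K) :
    weilScalar ψ k (u * u') = weilScalar ψ k u * weilScalar ψ k u' := by
  have h1 : eps F (Pi.single k (1 : K)) (Pi.single k 1) = 1 := by simp [eps]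
  rw [weilScalar, weilOp_mul h2 hψ, Module.End.mul_apply,
    weilOp_eps_eq_weilScalar_smul h2 hψ hk hu', map_smul,
    weilOp_eps_eq_weilScalar_smul h2 hψ hk hu, smul_smul, Finsupp.smul_apply, h1, smul_eq_mul,
    mul_one, mul_comm]

/-- If u fixes wB, then w⁻¹u = bw⁻¹ with b in B; evaluate both sides on ε_{v_n} at coordinate 0,
where b has no effect. -/
theorem weilScalar_mul_apply_zero (h2 : (2 : K) ≠ 0) {ψ : AddChar K F} (hψ : ψ ≠ 1) {k : Fin n}
    (hk : (k : ℕ) + 1 = n) {w u : Sp n K} (hu : u ∈ chamberStabilizer w) :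
    weilScalar ψ k u * weilOp ψ w⁻¹ (eps F (Pi.single k 1)) 0 =
      weilOp ψ w⁻¹ (eps F (Pi.single k 1)) 0 := by
  obtain ⟨hu, hB⟩ := mem_chamberStabilizer_iff.1 hu
  have e : w⁻¹ * u = (w⁻¹ * u * w) * w⁻¹ := by group
  have h1 : weilOp ψ (w⁻¹ * u) (eps F (Pi.single k 1)) 0 =
      weilOp ψ ((w⁻¹ * u * w) * w⁻¹) (eps F (Pi.single k 1)) 0 := by rw [← e]
  rw [weilOp_mul h2 hψ w⁻¹ u, weilOp_mul h2 hψ _ w⁻¹, Module.End.mul_apply, Module.End.mul_apply,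
    weilOp_borelB_apply_zero h2 hψ hB, weilOp_eps_eq_weilScalar_smul h2 hψ hk hu, map_smul,
    Finsupp.smul_apply, smul_eq_mul] at h1
  exact h1

/-- If w⁻¹v_n lies in M, the coefficient is 1, which forces the character to be trivial on the
stabilizer, a group of order 1 in F. If it lies in N, the character is nontrivial there, so the sum
and the coefficient are both 0. -/
theorem sum_weilScalar_chamberStabilizer (h2 : (2 : K) ≠ 0) {ψ : AddChar K F} (hψ : ψ ≠ 1)
    {k : Fin n} (hk : (k : ℕ) + 1 = n) {w : Sp n K} (hw : w ∈ groupW₂ n K)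
    [Fintype (chamberStabilizer w)] :
    ∑ u : chamberStabilizer w, weilScalar ψ k (u : Sp n K) =
      weilOp ψ w⁻¹ (eps F (Pi.single k 1)) 0 := by
  have hfix := fun u : chamberStabilizer w => weilScalar_mul_apply_zero h2 hψ hk u.2
  have hwm := inv_mem (groupW₂_le_monomial hw)
  obtain ⟨π, hπ⟩ := id hwm
  obtain ⟨d, hd⟩ := hπ (Sum.inr k)
  rcases hm : π (Sum.inr k) with m | m <;> rw [hm] at hd
  · have hc := weilOp_eps_apply_zero_of_act_eq h2 ψ hd
    rw [hc] at hfix ⊢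
    have h1 : ∀ u : chamberStabilizer w, weilScalar ψ k (u : Sp n K) = 1 := fun u => by
      simpa using hfix u
    rw [Finset.sum_congr rfl fun u _ => h1 u, Finset.sum_const, Finset.card_univ, nsmul_eq_mul,
      mul_one, card_eq_one_of_le_upperUni h2 F (chamberStabilizer w) fun u hu => hu.1]
  · obtain ⟨x, hx, hxB, hx1⟩ := exists_mem_upperUni_smul_ne_one h2 hψ hwm hd
    rw [inv_inv] at hxB
    have hxQ : x ∈ chamberStabilizer w := mem_chamberStabilizer_iff.2 ⟨hx, hxB⟩
    have hc : weilOp ψ w⁻¹ (eps F (Pi.single k 1)) 0 = 0 := by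
      by_contra h0
      exact hx1 (mul_right_cancel₀ h0 ((hfix ⟨_, hxQ⟩).trans (one_mul _).symm))
    rw [hc, sum_mul_hom_eq_zero (fun u : chamberStabilizer w => weilScalar ψ k (u : Sp n K))
      (fun a b => weilScalar_mul h2 hψ hk a.2.1 b.2.1) (g := ⟨_, hxQ⟩) hx1]

theorem sum_weilScalar_mul_coeff (h2 : (2 : K) ≠ 0) {ψ : AddChar K F} (hψ : ψ ≠ 1)
    {k : Fin n} (hk : (k : ℕ) + 1 = n) [Fintype (upperUni n K)] {w : Sp n K}
    (hw : w ∈ groupW₂ n K) :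
    ∑ u : upperUni n K, weilScalar ψ k (u : Sp n K) *
        (setSum F (apartment n K)).coeff ((u : Sp n K) * w) =
      weilOp ψ w⁻¹ (eps F (Pi.single k 1)) 0 := by
  classical
  let : Fintype (chamberStabilizer w) := Fintype.ofFinite _
  rw [← sum_weilScalar_chamberStabilizer h2 hψ hk hw]
  refine (Finset.sum_of_injOn
    (fun u : chamberStabilizer w => (⟨u, u.2.1⟩ : upperUni n K)) ?_ ?_ ?_ ?_).symm
  · intro u _ u' _ h
    exact Subtype.ext (congrArg (fun z : upperUni n K => (z : Sp n K)) h)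
  · intro u _
    simp
  · intro u _ hu
    rw [coeff_setSum_of_notMem, mul_zero]
    intro h
    refine hu ⟨⟨u, mem_chamberStabilizer_iff.2 ⟨u.2, (mul_mem_apartment_iff u.2 hw).1 h⟩⟩, ?_, rfl⟩
    simp
  · intro u _
    have hu := mem_chamberStabilizer_iff.1 u.2
    rw [coeff_setSum_of_mem ((mul_mem_apartment_iff hu.1 hw).2 hu.2), mul_one]

/-- By Bruhat, g = u₀⁻¹wb. Both sides ignore b and scale by the value of the character at u₀, so it
suffices to compare them at w, which is `sum_weilScalar_mul_coeff`. -/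
theorem matrixCoeff_eps_last (h2 : (2 : K) ≠ 0) {ψ : AddChar K F} (hψ : ψ ≠ 1) {k : Fin n}
    (hk : (k : ℕ) + 1 = n) [Fintype (upperUni n K)] :
    matrixCoeff ψ (eps F (Pi.single k (1 : K))) = ∑ u : upperUni n K,
      weilScalar ψ k (u : Sp n K) •
        (MonoidAlgebra.single (u : Sp n K)⁻¹ (1 : F) * setSum F (apartment n K)) := by
  ext g
  have hR : (∑ u : upperUni n K, weilScalar ψ k (u : Sp n K) •
      (MonoidAlgebra.single (u : Sp n K)⁻¹ (1 : F) * setSum F (apartment n K))).coeff g =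
      ∑ u : upperUni n K, weilScalar ψ k (u : Sp n K) *
        (setSum F (apartment n K)).coeff ((u : Sp n K) * g) := by
    rw [MonoidAlgebra.coeff_sum, Finsupp.finsetSum_apply]
    refine Finset.sum_congr rfl fun u _ => ?_
    rw [MonoidAlgebra.coeff_smul, Finsupp.smul_apply, coeff_single_one_mul_apply, inv_inv,
      smul_eq_mul]
  rw [coeff_matrixCoeff, hR]
  obtain ⟨u₀, hu₀, w, hw, hb'⟩ := exists_mul_mem_apartment h2 g
  obtain ⟨b, hb, rfl⟩ : ∃ b ∈ borelB n K, g = u₀⁻¹ * (w * b) := ⟨_, hb', by group⟩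
  have e : (u₀⁻¹ * (w * b))⁻¹ = b⁻¹ * (w⁻¹ * u₀) := by group
  rw [e, weilOp_mul h2 hψ, weilOp_mul h2 hψ, Module.End.mul_apply,
    weilOp_borelB_apply_zero h2 hψ (inv_mem hb), Module.End.mul_apply,
    weilOp_eps_eq_weilScalar_smul h2 hψ hk hu₀, map_smul, Finsupp.smul_apply, smul_eq_mul,
    ← sum_weilScalar_mul_coeff h2 hψ hk hw, Finset.mul_sum]
  symm
  rw [← Equiv.sum_comp (Equiv.mulRight (⟨u₀, hu₀⟩ : upperUni n K))]
  refine Finset.sum_congr rfl fun u _ => ?_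
  have e1 : ((Equiv.mulRight (⟨u₀, hu₀⟩ : upperUni n K) u : upperUni n K) : Sp n K) = u * u₀ :=
    rfl
  have e2 : (u : Sp n K) * u₀ * (u₀⁻¹ * (w * b)) = u * w * b := by group
  rw [e1, e2, coeff_setSum_apartment_mul hb, weilScalar_mul h2 hψ hk u.2 hu₀,
    mul_left_comm, mul_assoc]

theorem matrixCoeff_mem_steinbergModule (h2 : (2 : K) ≠ 0) {ψ : AddChar K F} (hψ : ψ ≠ 1)
    (y : WeilSpace n K F) : matrixCoeff ψ y ∈ steinbergModule n K F := by
  have key : ∀ v : Fin n → K, matrixCoeff ψ (eps F v) ∈ steinbergModule n K F := by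
    intro v
    by_cases hv : v = 0
    · rw [hv, matrixCoeff_eps_zero h2]
      exact setSum_univ_mem_steinbergModule h2
    · have hn : 0 < n := by
        rcases Nat.eq_zero_or_pos n with rfl | h
        · exact absurd (Subsingleton.elim v 0) hv
        · exact h
      let k : Fin n := ⟨n - 1, by omega⟩
      have hk : (k : ℕ) + 1 = n := Nat.sub_add_cancel hn
      obtain ⟨A, rfl⟩ := exists_leviN_eq (v := Pi.single k (1 : K)) (w := v) (by simp) hv
      let : Fintype (upperUni n K) := Fintype.ofFinite _
      rw [← weilOp_levi h2 hψ, matrixCoeff_weilOp h2 hψ, matrixCoeff_eps_last h2 hψ hk,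
        ← steinbergElement_eq]
      refine (steinbergModule n K F).smul_mem _ (sum_mem fun u _ => ?_)
      rw [← smul_mul_assoc]
      exact (steinbergModule n K F).smul_mem _ (Submodule.mem_span_singleton_self _)
  rw [weilSpace_eq_sum y, map_sum]
  refine sum_mem fun v _ => ?_
  rw [map_smul, ← one_mul (matrixCoeff ψ (eps F v)), ← smul_mul_assoc]
  exact (steinbergModule n K F).smul_mem _ (key v)

/-- The function is not constant: its coefficient is 0 at the identity and 1 at c_k⁻¹. -/
theorem matrixCoeff_eps_ne (h2 : (2 : K) ≠ 0) (ψ : AddChar K F) (k : Fin n) (c : F) :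
    matrixCoeff ψ (eps F (Pi.single k (1 : K))) ≠ c • setSum F Set.univ := by
  intro h
  have h1 := congrArg (fun x => x.coeff 1) h
  have h3 := congrArg (fun x => x.coeff (cSp k)⁻¹) h
  simp only [coeff_matrixCoeff, MonoidAlgebra.coeff_smul, Finsupp.smul_apply,
    coeff_setSum_of_mem (Set.mem_univ _), inv_one, weilOp_one h2, inv_inv] at h1 h3
  rw [weilOp_eps_apply_zero_of_act_eq h2 ψ (act_cSp_bas k (Sum.inr k)|>.trans (by
    rw [Equiv.swap_apply_right])), ← h1] at h3
  simp [eps] at h3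

end Embedding

/-- Two linear maps with the same fibres, one of them surjective. -/
theorem nonempty_range_equiv {R A B C : Type*} [Semiring R] [AddCommMonoid A] [AddCommMonoid B]
    [AddCommMonoid C] [Module R A] [Module R B] [Module R C] (f : A →ₗ[R] C) (g : A →ₗ[R] B)
    (hg : Function.Surjective g) (h : ∀ x y, f x = f y ↔ g x = g y) :
    Nonempty (LinearMap.range f ≃ₗ[R] B) := by
  have hs := Function.surjInv_eq hg
  let φ : B →ₗ[R] C :=
    { toFun := fun b => f (Function.surjInv hg b)
      map_add' := fun a b => by rw [← map_add, h, map_add, hs, hs, hs]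
      map_smul' := fun c b => by rw [RingHom.id_apply, ← map_smul, h, map_smul, hs, hs] }
  have hφ : ∀ x, φ (g x) = f x := fun x => (h _ _).2 (hs _)
  have hinj : Function.Injective φ := by
    intro a b hab
    obtain ⟨x, rfl⟩ := hg a
    obtain ⟨y, rfl⟩ := hg b
    rwa [hφ, hφ, h] at hab
  let φ' : B →ₗ[R] LinearMap.range f := φ.codRestrict _ fun b => ⟨_, rfl⟩
  have hφ' : Function.Bijective φ' := by
    refine ⟨fun a b hab => hinj (congrArg Subtype.val hab), ?_⟩
    rintro ⟨_, x, rfl⟩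
    exact ⟨g x, Subtype.ext (hφ x)⟩
  exact ⟨(LinearEquiv.ofBijective φ' hφ').symm⟩

/-! ### Weil modules over the group algebra. -/

section WeilModule

variable {n : ℕ} {K : Type*} [Field K] [Fintype K] {F : Type*} [Field F]
  {ψ : AddChar K F} {P : Representation F (Sp n K) (WeilSpace n K F)}

theorem mem_weilModule_iff (hP : IsWeilRepresentation ψ P) {y : P.asModule} :
    y ∈ weilModule hP ↔ P.asModuleEquiv y ∈ weilMinus n K F := Iff.rfl

theorem one_sub_flip_weilOp (ψ : AddChar K F) (g : Sp n K) (y : WeilSpace n K F) :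
    (1 - flip n K F) (weilOp ψ g y) = weilOp ψ g ((1 - flip n K F) y) := by
  rw [LinearMap.sub_apply, LinearMap.sub_apply, map_sub, ← Module.End.mul_apply (flip n K F),
    flip_mul_weilOp]
  rfl

variable [CharP F 2]

theorem finrank_weilModule (h2 : (2 : K) ≠ 0) (hP : IsWeilRepresentation ψ P) :
    Module.finrank F (weilModule hP) = (Fintype.card K ^ n - 1) / 2 := by
  rw [← finrank_weilMinus (n := n) (F := F) h2]
  let e : (weilModule hP) ≃ₗ[F] weilMinus n K F :=
    { toFun := fun y => ⟨P.asModuleEquiv y, y.2⟩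
      invFun := fun y => ⟨P.asModuleEquiv.symm y, y.2⟩
      map_add' := fun _ _ => rfl
      map_smul' := fun _ _ => rfl
      left_inv := fun _ => rfl
      right_inv := fun _ => rfl }
  exact e.finrank_eq

theorem asModuleEquiv_single_smul (h2 : (2 : K) ≠ 0) (hψ : ψ ≠ 1) (hP : IsWeilRepresentation ψ P)
    (g : Sp n K) (y : P.asModule) :
    P.asModuleEquiv (MonoidAlgebra.single g (1 : F) • y) = weilOp ψ g (P.asModuleEquiv y) := by
  rw [Representation.asModuleEquiv_map_smul, Representation.asAlgebraHom_single, one_smul,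
    hP.apply_eq h2 hψ]

/-- A stable subspace of the Weil representation that is not fixed by `flip` projects onto the Weil
module. -/
theorem exists_one_sub_flip_eq (h2 : (2 : K) ≠ 0) (hψ : ψ ≠ 1) (W : Submodule F (WeilSpace n K F))
    (hW : ∀ g : Sp n K, ∀ y ∈ W, weilOp ψ g y ∈ W) {y : WeilSpace n K F} (hy : y ∈ W)
    (hy' : (1 - flip n K F) y ≠ 0) (z : WeilSpace n K F) :
    ∃ x ∈ W, (1 - flip n K F) x = (1 - flip n K F) z := by
  have h := weilMinus_le_of_stable h2 hψ (W.map (1 - flip n K F)) (fun g x hx => by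
    obtain ⟨x, hx, rfl⟩ := hx
    refine ⟨weilOp ψ g x, hW g x hx, ?_⟩
    rw [one_sub_flip_weilOp]) (y := (1 - flip n K F) y) ⟨y, hy, rfl⟩ (by
      rw [weilMinus_eq_range]
      exact ⟨y, rfl⟩) hy'
  rw [weilMinus_eq_range] at h
  exact h ⟨z, rfl⟩

end WeilModule

/-! ### The copy of a Weil module inside I/S. -/

section Embedding

variable {n : ℕ} {K : Type*} [Field K] [Fintype K] {F : Type*} [Field F] [CharP F 2]
  {ψ : AddChar K F} {P : Representation F (Sp n K) (WeilSpace n K F)}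

/-- The matrix coefficient map, from the Weil representation to the Steinberg module. -/
def toSteinberg (h2 : (2 : K) ≠ 0) (hψ : ψ ≠ 1) (hP : IsWeilRepresentation ψ P) :
    P.asModule →ₗ[F[Sp n K]] steinbergModule n K F :=
  MonoidAlgebra.equivariantOfLinearOfComm
    { toFun := fun y => ⟨matrixCoeff ψ (P.asModuleEquiv y),
        matrixCoeff_mem_steinbergModule h2 hψ _⟩
      map_add' := fun y z => Subtype.ext (by simp)
      map_smul' := fun c y => Subtype.ext (by simp) }
    fun g y => Subtype.ext (by
      simp only [LinearMap.coe_mk, AddHom.coe_mk, Submodule.coe_smul, smul_eq_mul]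
      rw [asModuleEquiv_single_smul h2 hψ hP, matrixCoeff_weilOp h2 hψ])

theorem coe_toSteinberg (h2 : (2 : K) ≠ 0) (hψ : ψ ≠ 1) (hP : IsWeilRepresentation ψ P)
    (y : P.asModule) :
    (toSteinberg h2 hψ hP y : F[Sp n K]) = matrixCoeff ψ (P.asModuleEquiv y) := rfl

/-- The projection `y ↦ y - flip y` of the Weil representation onto the Weil module. -/
def toWeilModule (h2 : (2 : K) ≠ 0) (hψ : ψ ≠ 1) (hP : IsWeilRepresentation ψ P) :
    P.asModule →ₗ[F[Sp n K]] weilModule hP :=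
  MonoidAlgebra.equivariantOfLinearOfComm
    { toFun := fun y => ⟨P.asModuleEquiv.symm ((1 - flip n K F) (P.asModuleEquiv y)), by
        rw [mem_weilModule_iff, LinearEquiv.apply_symm_apply, weilMinus_eq_range]
        exact ⟨_, rfl⟩⟩
      map_add' := fun y z => Subtype.ext
        ((1 - flip n K F).map_add (P.asModuleEquiv y) (P.asModuleEquiv z))
      map_smul' := fun c y => Subtype.ext ((1 - flip n K F).map_smul c (P.asModuleEquiv y)) }
    fun g y => Subtype.ext (P.asModuleEquiv.injective (by
      change (1 - flip n K F) (P.asModuleEquiv (MonoidAlgebra.single g (1 : F) • y)) =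
        P.asModuleEquiv (MonoidAlgebra.single g (1 : F) •
          P.asModuleEquiv.symm ((1 - flip n K F) (P.asModuleEquiv y)))
      rw [asModuleEquiv_single_smul h2 hψ hP, asModuleEquiv_single_smul h2 hψ hP,
        LinearEquiv.apply_symm_apply, one_sub_flip_weilOp]))

theorem coe_toWeilModule (h2 : (2 : K) ≠ 0) (hψ : ψ ≠ 1) (hP : IsWeilRepresentation ψ P)
    (y : P.asModule) : P.asModuleEquiv (toWeilModule h2 hψ hP y) =
      (1 - flip n K F) (P.asModuleEquiv y) := rfl

theorem toWeilModule_surjective (h2 : (2 : K) ≠ 0) (hψ : ψ ≠ 1) (hP : IsWeilRepresentation ψ P) :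
    Function.Surjective (toWeilModule h2 hψ hP) := by
  intro z
  have hz := (mem_weilModule_iff hP).1 z.2
  rw [weilMinus_eq_range] at hz
  obtain ⟨y, hy⟩ := hz
  exact ⟨P.asModuleEquiv.symm y, Subtype.ext hy⟩

/-- The matrix coefficient map, modulo the socle of the Steinberg module. -/
def toSteinbergQuotient (h2 : (2 : K) ≠ 0) (hψ : ψ ≠ 1) (hP : IsWeilRepresentation ψ P) :
    P.asModule →ₗ[F[Sp n K]] steinbergModule n K F ⧸ steinbergSocle n K F :=
  (steinbergSocle n K F).mkQ ∘ₗ toSteinberg h2 hψ hP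

theorem toSteinbergQuotient_eq_zero_iff (h2 : (2 : K) ≠ 0) (hψ : ψ ≠ 1)
    (hP : IsWeilRepresentation ψ P) (y : P.asModule) : toSteinbergQuotient h2 hψ hP y = 0 ↔
      ∃ c : F, matrixCoeff ψ (P.asModuleEquiv y) = c • setSum F Set.univ := by
  rw [← coe_toSteinberg h2 hψ hP, ← mem_steinbergSocle_iff h2, toSteinbergQuotient,
    LinearMap.comp_apply, Submodule.mkQ_apply, Submodule.Quotient.mk_eq_zero]

theorem toSteinbergQuotient_eps_ne_zero (h2 : (2 : K) ≠ 0) (hψ : ψ ≠ 1)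
    (hP : IsWeilRepresentation ψ P) (k : Fin n) :
    toSteinbergQuotient h2 hψ hP (P.asModuleEquiv.symm (eps F (Pi.single k 1))) ≠ 0 := by
  intro h
  obtain ⟨c, hc⟩ := (toSteinbergQuotient_eq_zero_iff h2 hψ hP _).1 h
  exact matrixCoeff_eps_ne h2 ψ k c hc

/-- Since `matrixCoeff` does not see `flip`, a fixed vector y has the same image as y(0)ε_0, namely
y(0)z, which lies in S. -/
theorem toSteinbergQuotient_eq_zero_of_flip (h2 : (2 : K) ≠ 0) (hψ : ψ ≠ 1)
    (hP : IsWeilRepresentation ψ P) {y : WeilSpace n K F} (hy : (1 - flip n K F) y = 0) :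
    toSteinbergQuotient h2 hψ hP (P.asModuleEquiv.symm y) = 0 := by
  have hy' : flip n K F y = y := (sub_eq_zero.1 hy).symm
  rw [toSteinbergQuotient_eq_zero_iff]
  refine ⟨y 0, ?_⟩
  rw [LinearEquiv.apply_symm_apply, map_eq_of_flip_eq h2 (matrixCoeff ψ) (fun v => by
    rw [← flip_eps, matrixCoeff_flip]) hy', matrixCoeff_eps_zero h2]

/-- The preimage in the Weil space of a submodule. -/
def weilPreimage (h2 : (2 : K) ≠ 0) (hψ : ψ ≠ 1) (hP : IsWeilRepresentation ψ P)
    (N : Submodule F[Sp n K] (steinbergModule n K F ⧸ steinbergSocle n K F)) :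
    Submodule F (WeilSpace n K F) where
  carrier := {y | toSteinbergQuotient h2 hψ hP (P.asModuleEquiv.symm y) ∈ N}
  zero_mem' := by
    rw [Set.mem_ofPred_eq, map_zero, map_zero]
    exact N.zero_mem
  add_mem' {y z} hy hz := by
    rw [Set.mem_ofPred_eq, map_add, map_add]
    exact N.add_mem hy hz
  smul_mem' c y hy := by
    rw [Set.mem_ofPred_eq, Representation.asModuleEquiv_symm_map_smul, map_smul]
    exact N.smul_mem _ hy

theorem weilOp_mem_weilPreimage (h2 : (2 : K) ≠ 0) (hψ : ψ ≠ 1) (hP : IsWeilRepresentation ψ P)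
    {N : Submodule F[Sp n K] (steinbergModule n K F ⧸ steinbergSocle n K F)} (g : Sp n K)
    {y : WeilSpace n K F} (hy : y ∈ weilPreimage h2 hψ hP N) :
    weilOp ψ g y ∈ weilPreimage h2 hψ hP N := by
  have h1 := N.smul_mem (MonoidAlgebra.single g (1 : F)) hy
  have h3 := asModuleEquiv_single_smul h2 hψ hP g (P.asModuleEquiv.symm y)
  rw [LinearEquiv.apply_symm_apply, ← LinearEquiv.eq_symm_apply] at h3
  change toSteinbergQuotient h2 hψ hP (P.asModuleEquiv.symm (weilOp ψ g y)) ∈ N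
  rw [← h3, map_smul]
  exact h1

/-- By irreducibility of Y⁻, `1 - flip` maps the preimage of N onto Y⁻, and vectors killed by `1 -
flip` lie in the preimage anyway. Taking N = 0 determines the kernel; a general N gives simplicity
of the image. -/
theorem toSteinbergQuotient_mem (h2 : (2 : K) ≠ 0) (hψ : ψ ≠ 1) (hP : IsWeilRepresentation ψ P)
    {N : Submodule F[Sp n K] (steinbergModule n K F ⧸ steinbergSocle n K F)}
    {y : WeilSpace n K F} (hy : y ∈ weilPreimage h2 hψ hP N) (hy' : (1 - flip n K F) y ≠ 0)
    (z : WeilSpace n K F) : z ∈ weilPreimage h2 hψ hP N := by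
  obtain ⟨x, hx, hxz⟩ := exists_one_sub_flip_eq h2 hψ (weilPreimage h2 hψ hP N)
    (fun g y hy => weilOp_mem_weilPreimage h2 hψ hP g hy) hy hy' z
  have h : z - x ∈ weilPreimage h2 hψ hP N := by
    change toSteinbergQuotient h2 hψ hP (P.asModuleEquiv.symm (z - x)) ∈ N
    rw [toSteinbergQuotient_eq_zero_of_flip h2 hψ hP (by rw [map_sub, hxz, sub_self])]
    exact N.zero_mem
  have h1 := add_mem h hx
  rwa [sub_add_cancel] at h1

theorem toSteinbergQuotient_eq_zero_iff_flip (h2 : (2 : K) ≠ 0) (hψ : ψ ≠ 1) (hn : 0 < n)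
    (hP : IsWeilRepresentation ψ P) (y : WeilSpace n K F) :
    toSteinbergQuotient h2 hψ hP (P.asModuleEquiv.symm y) = 0 ↔ (1 - flip n K F) y = 0 := by
  refine ⟨fun h => ?_, toSteinbergQuotient_eq_zero_of_flip h2 hψ hP⟩
  by_contra hy
  have h1 := toSteinbergQuotient_mem h2 hψ hP (N := ⊥) (y := y)
    ((Submodule.mem_bot F[Sp n K]).2 h) hy (eps F (Pi.single ⟨0, hn⟩ 1))
  exact toSteinbergQuotient_eps_ne_zero h2 hψ hP ⟨0, hn⟩
    ((Submodule.mem_bot F[Sp n K]).1 h1)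

theorem isSimpleModule_range_toSteinbergQuotient (h2 : (2 : K) ≠ 0) (hψ : ψ ≠ 1) (hn : 0 < n)
    (hP : IsWeilRepresentation ψ P) :
    IsSimpleModule F[Sp n K] (LinearMap.range (toSteinbergQuotient h2 hψ hP)) := by
  rw [isSimpleModule_iff_isAtom]
  refine ⟨?_, fun N hN => ?_⟩
  · intro h
    have h1 : toSteinbergQuotient h2 hψ hP (P.asModuleEquiv.symm (eps F (Pi.single ⟨0, hn⟩ 1))) ∈
        LinearMap.range (toSteinbergQuotient h2 hψ hP) := ⟨_, rfl⟩
    rw [h, Submodule.mem_bot] at h1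
    exact toSteinbergQuotient_eps_ne_zero h2 hψ hP _ h1
  · by_contra hN0
    obtain ⟨x, hx, hx0⟩ := (Submodule.ne_bot_iff _).1 hN0
    obtain ⟨y, rfl⟩ := hN.le hx
    refine hN.not_ge ?_
    rintro _ ⟨z, rfl⟩
    exact toSteinbergQuotient_mem h2 hψ hP (y := P.asModuleEquiv y) hx
      (fun h => hx0 (toSteinbergQuotient_eq_zero_of_flip h2 hψ hP h)) (P.asModuleEquiv z)

theorem toSteinbergQuotient_eq_iff (h2 : (2 : K) ≠ 0) (hψ : ψ ≠ 1) (hn : 0 < n)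
    (hP : IsWeilRepresentation ψ P) (y z : P.asModule) :
    toSteinbergQuotient h2 hψ hP y = toSteinbergQuotient h2 hψ hP z ↔
      toWeilModule h2 hψ hP y = toWeilModule h2 hψ hP z := by
  have e : y = P.asModuleEquiv.symm (P.asModuleEquiv y - P.asModuleEquiv z) + z := by
    apply P.asModuleEquiv.injective
    rw [map_add, LinearEquiv.apply_symm_apply, sub_add_cancel]
  rw [Subtype.ext_iff, ← P.asModuleEquiv.injective.eq_iff, coe_toWeilModule, coe_toWeilModule,
    ← sub_eq_zero (a := (1 - flip n K F) _), ← map_sub,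
    ← toSteinbergQuotient_eq_zero_iff_flip h2 hψ hn hP]
  conv_lhs => rw [e, map_add]
  exact add_eq_right

theorem nonempty_range_equiv_weilModule (h2 : (2 : K) ≠ 0) (hψ : ψ ≠ 1) (hn : 0 < n)
    (hP : IsWeilRepresentation ψ P) :
    Nonempty (LinearMap.range (toSteinbergQuotient h2 hψ hP) ≃ₗ[F[Sp n K]] weilModule hP) :=
  nonempty_range_equiv _ _ (toWeilModule_surjective h2 hψ hP)
    (toSteinbergQuotient_eq_iff h2 hψ hn hP)

end Embedding

/-! ### Additive characters of K. -/

section AdditiveCharacters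

/-- Compose the trace to the prime field, which is not identically zero, with k ↦ ζ^k. -/
theorem exists_addChar_ne_one (p : ℕ) [Fact p.Prime] (K : Type*) [Field K] [Finite K] [CharP K p]
    {F : Type*} [Field F] {ζ : F} (hζ : IsPrimitiveRoot ζ p) : ∃ ψ : AddChar K F, ψ ≠ 1 := by
  obtain rfl : ringChar K = p := ringChar.eq_iff.2 inferInstance
  let : Algebra (ZMod (ringChar K)) K := ZMod.algebra K (ringChar K)
  obtain ⟨a, ha⟩ := FiniteField.trace_to_zmod_nondegenerate K one_ne_zero
  rw [one_mul] at ha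
  let χ : AddChar (ZMod (ringChar K)) F := AddChar.zmodChar (ringChar K) hζ.pow_eq_one
  refine ⟨χ.compAddMonoidHom (Algebra.trace (ZMod (ringChar K)) K).toAddMonoidHom, ?_⟩
  intro h
  have h1 : χ (Algebra.trace (ZMod (ringChar K)) K a) = 1 := DFunLike.congr_fun h a
  refine ha ((ZMod.val_eq_zero _).1 ?_)
  rw [AddChar.zmodChar_apply, ← pow_zero ζ] at h1
  exact hζ.pow_inj (ZMod.val_lt _) (NeZero.pos _) h1

variable {K : Type*} [Field K] [Fintype K] {F : Type*} [Field F]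

/-- Every additive character of a finite field is a multiplicative shift of a given nontrivial
one. -/
theorem exists_eq_mulShift [CharP F 2] (h2 : (2 : K) ≠ 0) {ψ : AddChar K F} (hψ : ψ ≠ 1)
    (φ : AddChar K F) : ∃ a, φ = ψ.mulShift a := by
  classical
  -- If φ is not a shift, every sum ∑_x φ(x)ψ(-ax) is 0. Summing over a first kills all terms with x
  -- ≠ 0 and leaves q = 1 in F.
  by_contra! hne
  have h1 : ∀ a, ∑ x, φ x * ψ (-(a * x)) = 0 := by
    intro a
    have h : φ * ψ.mulShift (-a) ≠ 1 := by
      intro h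
      refine hne a (DFunLike.ext _ _ fun x => ?_)
      have h3 := DFunLike.congr_fun h x
      rw [AddChar.mul_apply, AddChar.mulShift_apply, AddChar.one_apply] at h3
      have h4 : ψ (-a * x) * ψ (a * x) = 1 := by
        rw [← AddChar.map_add_eq_mul, neg_mul, neg_add_cancel, AddChar.map_zero_eq_one]
      rw [AddChar.mulShift_apply, ← mul_one (φ x), ← h4, ← mul_assoc, h3, one_mul]
    have h3 := AddChar.sum_eq_zero_of_ne_one h
    simpa [AddChar.mul_apply, AddChar.mulShift_apply] using h3
  have h3 : ∀ x : K, x ≠ 0 → ∑ a, φ x * ψ (-(a * x)) = 0 := by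
    intro x hx
    have h : ψ.mulShift (-x) ≠ 1 := by
      intro h
      refine hψ (DFunLike.ext _ _ fun t => ?_)
      have h4 := DFunLike.congr_fun h (t / -x)
      rwa [AddChar.mulShift_apply, mul_div_cancel₀ _ (neg_ne_zero.2 hx)] at h4
    have h4 := AddChar.sum_eq_zero_of_ne_one h
    rw [← Finset.mul_sum]
    convert mul_zero (φ x) using 2
    rw [← h4]
    exact Finset.sum_congr rfl fun a _ => by rw [AddChar.mulShift_apply, neg_mul, mul_comm]
  have h4 : ∑ x : K, ∑ a : K, φ x * ψ (-(a * x)) = 0 := by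
    rw [Finset.sum_comm]
    exact Finset.sum_eq_zero fun a _ => h1 a
  rw [Finset.sum_eq_single 0 (fun x _ hx => h3 x hx) (by simp)] at h4
  rw [sum_even (fun x h => eq_zero_of_neg_eq h2 x h) (add_self_eq_zero_of_module F) _ (by simp)]
    at h4
  simp at h4

theorem isSquare_mul_of_not_isSquare {a b : K} (ha : ¬ IsSquare a) (hb : ¬ IsSquare b) :
    IsSquare (a * b) := by
  classical
  have ha0 : a ≠ 0 := fun h => ha (h ▸ IsSquare.zero)
  have hb0 : b ≠ 0 := fun h => hb (h ▸ IsSquare.zero)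
  rw [← quadraticChar_one_iff_isSquare (mul_ne_zero ha0 hb0), map_mul,
    quadraticChar_neg_one_iff_not_isSquare.2 ha, quadraticChar_neg_one_iff_not_isSquare.2 hb]
  norm_num

end AdditiveCharacters

/-! ### Comparison of Weil modules of different types. -/

section Scaling

variable {n : ℕ} {K : Type*} [Field K] {F : Type*} [Field F]

/-- The map `ε_w ↦ ε_{bw}` of the Weil space. -/
def scale (n : ℕ) {K : Type*} [Field K] (F : Type*) [Field F] (b : K) :
    Module.End F (WeilSpace n K F) :=
  Finsupp.lmapDomain F F (b • ·)

theorem scale_eps (b : K) (w : Fin n → K) : scale n F b (eps F w) = eps F (b • w) := by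
  simp [scale, eps]

theorem scale_mem_weilMinus (b : K) {y : WeilSpace n K F} (hy : y ∈ weilMinus n K F) :
    scale n F b y ∈ weilMinus n K F := by
  refine Submodule.span_induction (p := fun y _ => scale n F b y ∈ weilMinus n K F) ?_ ?_ ?_ ?_ hy
  · rintro _ ⟨v, rfl⟩
    refine Submodule.subset_span ⟨b • v, ?_⟩
    simp only [map_sub, scale_eps, smul_neg]
  · rw [map_zero]
    exact zero_mem _
  · intro y z _ _ hy hz
    rw [map_add]
    exact add_mem hy hz
  · intro c y _ hy
    rw [map_smul]
    exact Submodule.smul_mem _ _ hy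

theorem scale_mul (b c : K) : scale n F b * scale n F c = scale n F (b * c) := by
  refine weilSpace_hom_ext fun w => ?_
  rw [Module.End.mul_apply, scale_eps, scale_eps, scale_eps, smul_smul]

theorem scale_one : scale n F (1 : K) = 1 := by
  refine weilSpace_hom_ext fun w => ?_
  rw [scale_eps, one_smul, Module.End.one_apply]

/-- The phase of J is quadratic in the coordinates, so scaling them by b changes the type by b². -/
theorem scale_mul_heis {ψ φ : AddChar K F} {b : K} (h : ∀ x, φ x = ψ (b ^ 2 * x))
    (x : Fin n ⊕ Fin n → K) : scale n F b * heis φ x = heis ψ (b • x) * scale n F b := by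
  refine weilSpace_hom_ext fun w => ?_
  rw [Module.End.mul_apply, heis_eps, map_smul, scale_eps, Module.End.mul_apply, scale_eps,
    heis_eps, h, smul_add]
  congr 2
  rw [Finset.mul_sum]
  refine Finset.sum_congr rfl fun i _ => ?_
  simp only [Pi.smul_apply, smul_eq_mul]
  ring

variable [Fintype K]

theorem scale_mul_weilOp {ψ φ : AddChar K F} {b : K} (hb : b ≠ 0) (h : ∀ x, φ x = ψ (b ^ 2 * x))
    (g : Sp n K) : scale n F b * weilOp φ g = weilOp ψ g * scale n F b := by
  rw [weilOp, weilOp, Finset.sum_mul, Finset.mul_sum, ← Equiv.sum_comp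
    (MulAction.toPerm (Units.mk0 b hb) : Equiv.Perm (Fin n ⊕ Fin n → K))
    (fun x => heis ψ (act g x) * heis ψ (-x) * scale n F b)]
  refine Finset.sum_congr rfl fun x _ => ?_
  have e : (MulAction.toPerm (Units.mk0 b hb) : Equiv.Perm (Fin n ⊕ Fin n → K)) x = b • x := rfl
  rw [e, act_smul, ← smul_neg, ← mul_assoc, scale_mul_heis h, mul_assoc, scale_mul_heis h,
    mul_assoc]

variable [CharP F 2] {ψ φ : AddChar K F} {P Q : Representation F (Sp n K) (WeilSpace n K F)}

/-- The homomorphism of Weil modules induced by `ε_w ↦ ε_{bw}`. -/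
def scaleHom (h2 : (2 : K) ≠ 0) (hψ : ψ ≠ 1) (hφ : φ ≠ 1) (hP : IsWeilRepresentation ψ P)
    (hQ : IsWeilRepresentation φ Q) {b : K} (hb : b ≠ 0) (h : ∀ x, φ x = ψ (b ^ 2 * x)) :
    weilModule hQ →ₗ[F[Sp n K]] weilModule hP :=
  MonoidAlgebra.equivariantOfLinearOfComm
    { toFun := fun y => ⟨P.asModuleEquiv.symm (scale n F b (Q.asModuleEquiv y)),
        scale_mem_weilMinus b y.2⟩
      map_add' := fun y z => Subtype.ext
        ((scale n F b).map_add (Q.asModuleEquiv y) (Q.asModuleEquiv z))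
      map_smul' := fun c y => Subtype.ext ((scale n F b).map_smul c (Q.asModuleEquiv y)) }
    fun g y => Subtype.ext (P.asModuleEquiv.injective (by
      change scale n F b (Q.asModuleEquiv (MonoidAlgebra.single g (1 : F) • (y : Q.asModule))) =
        P.asModuleEquiv (MonoidAlgebra.single g (1 : F) •
          P.asModuleEquiv.symm (scale n F b (Q.asModuleEquiv y)))
      rw [asModuleEquiv_single_smul h2 hφ hQ, asModuleEquiv_single_smul h2 hψ hP,
        LinearEquiv.apply_symm_apply, ← Module.End.mul_apply, ← Module.End.mul_apply,
        scale_mul_weilOp hb h]))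

theorem coe_scaleHom (h2 : (2 : K) ≠ 0) (hψ : ψ ≠ 1) (hφ : φ ≠ 1) (hP : IsWeilRepresentation ψ P)
    (hQ : IsWeilRepresentation φ Q) {b : K} (hb : b ≠ 0) (h : ∀ x, φ x = ψ (b ^ 2 * x))
    (y : weilModule hQ) : P.asModuleEquiv (scaleHom h2 hψ hφ hP hQ hb h y) =
      scale n F b (Q.asModuleEquiv y) := rfl

/-- Weil modules whose types differ by a square are isomorphic. -/
theorem nonempty_weilModule_equiv (h2 : (2 : K) ≠ 0) (hψ : ψ ≠ 1) (hφ : φ ≠ 1)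
    (hP : IsWeilRepresentation ψ P) (hQ : IsWeilRepresentation φ Q) {b : K} (hb : b ≠ 0)
    (h : ∀ x, φ x = ψ (b ^ 2 * x)) : Nonempty (weilModule hP ≃ₗ[F[Sp n K]] weilModule hQ) := by
  have h' : ∀ x, ψ x = φ (b⁻¹ ^ 2 * x) := fun x => by
    rw [h, ← mul_assoc, ← mul_pow, mul_inv_cancel₀ hb, one_pow, one_mul]
  refine ⟨LinearEquiv.ofLinearMap (scaleHom h2 hφ hψ hQ hP (inv_ne_zero hb) h')
    (scaleHom h2 hψ hφ hP hQ hb h) ?_ ?_⟩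
  · refine LinearMap.ext fun y => Subtype.ext (Q.asModuleEquiv.injective ?_)
    rw [LinearMap.comp_apply, coe_scaleHom, coe_scaleHom, ← Module.End.mul_apply, scale_mul,
      inv_mul_cancel₀ hb, scale_one]
    rfl
  · refine LinearMap.ext fun y => Subtype.ext (P.asModuleEquiv.injective ?_)
    rw [LinearMap.comp_apply, coe_scaleHom, coe_scaleHom, ← Module.End.mul_apply, scale_mul,
      mul_inv_cancel₀ hb, scale_one]
    rfl

/-- Weil modules whose types differ by a nonsquare are not isomorphic. -/
theorem isSquare_of_weilModule_equiv (h2 : (2 : K) ≠ 0) (hψ : ψ ≠ 1) (hφ : φ ≠ 1) (hn : 0 < n)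
    (hP : IsWeilRepresentation ψ P) (hQ : IsWeilRepresentation φ Q) {c : K}
    (h : ∀ x, φ x = ψ (c * x)) (e : weilModule hP ≃ₗ[F[Sp n K]] weilModule hQ) : IsSquare c := by
  let v : Fin n → K := Pi.single ⟨0, hn⟩ 1
  have hv : v ≠ -v := fun h => by
    have := eq_zero_of_neg_eq h2 v h.symm
    simp [v] at this
  let z : weilModule hP := ⟨P.asModuleEquiv.symm (eps F v - eps F (-v)),
    (mem_weilModule_iff hP).2 (Submodule.subset_span ⟨v, rfl⟩)⟩
  have hz0 : z ≠ 0 := by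
    intro hz
    have h1 : P.asModuleEquiv z = 0 := by
      rw [hz]
      rfl
    have h3 := congrArg (fun y : WeilSpace n K F => y v) h1
    change (eps F v - eps F (-v)) v = 0 at h3
    simp [eps, hv.symm] at h3
  -- The vector z = ε_v - ε_{-v} spans a line on which Sp^M acts by χ_v of type ψ. An isomorphism
  -- keeps this character, and any w in the support of the image has the same character for the type
  -- φ.
  have hsz : ∀ s ∈ fixM n K, MonoidAlgebra.single s (1 : F) • z =
      MonoidAlgebra.single (1 : Sp n K) (chi ψ (inN v) s) • z := by
    intro s hs
    refine Subtype.ext (P.asModuleEquiv.injective ?_)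
    have h1 : P.asModuleEquiv (MonoidAlgebra.single (1 : Sp n K) (chi ψ (inN v) s) •
        (z : P.asModule)) = chi ψ (inN v) s • P.asModuleEquiv (z : P.asModule) := by
      rw [Representation.asModuleEquiv_map_smul, Representation.asAlgebraHom_single, map_one]
      rfl
    rw [Submodule.coe_smul, Submodule.coe_smul, h1, asModuleEquiv_single_smul h2 hψ hP]
    change weilOp ψ s (eps F v - eps F (-v)) = chi ψ (inN v) s • (eps F v - eps F (-v))
    have h3 : chi ψ (inN (-v)) s = chi ψ (inN v) s := by
      rw [chi, chi, inN_neg, act_neg, form_neg_left, form_neg_right, neg_neg]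
    rw [map_sub, weilOp_fixM h2 hψ hs, weilOp_fixM h2 hψ hs, smul_sub, h3]
  set y : WeilSpace n K F := Q.asModuleEquiv (e z) with hy
  have hy0 : y ≠ 0 := by
    intro h0
    refine hz0 (e.injective (Subtype.ext (Q.asModuleEquiv.injective ?_)))
    rw [map_zero]
    exact h0
  obtain ⟨w, hw⟩ : ∃ w, y w ≠ 0 := by
    by_contra! h
    exact hy0 (Finsupp.ext h)
  have hw0 : w ≠ 0 := by
    rintro rfl
    exact hw (apply_zero_of_mem_weilMinus (e z).2)
  have hchi : ∀ s ∈ fixM n K, chi φ (inN w) s = chi ψ (inN v) s := by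
    intro s hs
    have h1 := congrArg (fun x => Q.asModuleEquiv (e x : Q.asModule)) (hsz s hs)
    simp only [map_smul, Submodule.coe_smul] at h1
    rw [asModuleEquiv_single_smul h2 hφ hQ, Representation.asModuleEquiv_map_smul,
      Representation.asAlgebraHom_single, map_one, ← hy] at h1
    have h3 := congrArg (fun y : WeilSpace n K F => y w) h1
    simp only [weilOp_fixM_apply h2 hφ hs, LinearMap.smul_apply, Module.End.one_apply,
      Finsupp.smul_apply, smul_eq_mul] at h3
    exact mul_right_cancel₀ hw h3
  -- On transvections along a, equality of the characters reads ψ(ct(a·w)²) = ψ(t(a·v)²); with a·w =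
  -- 1 this gives c = (a·v)².
  obtain ⟨a, ha⟩ := exists_dot_eq hw0 1
  have h1 := addChar_eq_of_forall hψ (x := c) (y := (∑ i, a i * v i) ^ 2) fun t => by
    have h3 := hchi _ (transvection_inM_mem_fixM a t)
    rwa [chi_transvection, chi_transvection, ha, one_pow, mul_one, h, mul_comm] at h3
  rw [h1]
  exact ⟨_, sq _⟩

end Scaling

end SteinbergWeil

end

/-! ### Assembly of the theorem. -/

open SteinbergWeil in
theorem mainTheorem1 (p n : ℕ) [Fact p.Prime] (hp : p ≠ 2) (hn : 0 < n)
    {K : Type*} [Field K] [Fintype K] [CharP K p]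
    {F : Type*} [Field F] [CharP F 2] (hF : ∃ ζ : F, IsPrimitiveRoot ζ p) :
    -- the socle `S` of the Steinberg module `I` affords the trivial representation
    (Module.finrank F (steinbergSocle n K F) = 1 ∧
      ∀ (g : Sp n K), ∀ x ∈ steinbergSocle n K F, MonoidAlgebra.single g (1 : F) • x = x) ∧
    -- the Weil representation of each type exists and is unique
    (∀ ψ : AddChar K F, ψ ≠ 1 →
      ∃! P : Representation F (Sp n K) (WeilSpace n K F), IsWeilRepresentation ψ P) ∧
    -- `I / S` contains two non-isomorphic irreducible submodules of dimension `(q^n - 1)/2`,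
    ∃ M₁ M₂ : Submodule F[Sp n K] (steinbergModule n K F ⧸ steinbergSocle n K F),
      IsSimpleModule F[Sp n K] M₁ ∧ IsSimpleModule F[Sp n K] M₂ ∧
      IsEmpty (M₁ ≃ₗ[F[Sp n K]] M₂) ∧
      Module.finrank F M₁ = (Fintype.card K ^ n - 1) / 2 ∧
      Module.finrank F M₂ = (Fintype.card K ^ n - 1) / 2 ∧
      -- both are Weil modules of that degree,
      (∃ ψ : AddChar K F, ψ ≠ 1 ∧ ∃ (P : Representation F (Sp n K) (WeilSpace n K F))
        (hP : IsWeilRepresentation ψ P), Nonempty (M₁ ≃ₗ[F[Sp n K]] weilModule hP)) ∧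
      (∃ ψ : AddChar K F, ψ ≠ 1 ∧ ∃ (P : Representation F (Sp n K) (WeilSpace n K F))
        (hP : IsWeilRepresentation ψ P), Nonempty (M₂ ≃ₗ[F[Sp n K]] weilModule hP)) ∧
      -- and every Weil module of that degree is isomorphic to one of the two
      (∀ ψ : AddChar K F, ψ ≠ 1 → ∀ (P : Representation F (Sp n K) (WeilSpace n K F))
        (hP : IsWeilRepresentation ψ P),
        Nonempty (M₁ ≃ₗ[F[Sp n K]] weilModule hP) ∨
          Nonempty (M₂ ≃ₗ[F[Sp n K]] weilModule hP)) := by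
  have h2 : (2 : K) ≠ 0 := by
    intro h
    have h1 : ((2 : ℕ) : K) = 0 := by exact_mod_cast h
    have h3 := (CharP.cast_eq_zero_iff K p 2).1 h1
    exact hp ((Nat.prime_dvd_prime_iff_eq Fact.out Nat.prime_two).1 h3)
  have hex := fun (ψ : AddChar K F) (hψ : ψ ≠ 1) => isWeilRepresentation_weilRep (n := n) h2 hψ
  refine ⟨⟨finrank_steinbergSocle h2, single_smul_of_mem_steinbergSocle h2⟩,
    fun ψ hψ => ⟨_, hex ψ hψ, fun P hP => weilRepresentation_unique hP (hex ψ hψ)⟩, ?_⟩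
  obtain ⟨ζ, hζ⟩ := hF
  obtain ⟨ψ₁, hψ₁⟩ := exists_addChar_ne_one p K hζ
  obtain ⟨c, hc⟩ := FiniteField.exists_nonsquare (F := K) (by rwa [ringChar.eq_iff.2 ‹CharP K p›])
  have hc0 : c ≠ 0 := fun h => hc (h ▸ IsSquare.zero)
  have hψ₂ : ψ₁.mulShift c ≠ 1 := by
    intro h
    refine hψ₁ (DFunLike.ext _ _ fun t => ?_)
    have h1 := DFunLike.congr_fun h (t / c)
    rwa [AddChar.mulShift_apply, mul_div_cancel₀ _ hc0] at h1
  obtain ⟨e₁⟩ := nonempty_range_equiv_weilModule h2 hψ₁ hn (hex _ hψ₁)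
  obtain ⟨e₂⟩ := nonempty_range_equiv_weilModule h2 hψ₂ hn (hex _ hψ₂)
  refine ⟨_, _, isSimpleModule_range_toSteinbergQuotient h2 hψ₁ hn (hex _ hψ₁),
    isSimpleModule_range_toSteinbergQuotient h2 hψ₂ hn (hex _ hψ₂), ⟨fun e => ?_⟩, ?_, ?_,
    ⟨_, hψ₁, _, _, ⟨e₁⟩⟩, ⟨_, hψ₂, _, _, ⟨e₂⟩⟩, fun φ hφ Q hQ => ?_⟩
  · exact hc (isSquare_of_weilModule_equiv h2 hψ₁ hψ₂ hn (hex _ hψ₁) (hex _ hψ₂)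
      (fun x => AddChar.mulShift_apply) (e₁.symm.trans (e.trans e₂)))
  · rw [← finrank_weilModule h2 (hex _ hψ₁)]
    exact (e₁.restrictScalars F).finrank_eq
  · rw [← finrank_weilModule h2 (hex _ hψ₂)]
    exact (e₂.restrictScalars F).finrank_eq
  · obtain ⟨a, rfl⟩ := exists_eq_mulShift h2 hψ₁ φ
    have ha0 : a ≠ 0 := by
      rintro rfl
      exact hφ (AddChar.mulShift_zero _)
    by_cases ha : IsSquare a
    · obtain ⟨b, rfl⟩ := ha
      have hb : b ≠ 0 := left_ne_zero_of_mul ha0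
      obtain ⟨f⟩ := nonempty_weilModule_equiv h2 hψ₁ hφ (hex _ hψ₁) hQ hb fun x => by
        rw [AddChar.mulShift_apply, sq]
      exact Or.inl ⟨e₁.trans f⟩
    -- With ac = d², the type ψ₁(a·) is the shift of ψ₁(c·) by a/c = (d/c)², a square.
    · obtain ⟨d, hd⟩ := isSquare_mul_of_not_isSquare ha hc
      have hd0 : d ≠ 0 := left_ne_zero_of_mul (hd ▸ mul_ne_zero ha0 hc0)
      obtain ⟨f⟩ := nonempty_weilModule_equiv h2 hψ₂ hφ (hex _ hψ₂) hQ (div_ne_zero hd0 hc0)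
        fun x => by
          rw [AddChar.mulShift_apply, AddChar.mulShift_apply]
          congr 1
          field_simp
          rw [sq, ← hd]
          ring
      exact Or.inr ⟨e₂.trans f⟩
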